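/- **Setting.** A network has $n$ anonymous nodes $v_1,\dots,v_n$ that work in synchronous rounds in the uniform gossip model: communication is only possible by push operations (send a message to a uniformly random node) and pull operations (ask a uniformly random node for a message). The *work* of a node in a round is the number of push and pull operations it executes. A *hitting set* of a collection $\mathcal S$ of $s$ subsets of $X=\{1,\dots,n\}$ is a set $H\subseteq X$ with $S\cap H\neq\emptyset$ for all $S\in\mathcal S$; let $d$ be the minimum size of a hitting set. Every node knows $\mathcal S$, $d$ and $\log n$. Initially every point of $X$ is assigned to an independent, uniformly random node; $X_0(v)$ is the set of points assigned to $v$, and $X(v)\supseteq X_0(v)$ denotes the multiset of (copies of) points currently stored at $v$. **Distributed Hitting Set Algorithm** (with a constant $c$ and $r=\lceil 6d\ln(12ds)\rceil$). In each round $i$, every node $v$ that has not halted does the following. 1. *Termination detection.* The node stores entries $(t,B,x)$, at most one for each $t$. It merges the entries received since the last round into its own: of two entries with the same $t$ the one with larger $f(B)$ is kept, where $f(B)$ is the number of sets in $\mathcal S$ that $B$ hits and ties are broken by a fixed linear order on sets; if both contain the same $B$, they are replaced by $(t,B,\min\{x,x'\})$. Then $x$ is set to $0$ in every stored entry with $f(B)<f(B\cup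 X(v))$. Entries with $t<i-c\log n$ are removed, and if a removed entry has $x=1$, the node outputs $B$ and halts. 2. *Sampling.* The node executes $\lceil c(r+\log n)\rceil$ pull operations, each of which returns a uniformly random stored copy of the contacted node, if there is one. If at least $r$ distinct copies are returned, $r$ of them are selected at random and form the multiset $R$; otherwise the sampling fails, and steps 3 and 4 are skipped. 3. If $R$ is a hitting set, the node stores the entry $(i,R,1)$. 4. Otherwise it picks a random set $S$ among the sets in $\mathcal S$ with $S\cap R=\emptyset$ and, if $W=S\cap X(v)$ has at most $c\,d\log n$ elements, pushes each element of $W$ (each one to its own random node). 5. It pushes each of its stored entries, adds the received points to $X(v)$, and keeps each copy in $X(v)\setminus X_0(v)$ with probability $1/(1+1/(2d))$, independently. **Theorem.** For every $a>0$ the following holds for every sufficiently large constant $c$ (depending on $a$): there are constants $C,\varepsilon>0$ (depending only on $a$ and $c$) such that for all $n\ge 1$, $s\ge1$ and every collection $\mathcal S$ of $s$ subsets of $X$, $|X|=n$, with minimum hitting set size $d$, where $d$ is small compared to $n$ in the sense that $d\log(12ds)\le\varepsilon n$, with probability at least $1-n^{-a}$: within $C\,d\log n$ rounds every node has halted, every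 node has output a hitting set of size at most $C\,d\log(2ds)$, and no node has had work more than $C\,(d\log(2ds)+\log n)$ in any round. (So, with high probability, the algorithm finds a hitting set of size $O(d\log(ds))$ in $O(d\log n)$ rounds with maximum work $O(d\log(ds)+\log n)$ per round, if $ds\ge2$.) The same holds for set cover: given $n$ sets $U_1,\dots,U_n$ with union $\{1,\dots,m\}$, $m\ge1$, and minimum set cover size $d$ with $d\log(12dm)\le\varepsilon n$, run the algorithm on $n$ nodes for the dual instance with the points $\{1,\dots,n\}$ and the sets $M_i=\{j : i\in U_j\}$, $i=1,\dots,m$. With probability at least $1-n^{-a}$, within $C\,d\log n$ rounds every node has halted, every node has output a set $K$ of at most $C\,d\log(2dm)$ indices such that the sets $U_j$, $j\in K$, cover $\{1,\dots,m\}$, and no node has had work more than $C\,(d\log(2dm)+\log n)$ in any round. -/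

import Mathlib

open scoped NNReal ENNReal

noncomputable section

/-! ### Hitting sets and set covers -/

/-- `H` is a hitting set of the collection `𝒮 0, …, 𝒮 (s - 1)` of subsets of `{0, …, n - 1}`. -/
def IsHittingSet {n s : ℕ} (𝒮 : Fin s → Finset (Fin n)) (H : Finset (Fin n)) : Prop :=
  ∀ j, (𝒮 j ∩ H).Nonempty

/-- `d` is the minimum size of a hitting set of `𝒮`. -/
def IsMinHittingSetSize {n s : ℕ} (𝒮 : Fin s → Finset (Fin n)) (d : ℕ) : Prop :=
  IsLeast {k | ∃ H, IsHittingSet 𝒮 H ∧ H.card = k} d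

/-- The sets `𝒰 j`, `j ∈ K`, cover the ground set `{0, …, m - 1}`. -/
def IsSetCover {m n : ℕ} (𝒰 : Fin n → Finset (Fin m)) (K : Finset (Fin n)) : Prop :=
  K.biUnion 𝒰 = Finset.univ

/-- `d` is the minimum number of sets in a set cover. -/
def IsMinSetCoverSize {m n : ℕ} (𝒰 : Fin n → Finset (Fin m)) (d : ℕ) : Prop :=
  IsLeast {k | ∃ K, IsSetCover 𝒰 K ∧ K.card = k} d

/-- The dual collection: the `i`-th set consists of all `j` with `i ∈ 𝒰 j`. -/
def dualFamily {m n : ℕ} (𝒰 : Fin n → Finset (Fin m)) : Fin m → Finset (Fin n) :=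
  fun i => Finset.univ.filter fun j => i ∈ 𝒰 j

namespace Gossip

/-! ### Random choices -/

/-- The joint law of independent random variables with laws `p 0, …, p (k - 1)`. -/
def indep {α : Type} : (k : ℕ) → (Fin k → PMF α) → PMF (Fin k → α)
  | 0, _ => PMF.pure Fin.elim0
  | k + 1, p => (p 0).bind fun a =>
      (indep k fun i => p i.succ).map fun f => (Fin.cons a f : Fin (k + 1) → α)

/-- A coin showing `true` with probability `1 / (1 + 1 / (2 d))`. -/
def keepCoin (d : ℕ) : PMF Bool :=
  PMF.ofFintype
    (fun b => cond b ((1 / (1 + 1 / (2 * d)) : ℝ≥0) : ℝ≥0∞) (1 - (1 / (1 + 1 / (2 * d)) : ℝ≥0)))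
    (by
      have h : (1 / (1 + 1 / (2 * d)) : ℝ≥0) ≤ 1 := by
        rw [one_div]
        exact inv_le_one_of_one_le₀ (le_add_of_nonneg_right bot_le)
      simp only [Fintype.sum_bool, cond_true, cond_false]
      exact add_tsub_cancel_of_le (by exact_mod_cast h))

/-- Keep every entry of a list independently with probability `1 / (1 + 1 / (2 d))`. -/
def thin {α : Type} (d : ℕ) : List α → PMF (List α)
  | [] => PMF.pure []
  | x :: l => (keepCoin d).bind fun b => (thin d l).map fun l' => if b then x :: l' else l'

/-- Push operations: every entry of the list is sent to an independent uniformly random node;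
the outcome lists the pairs (receiver, content). -/
def scatter {β : Type} (n : ℕ) [NeZero n] : List β → PMF (List (Fin n × β))
  | [] => PMF.pure []
  | x :: l => (PMF.uniformOfFintype (Fin n)).bind fun v =>
      (scatter n l).map fun l' => (v, x) :: l'

/-! ### States of the nodes -/

/-- An entry `(t, B, x)` of the termination protocol: `B` was found in iteration `t`, and the bit
`x` says whether `B` is still considered valid. -/
abbrev Entry (n : ℕ) : Type := ℕ × Finset (Fin n) × Bool

/-- The state of a node between two iterations. -/
structure NodeState (n : ℕ) where
  /-- the points initially assigned to the node -/
  orig : List (Fin n)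
  /-- the further copies of points, received later on -/
  extra : List (Fin n)
  /-- the stored entries `(t, B, x)`, at most one for each `t` -/
  entries : ℕ → Option (Finset (Fin n) × Bool)
  /-- the entries that were pushed to the node in the previous iteration -/
  inbox : List (Entry n)
  /-- the output; the node has halted as soon as there is one -/
  out : Option (Finset (Fin n))

/-- The multiset of points stored at a node. -/
def NodeState.store {n : ℕ} (v : NodeState n) : List (Fin n) := v.orig ++ v.extra

/-- The state of the network, together with the maximum work (number of push and pull operations)
that any node has performed in any single iteration so far. -/
structure Config (n : ℕ) where
  node : Fin n → NodeState n
  peak : ℕ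

/-! ### Sampling -/

/-- A stored copy of a point: the storing node, the position in its storage, and the point. -/
abbrev Copy (n : ℕ) : Type := Fin n × ℕ × Fin n

/-- A pull operation: a uniformly random node returns a uniformly random one of its stored copies,
if it has any. (The copies stored at nodes that have halted remain accessible.) -/
def pull {n : ℕ} [NeZero n] (σ : Fin n → NodeState n) : PMF (Option (Copy n)) :=
  (PMF.uniformOfFintype (Fin n)).bind fun u =>
    if h : 0 < (σ u).store.length then
      haveI : Nonempty (Fin (σ u).store.length) := ⟨⟨0, h⟩⟩
      (PMF.uniformOfFintype (Fin (σ u).store.length)).map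
        fun (k : Fin (σ u).store.length) => some (u, (k : ℕ), (σ u).store.get k)
    else PMF.pure none

/-- Perform `N` independent pull operations and select `r` distinct copies at random among the
returned ones. The outcome is the set of points occurring in this random multiset, or `none` if
fewer than `r` distinct copies have been returned. -/
def sample {n : ℕ} [NeZero n] (N r : ℕ) (σ : Fin n → NodeState n) :
    PMF (Option (Finset (Fin n))) :=
  (indep N fun _ => pull σ).bind fun a =>
    let got : Finset (Copy n) := Finset.univ.biUnion fun k => (a k).toFinset
    if h : r ≤ got.card then
      (PMF.uniformOfFinset (got.powersetCard r) (Finset.powersetCard_nonempty.2 h)).map fun Q =>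
        some (Q.image fun q => q.2.2)
    else PMF.pure none

/-- The sample size `r = ⌈6 d ln (12 d s)⌉`. -/
def sampleSize (d s : ℕ) : ℕ := ⌈6 * (d : ℝ) * Real.log (12 * d * s)⌉₊

/-- The number `⌈c (r + log n)⌉` of pull operations used for one sample. -/
def numPulls (c : ℝ) (n s d : ℕ) : ℕ := ⌈c * ((sampleSize d s : ℝ) + Real.log n)⌉₊

/-- The (indices of the) sets that are not hit by `R`. -/
def unhit {n s : ℕ} (𝒮 : Fin s → Finset (Fin n)) (R : Finset (Fin n)) : Finset (Fin s) :=
  Finset.univ.filter fun j => 𝒮 j ∩ R = ∅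

/-- The sampling part of an iteration at node `v`: sample `R`; if `R` is a hitting set, report it;
otherwise choose a random set `S` that is not hit by `R`, and let `W` consist of the copies of
elements of `S` stored at `v`. The copies in `W` are to be pushed if `|W| ≤ c d log n`. The outcome
is the pair (hitting set that was found, copies to be pushed). -/
def search {n s : ℕ} [NeZero n] (𝒮 : Fin s → Finset (Fin n)) (d : ℕ) (c : ℝ)
    (σ : Fin n → NodeState n) (v : Fin n) : PMF (Option (Finset (Fin n)) × List (Fin n)) :=
  (sample (numPulls c n s d) (sampleSize d s) σ).bind fun o =>
    match o with
    | none => PMF.pure (none, [])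
    | some R =>
      if h : (unhit 𝒮 R).Nonempty then
        (PMF.uniformOfFinset (unhit 𝒮 R) h).map fun j =>
          let W := (σ v).store.filter fun x => x ∈ 𝒮 j
          (none, if (W.length : ℝ) ≤ c * d * Real.log n then W else [])
      else PMF.pure (some R, [])

/-! ### Termination detection -/

/-- `f U` is the number of sets that are hit by `U`. -/
def hitCount {n s : ℕ} (𝒮 : Fin s → Finset (Fin n)) (U : Finset (Fin n)) : ℕ :=
  (Finset.univ.filter fun j => (𝒮 j ∩ U).Nonempty).card

/-- Candidates are compared by `f`, with a lexicographic ordering of the sets as a tie breaker. -/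
def rank {n s : ℕ} (𝒮 : Fin s → Finset (Fin n)) (B : Finset (Fin n)) :
    ℕ ×ₗ Colex (Finset (Fin n)) :=
  toLex (hitCount 𝒮 B, toColex B)

/-- Processing a received entry `(t, B, x)`. -/
def receive {n s : ℕ} (𝒮 : Fin s → Finset (Fin n))
    (e : ℕ → Option (Finset (Fin n) × Bool)) (msg : Entry n) :
    ℕ → Option (Finset (Fin n) × Bool) :=
  match msg with
  | (t, B, x) => Function.update e t <|
      match e t with
      | none => some (B, x)
      | some (B', x') =>
        if rank 𝒮 B < rank 𝒮 B' then some (B', x')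
        else if rank 𝒮 B' < rank 𝒮 B then some (B, x)
        else some (B', x && x')

/-- The stored entries at the beginning of an iteration, after all received entries have been
processed and all candidates have been checked against the points stored at the node. -/
def checked {n s : ℕ} (𝒮 : Fin s → Finset (Fin n)) (v : NodeState n) :
    ℕ → Option (Finset (Fin n) × Bool) := fun t =>
  ((v.inbox.foldl (receive 𝒮) v.entries) t).map fun Bx =>
    (Bx.1, if hitCount 𝒮 Bx.1 < hitCount 𝒮 (Bx.1 ∪ v.store.toFinset) then false else Bx.2)

/-- In iteration `i`, the entries created in iteration `t` are mature if `t < i - c log n`. -/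
def Mature (c : ℝ) (n i t : ℕ) : Prop := (t : ℝ) < (i : ℝ) - c * Real.log n

open Classical in
/-- The termination protocol of a node at the beginning of iteration `i`: mature entries are
removed, and the node outputs `B` and halts if one of them is `(t, B, 1)`. A node that has halted
does not change any more. -/
def check {n s : ℕ} (𝒮 : Fin s → Finset (Fin n)) (c : ℝ) (i : ℕ) (v : NodeState n) :
    NodeState n :=
  if v.out.isSome then v
  else
    { v with
      entries := fun t => if Mature c n i t then none else checked 𝒮 v t
      inbox := []
      out := (List.range (i + 1)).findSome? fun t =>
        if Mature c n i t then
          (checked 𝒮 v t).bind fun Bx => if Bx.2 then some Bx.1 else none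
        else none }

/-- The list of the entries stored at a node in iteration `i`. -/
def entryList {n : ℕ} (i : ℕ) (e : ℕ → Option (Finset (Fin n) × Bool)) : List (Entry n) :=
  (List.range (i + 1)).filterMap fun t => (e t).map fun Bx => (t, Bx)

/-! ### The algorithm -/

/-- What a node does in an iteration: its new state (before the pushed data is received), the
copies of points and the entries it pushes, with their receivers, and its work. -/
structure Action (n : ℕ) where
  state : NodeState n
  points : List (Fin n × Fin n)
  msgs : List (Fin n × Entry n)
  work : ℕ

/-- The action of node `v` in iteration `i`, where `σ` holds the states of all nodes after the
termination protocol has been carried out at the beginning of the iteration. A hitting set found by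
`v` is stored as the entry `(i, R, 1)`. All stored entries are pushed. -/
def act {n s : ℕ} [NeZero n] (𝒮 : Fin s → Finset (Fin n)) (d : ℕ) (c : ℝ) (i : ℕ)
    (σ : Fin n → NodeState n) (v : Fin n) : PMF (Action n) :=
  if (σ v).out.isSome then PMF.pure ⟨σ v, [], [], 0⟩
  else
    (search 𝒮 d c σ v).bind fun RW =>
      let e : ℕ → Option (Finset (Fin n) × Bool) :=
        match RW.1 with
        | none => (σ v).entries
        | some R => Function.update (σ v).entries i (some (R, true))
      (scatter n RW.2).bind fun P =>
        (scatter n (entryList i e)).map fun M =>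
          { state := { σ v with entries := e }
            points := P
            msgs := M
            work := numPulls c n s d + P.length + M.length }

/-- All contents that are sent to node `v`. -/
def delivered {n : ℕ} {β : Type} (sent : Fin n → List (Fin n × β)) (v : Fin n) : List β :=
  (List.finRange n).flatMap fun u => ((sent u).filter fun q => q.1 = v).map Prod.snd

/-- Receiving the pushed points and entries, and filtering the points that are not initial ones. -/
def absorb {n : ℕ} (d : ℕ) (a : Fin n → Action n) (v : Fin n) : PMF (NodeState n) :=
  if (a v).state.out.isSome then PMF.pure (a v).state
  else
    (thin d ((a v).state.extra ++ delivered (fun u => (a u).points) v)).map fun l =>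
      { (a v).state with
        extra := l
        inbox := delivered (fun u => (a u).msgs) v }

/-- One iteration (number `i`) of the algorithm, executed by all nodes in parallel. -/
def iteration {n s : ℕ} [NeZero n] (𝒮 : Fin s → Finset (Fin n)) (d : ℕ) (c : ℝ) (i : ℕ)
    (γ : Config n) : PMF (Config n) :=
  let σ : Fin n → NodeState n := fun v => check 𝒮 c i (γ.node v)
  (indep n fun v => act 𝒮 d c i σ v).bind fun a =>
    (indep n fun v => absorb d a v).map fun σ' =>
      { node := σ'
        peak := max γ.peak (Finset.univ.sup fun v => (a v).work) }

/-- Initially every point is assigned to an independent uniformly random node. -/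
def initial (n : ℕ) [NeZero n] : PMF (Config n) :=
  (indep n fun _ => PMF.uniformOfFintype (Fin n)).map fun place =>
    { node := fun v =>
        { orig := (List.finRange n).filter fun x => place x = v
          extra := []
          entries := fun _ => none
          inbox := []
          out := none }
      peak := 0 }

/-- The distributed hitting set algorithm with parameters `d` and `c`: the law of the configuration
after the first `T` iterations (numbered `0, …, T - 1`). -/
def run {n s : ℕ} [NeZero n] (𝒮 : Fin s → Finset (Fin n)) (d : ℕ) (c : ℝ) :
    ℕ → PMF (Config n)
  | 0 => initial n
  | T + 1 => (run 𝒮 d c T).bind (iteration 𝒮 d c T)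

/-- All nodes have halted, each of them with an output that satisfies `Good` and has size at most
`K`, and in no iteration has any node performed more than `w` push and pull operations. -/
def Success {n : ℕ} (Good : Finset (Fin n) → Prop) (K w : ℝ) (γ : Config n) : Prop :=
  (∀ v, ∃ H, (γ.node v).out = some H ∧ Good H ∧ (H.card : ℝ) ≤ K) ∧ (γ.peak : ℝ) ≤ w

end Gossip

end

/-! The network is a Markov chain, analysed as long as no node has halted. Its state is augmented
(`Tracked`) by the numbers of non-initial copies, in total (`mass`) and for each set (`setMass`),
that are expected given the past push counts, and by the iteration in which a hitting set first
appeared. Expectations are restricted to trajectories that were good so far (`killed`). By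
`ex_chain_le` it is then enough to bound, for each iteration, the probability that it is the first
bad one. The probabilistic bounds come mostly from Markov's inequality for potentials that do not
grow in expectation on good states.

Few copies. Let q = 1/(1 + 1/(2d)) be the probability of keeping a copy, so that q + q² + ... = 2d.
A set that a pull hits with probability at least 1/(5d) is missed by a sample with probability at
most 1/(6ds) (`ex_sample_misses_le_of_pullMass`). Any other set has only O(n/d) copies, provided
that few of its copies lie at nodes storing 1000 or more copies (`killed_crowded_le`,
`Balanced.copyCount_le`). Hence an iteration pushes O(n/d) copies on average, and the mass stays
O(n) (`killed_mass_le`). Conversely, a bounded mass gives bounded loads through product potentials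
that work for every adaptive choice of the pushed copies (`ex_productPot_le`). The argument is not
circular: the mass at time i depends on balance before time i, and balance at time i on the mass at
time i.

Progress. Let H be a minimum hitting set and consider the product over H of multiplicity^(-1/(2d)),
called `scarcity`. Each chosen set contains a point of H, and a node pushes all its copies of that
point. This lowers the expected scarcity by a factor 1 - 26/(100d), whereas filtering raises it by
at most 1 + 1/(4d). As scarcity stays at least 1/n, a hitting set is found within O(d log n)
iterations (`killed_found_le`).

Termination. Only true hitting sets are ever stored, so no validity bit is cleared. The first entry
spreads as a rumour: the ratio of uninformed to informed nodes shrinks by 7/8 per iteration on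
average (`ex_scatter_missed_le`), so every node knows the entry when it matures
(`killed_not_spread_le`), and all nodes halt in the same iteration. The output size is at most the
sample size. The work consists of the pulls, at most log n pushed copies, and one message for each
entry that is not mature.

Each kind of failure has probability at most n^(-(a+3)) per iteration, and there are at most n²
iterations. Set cover is the hitting set problem of the dual family. -/

set_option linter.unusedSectionVars false

open scoped NNReal ENNReal

noncomputable section

namespace Gossip

/-! ### Expectations -/

/-- The expectation of `f` under `p`. -/
def ex {α : Type} (p : PMF α) (f : α → ℝ≥0∞) : ℝ≥0∞ := ∑' a, p a * f a

open Classical in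
/-- The indicator of a proposition. -/
def ind (A : Prop) : ℝ≥0∞ := if A then 1 else 0

theorem ind_pos {A : Prop} (h : A) : ind A = 1 := if_pos h

theorem ind_neg {A : Prop} (h : ¬ A) : ind A = 0 := if_neg h

theorem ind_le_one (A : Prop) : ind A ≤ 1 := by unfold ind; split_ifs <;> simp

theorem ind_mono {A B : Prop} (h : A → B) : ind A ≤ ind B := by
  by_cases hA : A
  · rw [ind_pos (h hA)]; exact ind_le_one A
  · rw [ind_neg hA]; exact zero_le

section Expectation
variable {α β : Type}

theorem ex_pure (a : α) (f : α → ℝ≥0∞) : ex (PMF.pure a) f = f a := by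
  classical
  unfold ex
  rw [tsum_eq_single a]
  · simp
  · intro b hb; simp [hb]

theorem ex_bind (p : PMF α) (g : α → PMF β) (f : β → ℝ≥0∞) :
    ex (p.bind g) f = ex p fun a => ex (g a) f := by
  unfold ex
  simp only [PMF.bind_apply, ← ENNReal.tsum_mul_right, ← ENNReal.tsum_mul_left]
  rw [ENNReal.tsum_comm]
  simp only [mul_assoc]

theorem ex_map (p : PMF α) (g : α → β) (f : β → ℝ≥0∞) :
    ex (p.map g) f = ex p fun a => f (g a) := by
  rw [← PMF.bind_pure_comp, ex_bind]
  simp [ex_pure]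

theorem ex_mono_of_support (p : PMF α) {f g : α → ℝ≥0∞} (h : ∀ a ∈ p.support, f a ≤ g a) :
    ex p f ≤ ex p g := by
  refine ENNReal.tsum_le_tsum fun a => ?_
  by_cases ha : a ∈ p.support
  · exact mul_le_mul_right (h a ha) _
  · rw [(PMF.apply_eq_zero_iff p a).2 ha]; simp

theorem ex_mono (p : PMF α) {f g : α → ℝ≥0∞} (h : ∀ a, f a ≤ g a) : ex p f ≤ ex p g :=
  ex_mono_of_support p fun a _ => h a

theorem ex_congr_of_support (p : PMF α) {f g : α → ℝ≥0∞} (h : ∀ a ∈ p.support, f a = g a) :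
    ex p f = ex p g :=
  le_antisymm (ex_mono_of_support p fun a ha => (h a ha).le)
    (ex_mono_of_support p fun a ha => (h a ha).ge)

theorem ex_const_mul (p : PMF α) (c : ℝ≥0∞) (f : α → ℝ≥0∞) :
    (ex p fun a => c * f a) = c * ex p f := by
  unfold ex
  rw [← ENNReal.tsum_mul_left]
  exact tsum_congr fun a => by ring

theorem ex_mul_const (p : PMF α) (c : ℝ≥0∞) (f : α → ℝ≥0∞) :
    (ex p fun a => f a * c) = ex p f * c := by
  simp only [mul_comm _ c, ex_const_mul]

theorem ex_add (p : PMF α) (f g : α → ℝ≥0∞) :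
    (ex p fun a => f a + g a) = ex p f + ex p g := by
  unfold ex
  rw [← ENNReal.tsum_add]
  exact tsum_congr fun a => by ring

theorem ex_const (p : PMF α) (c : ℝ≥0∞) : (ex p fun _ => c) = c := by
  unfold ex
  rw [ENNReal.tsum_mul_right, p.tsum_coe, one_mul]

theorem ex_zero (p : PMF α) : (ex p fun _ => 0) = 0 := ex_const p 0

theorem ex_le_of_forall (p : PMF α) {f : α → ℝ≥0∞} {c : ℝ≥0∞} (h : ∀ a ∈ p.support, f a ≤ c) :
    ex p f ≤ c :=
  (ex_mono_of_support p h).trans (ex_const p c).le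

theorem ex_finset_sum {ι : Type} (t : Finset ι) (p : PMF α) (f : ι → α → ℝ≥0∞) :
    (ex p fun a => ∑ i ∈ t, f i a) = ∑ i ∈ t, ex p (f i) := by
  classical
  induction t using Finset.induction_on with
  | empty => simp [ex_zero]
  | insert i t hi ih => simp only [Finset.sum_insert hi, ex_add, ih]

theorem ex_comm (p : PMF α) (r : PMF β) (f : α → β → ℝ≥0∞) :
    (ex p fun a => ex r fun b => f a b) = ex r fun b => ex p fun a => f a b := by
  unfold ex
  simp only [← ENNReal.tsum_mul_left]
  rw [ENNReal.tsum_comm]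
  exact tsum_congr fun b => tsum_congr fun a => by ring

theorem ex_uniformOfFintype [Fintype α] [Nonempty α] (f : α → ℝ≥0∞) :
    ex (PMF.uniformOfFintype α) f = (∑ a, f a) / Fintype.card α := by
  unfold ex
  rw [tsum_fintype]
  simp only [PMF.uniformOfFintype_apply, ← Finset.mul_sum]
  rw [mul_comm, div_eq_mul_inv]

theorem ex_uniformOfFinset (t : Finset α) (ht : t.Nonempty) (f : α → ℝ≥0∞) :
    ex (PMF.uniformOfFinset t ht) f = (∑ a ∈ t, f a) / t.card := by
  classical
  unfold ex
  rw [tsum_eq_sum (s := t)]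
  · rw [Finset.sum_congr rfl fun a ha => by rw [PMF.uniformOfFinset_apply_of_mem ht ha],
      ← Finset.mul_sum, mul_comm, div_eq_mul_inv]
  · intro a ha
    rw [PMF.uniformOfFinset_apply_of_notMem ht ha, zero_mul]

theorem toOuterMeasure_eq_ex (p : PMF α) (A : Set α) :
    p.toOuterMeasure A = ex p fun a => ind (a ∈ A) := by
  classical
  rw [PMF.toOuterMeasure_apply]
  unfold ex
  refine tsum_congr fun a => ?_
  by_cases h : a ∈ A <;> simp [h, ind]

theorem ex_ind_compl (p : PMF α) (A : α → Prop) :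
    (ex p fun a => ind (A a)) + (ex p fun a => ind (¬ A a)) = 1 := by
  rw [← ex_add]
  refine Eq.trans (congrArg (ex p) (funext fun a => ?_)) (ex_const p 1)
  by_cases h : A a <;> simp [h, ind]

end Expectation

/-! ### Independent choices -/

section Indep
variable {α β : Type}

theorem ex_indep_zero (p : Fin 0 → PMF α) (f : (Fin 0 → α) → ℝ≥0∞) :
    ex (indep 0 p) f = f Fin.elim0 := ex_pure _ _

theorem ex_indep_succ (k : ℕ) (p : Fin (k + 1) → PMF α) (f : (Fin (k + 1) → α) → ℝ≥0∞) :
    ex (indep (k + 1) p) f =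
      ex (p 0) fun a => ex (indep k fun i => p i.succ) fun g => f (Fin.cons a g) := by
  simp only [indep, ex_bind, ex_map]

theorem ex_indep_prod (k : ℕ) (p : Fin k → PMF α) (f : Fin k → α → ℝ≥0∞) :
    (ex (indep k p) fun a => ∏ i, f i (a i)) = ∏ i, ex (p i) (f i) := by
  induction k with
  | zero => simp [ex_indep_zero]
  | succ k ih =>
    rw [ex_indep_succ, Fin.prod_univ_succ]
    simp only [Fin.prod_univ_succ, Fin.cons_zero, Fin.cons_succ, ex_const_mul]
    rw [ih (fun i => p i.succ) (fun i => f i.succ), ex_mul_const]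

/-- The product formula in which all other factors are constantly 1. -/
theorem ex_indep_coord (k : ℕ) (p : Fin k → PMF α) (i : Fin k) (f : α → ℝ≥0∞) :
    (ex (indep k p) fun a => f (a i)) = ex (p i) f := by
  classical
  have h := ex_indep_prod k p fun j a => if j = i then f a else 1
  have h1 : ∀ a : Fin k → α, (∏ j, if j = i then f (a j) else 1) = f (a i) := by
    intro a; rw [Finset.prod_eq_single i] <;> simp +contextual
  simp only [h1] at h
  rw [h, Finset.prod_eq_single i]
  · simp
  · intro j _ hj; simp [hj, ex_const]
  · simp

/-- This allows an iteration to be read stage by stage: all nodes make their first choice, then all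
make the second one, and so on. -/
theorem ex_indep_bind (k : ℕ) (p : Fin k → PMF α) (g : Fin k → α → PMF β)
    (f : (Fin k → β) → ℝ≥0∞) :
    ex (indep k fun i => (p i).bind (g i)) f =
      ex (indep k p) fun a => ex (indep k fun i => g i (a i)) f := by
  induction k with
  | zero => simp [ex_indep_zero]
  | succ k ih =>
    rw [ex_indep_succ, ex_bind, ex_indep_succ]
    simp only [ex_indep_succ, Fin.cons_zero, Fin.cons_succ]
    congr 1; funext a
    rw [ex_comm (indep k fun i => p i.succ)]
    congr 1; funext b
    exact ih (fun i => p i.succ) (fun i => g i.succ) (fun x => f (Fin.cons b x))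

theorem ex_indep_pure (k : ℕ) (g : Fin k → α) (f : (Fin k → α) → ℝ≥0∞) :
    ex (indep k fun i => PMF.pure (g i)) f = f g := by
  induction k with
  | zero => rw [ex_indep_zero]; congr 1; exact Subsingleton.elim _ _
  | succ k ih =>
    rw [ex_indep_succ, ex_pure, ih (fun i => g i.succ)]
    congr 1
    exact Fin.cons_self_tail g

theorem ex_indep_map (k : ℕ) (p : Fin k → PMF α) (g : Fin k → α → β)
    (f : (Fin k → β) → ℝ≥0∞) :
    ex (indep k fun i => (p i).map (g i)) f = ex (indep k p) fun a => f fun i => g i (a i) := by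
  have h : ∀ i, (p i).map (g i) = (p i).bind fun a => PMF.pure (g i a) := by
    intro i; rw [← PMF.bind_pure_comp]; rfl
  simp only [h]
  rw [ex_indep_bind]
  simp only [ex_indep_pure]

theorem mem_support_of_indep {k : ℕ} {p : Fin k → PMF α} {a : Fin k → α}
    (ha : a ∈ (indep k p).support) (i : Fin k) : a i ∈ (p i).support := by
  classical
  by_contra h
  have h1 := ex_indep_coord k p i fun x => if x = a i then 1 else 0
  have h2 : (ex (p i) fun x => if x = a i then 1 else 0) = 0 := by
    unfold ex
    rw [ENNReal.tsum_eq_zero]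
    intro x
    by_cases hx : x = a i
    · rw [hx, (PMF.apply_eq_zero_iff _ _).2 h, zero_mul]
    · simp [hx]
  rw [h2] at h1
  unfold ex at h1
  rw [ENNReal.tsum_eq_zero] at h1
  have := h1 a
  simp only [if_true, mul_one] at this
  exact ((PMF.mem_support_iff _ _).1 ha) this

end Indep

/-! ### Pushing and thinning lists -/

section Lists
variable {n : ℕ} [NeZero n] {β : Type}

theorem ex_scatter_nil (f : List (Fin n × β) → ℝ≥0∞) : ex (scatter n []) f = f [] := by
  simp only [scatter, ex_pure]

theorem ex_scatter_cons (x : β) (l : List β) (f : List (Fin n × β) → ℝ≥0∞) :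
    ex (scatter n (x :: l)) f =
      (∑ v : Fin n, ex (scatter n l) fun l' => f ((v, x) :: l')) / n := by
  rw [scatter, ex_bind, ex_uniformOfFintype, Fintype.card_fin]
  simp only [ex_map]

theorem ex_scatter_append (l₁ l₂ : List β) (f : List (Fin n × β) → ℝ≥0∞) :
    ex (scatter n (l₁ ++ l₂)) f =
      ex (scatter n l₁) fun a => ex (scatter n l₂) fun b => f (a ++ b) := by
  induction l₁ generalizing f with
  | nil => simp [ex_scatter_nil]
  | cons x l₁ ih => simp only [List.cons_append, ex_scatter_cons, ih]

theorem map_snd_of_mem_support_scatter {l : List β} {a : List (Fin n × β)}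
    (ha : a ∈ (scatter n l).support) : a.map Prod.snd = l := by
  induction l generalizing a with
  | nil => simp [scatter] at ha; simp [ha]
  | cons x l ih =>
    simp only [scatter, PMF.mem_support_bind_iff, PMF.mem_support_map_iff] at ha
    obtain ⟨v, -, b, hb, rfl⟩ := ha
    simp [ih hb]

/-- The sender of a copy is irrelevant, so the pushes of all nodes can be treated as one long list.
-/
theorem ex_indep_scatter (k : ℕ) (w : Fin k → List β) (f : List (Fin n × β) → ℝ≥0∞) :
    (ex (indep k fun i => scatter n (w i)) fun a => f (List.ofFn a).flatten) =
      ex (scatter n (List.ofFn w).flatten) f := by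
  induction k generalizing f with
  | zero => simp [ex_indep_zero, ex_scatter_nil]
  | succ k ih =>
    rw [ex_indep_succ]
    simp only [List.ofFn_succ, List.flatten_cons, Fin.cons_zero, Fin.cons_succ, ex_scatter_append]
    congr 1; funext a
    exact ih (fun i => w i.succ) fun b => f (a ++ b)

/-- The initial assignment of the points thereby becomes a push of the list of all points, and the
bounds for pushes apply to it. -/
theorem ex_scatter_ofFn (k : ℕ) (w : Fin k → β) (f : List (Fin n × β) → ℝ≥0∞) :
    (ex (indep k fun _ => PMF.uniformOfFintype (Fin n)) fun a => f (List.ofFn fun i => (a i, w i)))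
      = ex (scatter n (List.ofFn w)) f := by
  induction k generalizing f with
  | zero => simp [ex_indep_zero, ex_scatter_nil]
  | succ k ih =>
    rw [ex_indep_succ, ex_uniformOfFintype, Fintype.card_fin]
    simp only [List.ofFn_succ, Fin.cons_zero, Fin.cons_succ, ex_scatter_cons]
    congr 1
    refine Finset.sum_congr rfl fun v _ => ?_
    exact ih (fun i => w i.succ) fun b => f ((v, w 0) :: b)

end Lists

/-- The contents received by node `v`. -/
def received {n : ℕ} {β : Type} (P : List (Fin n × β)) (v : Fin n) : List β :=
  (P.filter fun z => z.1 = v).map Prod.snd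

theorem delivered_eq_received {n : ℕ} {β : Type} (sent : Fin n → List (Fin n × β)) (v : Fin n) :
    delivered sent v = received (List.ofFn sent).flatten v := by
  unfold delivered received
  rw [List.ofFn_eq_map]
  generalize List.finRange n = l
  induction l with
  | nil => simp
  | cons u l ih => simp [ih]


/-- The probability with which a copy is kept in the filtering step. -/
def keepProb (d : ℕ) : ℝ := 1 / (1 + 1 / (2 * d))

theorem keepProb_pos (d : ℕ) : 0 < keepProb d := by unfold keepProb; positivity

theorem keepProb_le_one (d : ℕ) : keepProb d ≤ 1 := by
  unfold keepProb
  rw [one_div]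
  exact inv_le_one_of_one_le₀ (le_add_of_nonneg_right (by positivity))

theorem ex_keepCoin (d : ℕ) (f : Bool → ℝ≥0∞) :
    ex (keepCoin d) f =
      ENNReal.ofReal (keepProb d) * f true + ENNReal.ofReal (1 - keepProb d) * f false := by
  have h : (((1 / (1 + 1 / (2 * d)) : ℝ≥0)) : ℝ≥0∞) = ENNReal.ofReal (keepProb d) := by
    rw [← ENNReal.ofReal_coe_nnreal]; congr 1
  unfold ex keepCoin
  rw [tsum_bool]
  simp only [PMF.ofFintype_apply, cond_true, cond_false]
  rw [h, ENNReal.ofReal_sub _ (keepProb_pos d).le, ENNReal.ofReal_one, add_comm]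

section Thin
variable {β : Type}

theorem ex_thin_nil (d : ℕ) (f : List β → ℝ≥0∞) : ex (thin d []) f = f [] := by
  simp only [thin, ex_pure]

theorem ex_thin_cons (d : ℕ) (x : β) (l : List β) (f : List β → ℝ≥0∞) :
    ex (thin d (x :: l)) f =
      ENNReal.ofReal (keepProb d) * (ex (thin d l) fun l' => f (x :: l')) +
        ENNReal.ofReal (1 - keepProb d) * ex (thin d l) f := by
  simp only [thin, ex_bind, ex_map, ex_keepCoin]
  simp

/-- A copy satisfying `p` that takes part in the filtering contributes the factor
`1 - q + q y` to the generating function of the number of remaining ones. -/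
theorem ex_thin_pow (d : ℕ) (p : β → Bool) {y : ℝ} (hy : 0 ≤ y) (l : List β) :
    (ex (thin d l) fun l' => ENNReal.ofReal (y ^ l'.countP p)) =
      ENNReal.ofReal ((1 - keepProb d + keepProb d * y) ^ l.countP p) := by
  have h0 := (keepProb_pos d).le
  have h1 := sub_nonneg.2 (keepProb_le_one d)
  induction l with
  | nil => simp [ex_thin_nil]
  | cons x l ih =>
    rw [ex_thin_cons, ih]
    by_cases hx : p x
    · simp only [List.countP_cons_of_pos hx, pow_succ, mul_comm _ y]
      simp only [ENNReal.ofReal_mul hy, ex_const_mul]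
      rw [ih, ← ENNReal.ofReal_mul hy, ← ENNReal.ofReal_mul h0, ← ENNReal.ofReal_mul h1,
        ← ENNReal.ofReal_add (by positivity) (by positivity)]
      congr 1; ring
    · simp only [List.countP_cons_of_neg hx]
      rw [ih, ← add_mul, ← ENNReal.ofReal_add h0 h1]
      simp

end Thin

/-! ### Chains that are killed outside of good states -/

section Chain
variable {α : Type}

/-- The law of a Markov chain at a given time. -/
def chain (p : PMF α) (step : ℕ → α → PMF α) : ℕ → PMF α
  | 0 => p
  | t + 1 => (chain p step t).bind (step t)

open Classical in
/-- The expectation of a function of the state at time `t`, restricted to the trajectories that are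
good at all earlier times. -/
def killed (p : PMF α) (step : ℕ → α → PMF α) (G : ℕ → α → Prop) : ℕ → (α → ℝ≥0∞) → ℝ≥0∞
  | 0, f => ex p f
  | t + 1, f => killed p step G t fun x => if G t x then ex (step t x) f else 0

variable (p : PMF α) (step : ℕ → α → PMF α) (G : ℕ → α → Prop)

theorem killed_mono (t : ℕ) {f g : α → ℝ≥0∞} (h : ∀ x, f x ≤ g x) :
    killed p step G t f ≤ killed p step G t g := by
  induction t generalizing f g with
  | zero => exact ex_mono _ h
  | succ t ih =>
    refine ih fun x => ?_
    split_ifs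
    · exact ex_mono _ h
    · exact le_rfl

theorem killed_const_mul (t : ℕ) (c : ℝ≥0∞) (f : α → ℝ≥0∞) :
    (killed p step G t fun x => c * f x) = c * killed p step G t f := by
  induction t generalizing f with
  | zero => exact ex_const_mul _ _ _
  | succ t ih =>
    simp only [killed]
    rw [← ih]
    congr 1; funext x
    split_ifs
    · exact ex_const_mul _ _ _
    · simp

theorem killed_add (t : ℕ) (f g : α → ℝ≥0∞) :
    (killed p step G t fun x => f x + g x) = killed p step G t f + killed p step G t g := by
  induction t generalizing f g with
  | zero => exact ex_add _ _ _
  | succ t ih =>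
    simp only [killed]
    rw [← ih]
    congr 1; funext x
    split_ifs
    · exact ex_add _ _ _
    · simp

theorem killed_zero (t : ℕ) : (killed p step G t fun _ => 0) = 0 := by
  have := killed_const_mul p step G t 0 fun _ => 0
  simpa using this

theorem killed_sum {ι : Type} (s : Finset ι) (t : ℕ) (f : ι → α → ℝ≥0∞) :
    (killed p step G t fun x => ∑ i ∈ s, f i x) = ∑ i ∈ s, killed p step G t (f i) := by
  classical
  induction s using Finset.induction_on with
  | empty => simp [killed_zero]
  | insert i s hi ih => simp only [Finset.sum_insert hi, killed_add, ih]

theorem killed_const_le (t : ℕ) (c : ℝ≥0∞) : (killed p step G t fun _ => c) ≤ c := by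
  induction t with
  | zero => exact (ex_const _ _).le
  | succ t ih =>
    refine (killed_mono p step G t fun x => ?_).trans ih
    split_ifs
    · exact (ex_const _ _).le
    · exact zero_le

/-- Split according to the first time at which the chain is outside `G`; from then on `f` is bounded
by 1. -/
theorem ex_chain_le (t : ℕ) {f : α → ℝ≥0∞} (hf : ∀ x, f x ≤ 1) :
    ex (chain p step t) f ≤
      (∑ i ∈ Finset.range t, killed p step G i fun x => ind (¬ G i x)) +
        killed p step G t f := by
  induction t generalizing f with
  | zero => simp [chain, killed]
  | succ t ih =>
    rw [chain, ex_bind]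
    refine (ih fun x => ex_le_of_forall _ fun a _ => hf a).trans ?_
    rw [Finset.sum_range_succ, add_assoc]
    gcongr
    rw [killed, ← killed_add]
    refine killed_mono p step G t fun x => ?_
    split_ifs with hx
    · rw [ind_neg (not_not.2 hx), zero_add]
    · rw [ind_pos hx]; simpa using ex_le_of_forall _ fun a _ => hf a

/-- The expectation of a potential that depends on the remaining time. -/
theorem killed_le_of_remaining {f : ℕ → α → ℝ≥0∞} {T : ℕ}
    (h : ∀ t x, G t x → ∀ m, t + m < T → ex (step t x) (f m) ≤ f (m + 1) x) {t m : ℕ}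
    (ht : t + m ≤ T) : killed p step G t (f m) ≤ ex p (f (m + t)) := by
  induction t generalizing m with
  | zero => exact le_rfl
  | succ t ih =>
    rw [killed]
    refine (killed_mono p step G t (g := f (m + 1)) fun x => ?_).trans ?_
    · split_ifs with hx
      · exact h t x hx m (by omega)
      · exact zero_le
    · refine (ih (m := m + 1) (by omega)).trans (le_of_eq ?_)
      congr 2; ring

/-- The variant for a potential that only makes sense from some time on, such as the spread of an
entry after its creation. -/
theorem killed_le_of_supermartingale {f : ℕ → α → ℝ≥0∞} {t₀ : ℕ}
    (h : ∀ t x, t₀ ≤ t → G t x → ex (step t x) (f (t + 1)) ≤ f t x) {t : ℕ} (ht : t₀ ≤ t) :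
    killed p step G t (f t) ≤ killed p step G t₀ (f t₀) := by
  induction t, ht using Nat.le_induction with
  | base => exact le_rfl
  | succ t ht ih =>
    refine le_trans ?_ ih
    rw [killed]
    refine killed_mono p step G t fun x => ?_
    split_ifs with hx
    · exact h t x ht hx
    · exact zero_le

/-- Markov's inequality. -/
theorem killed_markov (t : ℕ) {f : α → ℝ≥0∞} {A : α → Prop} {y b : ℝ≥0∞}
    (hA : ∀ x, A x → 1 ≤ y * f x) (hb : y * killed p step G t f ≤ b) :
    (killed p step G t fun x => ind (A x)) ≤ b := by
  refine le_trans ?_ hb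
  rw [← killed_const_mul]
  refine killed_mono p step G t fun x => ?_
  by_cases hx : A x
  · rw [ind_pos hx]; exact hA x hx
  · rw [ind_neg hx]; exact zero_le

end Chain

/-! ### Product potentials for randomly placed copies -/

/-- The left side collects the terms of the expanded product that contain at most one `δ`. -/
theorem prod_add_sum_le_prod_add {ι : Type} [DecidableEq ι] (t : Finset ι) {g δ : ι → ℝ}
    (hg : ∀ i, 0 ≤ g i) (hδ : ∀ i, 0 ≤ δ i) :
    ∏ i ∈ t, g i + ∑ w ∈ t, δ w * ∏ i ∈ t.erase w, g i ≤ ∏ i ∈ t, (g i + δ i) := by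
  induction t using Finset.induction_on with
  | empty => simp
  | insert a t ha ih =>
    rw [Finset.prod_insert ha, Finset.sum_insert ha, Finset.prod_insert ha,
      Finset.erase_insert ha]
    have h1 : ∑ w ∈ t, δ w * ∏ i ∈ (insert a t).erase w, g i =
        g a * ∑ w ∈ t, δ w * ∏ i ∈ t.erase w, g i := by
      rw [Finset.mul_sum]
      refine Finset.sum_congr rfl fun w hw => ?_
      have hwa : a ≠ w := fun h => ha (h ▸ hw)
      rw [Finset.erase_insert_of_ne hwa, Finset.prod_insert (fun h => ha (Finset.mem_of_mem_erase h))]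
      ring
    rw [h1]
    have h2 : ∏ i ∈ t, g i ≤ ∏ i ∈ t, (g i + δ i) :=
      Finset.prod_le_prod (fun i _ => hg i) fun i _ => le_add_of_nonneg_right (hδ i)
    nlinarith [hg a, hδ a, mul_le_mul_of_nonneg_left ih (hg a), mul_le_mul_of_nonneg_left h2 (hδ a)]

/-- A form of negative dependence: a copy raises the factor of only one node, and this is no worse
than giving every node its share 1/n of the increase. -/
theorem average_prod_le {n : ℕ} [NeZero n] {g g' : Fin n → ℝ} (hg : ∀ i, 0 ≤ g i)
    (hg' : ∀ i, g i ≤ g' i) :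
    (∑ w, ∏ u, if u = w then g' u else g u) / n ≤ ∏ u, (g u + (g' u - g u) / n) := by
  have hn : (0 : ℝ) < n := by exact_mod_cast Nat.pos_of_ne_zero (NeZero.ne n)
  have h := prod_add_sum_le_prod_add Finset.univ hg (δ := fun i => (g' i - g i) / n)
    (fun i => div_nonneg (sub_nonneg.2 (hg' i)) hn.le)
  refine le_trans (le_of_eq ?_) h
  have h1 : ∀ w : Fin n, (∏ u, if u = w then g' u else g u) =
      ∏ u, g u + (g' w - g w) * ∏ u ∈ Finset.univ.erase w, g u := by
    intro w
    rw [← Finset.mul_prod_erase _ _ (Finset.mem_univ w),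
      ← Finset.mul_prod_erase _ g (Finset.mem_univ w), if_pos rfl]
    rw [Finset.prod_congr rfl fun u hu => if_neg (Finset.ne_of_mem_erase hu)]
    ring
  simp only [h1, Finset.sum_add_distrib, Finset.sum_const, Finset.card_univ, Fintype.card_fin,
    nsmul_eq_mul, add_div]
  rw [mul_div_cancel_left₀ _ hn.ne', Finset.sum_div]
  congr 1
  exact Finset.sum_congr rfl fun w _ => by ring

theorem received_cons {n : ℕ} {β : Type} (v u : Fin n) (x : β) (l : List (Fin n × β)) :
    received ((v, x) :: l) u = if u = v then x :: received l u else received l u := by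
  unfold received
  by_cases h : v = u
  · subst h; simp
  · simp [h, Ne.symm h]

section
variable {n : ℕ} [NeZero n] {β : Type}

/-- Induction over the pushed copies. Each one multiplies the power it enters by at most 1 + b/n ≤
exp(b/n) on average. The assumption `Y ≤ A` keeps all factors nonnegative and increasing in the
received copies, as `average_prod_le` requires. -/
theorem ex_scatter_prod_le (p : β → Bool) {b : ℝ} (hb : 0 ≤ b) (W : List β) {A Y : Fin n → ℝ}
    (hY : ∀ u, 0 ≤ Y u) (hA : ∀ u, Y u ≤ A u) :
    (ex (scatter n W) fun P => ∏ u, ENNReal.ofReal (1 + A u * (1 + b) ^ (received P u).length -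
        Y u * (1 + b) ^ (received P u).countP p)) ≤
      ∏ u, ENNReal.ofReal (1 + A u * Real.exp (b * W.length / n) -
        Y u * Real.exp (b * W.countP p / n)) := by
  have hn : (0 : ℝ) < n := by exact_mod_cast Nat.pos_of_ne_zero (NeZero.ne n)
  induction W generalizing A Y with
  | nil => simp [ex_scatter_nil, received]
  | cons x W ih =>
    set k : ℝ := Real.exp (b * W.length / n) with hk
    set j : ℝ := Real.exp (b * W.countP p / n) with hj
    have hk0 : 0 < k := Real.exp_pos _
    have hj0 : 0 < j := Real.exp_pos _
    have hjk : j ≤ k := by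
      refine Real.exp_le_exp.2 ?_
      gcongr
      exact List.countP_le_length
    have he : 1 + b / n ≤ Real.exp (b / n) := by
      have := Real.add_one_le_exp (b / n); linarith
    have hbn : 0 ≤ b / n := by positivity
    set g : Fin n → ℝ := fun u => 1 + A u * k - Y u * j with hgdef
    set g' : Fin n → ℝ := fun u => 1 + A u * (1 + b) * k -
      Y u * (if p x then 1 + b else 1) * j with hgdef'
    have hg : ∀ u, 0 ≤ g u := fun u => by
      have := mul_le_mul (hA u) hjk hj0.le ((hY u).trans (hA u))
      simp only [hgdef]; linarith
    have hgg : ∀ u, g u ≤ g' u := fun u => by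
      have := mul_le_mul (hA u) hjk hj0.le ((hY u).trans (hA u))
      have h2 : 0 ≤ A u * k := mul_nonneg ((hY u).trans (hA u)) hk0.le
      simp only [hgdef, hgdef']
      split_ifs <;> nlinarith
    have key : ∀ v : Fin n, (ex (scatter n W) fun P =>
        ∏ u, ENNReal.ofReal (1 + A u * (1 + b) ^ (received ((v, x) :: P) u).length -
          Y u * (1 + b) ^ (received ((v, x) :: P) u).countP p)) ≤
        ENNReal.ofReal (∏ u, if u = v then g' u else g u) := by
      intro v
      have h := ih (A := fun u => if u = v then A u * (1 + b) else A u)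
        (Y := fun u => if u = v then Y u * (if p x then 1 + b else 1) else Y u)
        (fun u => by
          have := hY u
          split_ifs <;> positivity)
        (fun u => by
          have := hY u
          have := hA u
          split_ifs <;> nlinarith)
      rw [ENNReal.ofReal_prod_of_nonneg]
      · refine le_trans (le_of_eq ?_) (h.trans (le_of_eq ?_))
        · congr 1; funext P
          refine Finset.prod_congr rfl fun u _ => ?_
          rw [received_cons]
          by_cases huv : u = v
          · simp only [huv, if_true, List.length_cons]
            by_cases hx : p x
            · simp only [hx, if_true, List.countP_cons_of_pos hx, pow_succ]
              congr 1; ring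
            · simp only [hx, List.countP_cons_of_neg hx, pow_succ]
              congr 1
              simp only [Bool.false_eq_true, if_false]; ring
          · simp only [huv, if_false]
        · refine Finset.prod_congr rfl fun u _ => ?_
          by_cases huv : u = v
          · simp only [huv, if_true, hgdef']
          · simp only [huv, if_false, hgdef]
      · intro u _
        split_ifs
        · exact (hg u).trans (hgg u)
        · exact hg u
    rw [ex_scatter_cons]
    calc _ ≤ (∑ v : Fin n, ENNReal.ofReal (∏ u, if u = v then g' u else g u)) / n := by
          gcongr with v _
          exact key v
      _ = ENNReal.ofReal ((∑ v : Fin n, ∏ u, if u = v then g' u else g u) / n) := by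
          rw [ENNReal.ofReal_div_of_pos hn, ENNReal.ofReal_natCast, ENNReal.ofReal_sum_of_nonneg]
          intro v _
          refine Finset.prod_nonneg fun u _ => ?_
          split_ifs
          · exact (hg u).trans (hgg u)
          · exact hg u
      _ ≤ ENNReal.ofReal (∏ u, (g u + (g' u - g u) / n)) :=
          ENNReal.ofReal_le_ofReal (average_prod_le hg hgg)
      _ ≤ _ := by
          rw [ENNReal.ofReal_prod_of_nonneg fun u _ =>
            add_nonneg (hg u) (div_nonneg (sub_nonneg.2 (hgg u)) hn.le)]
          refine Finset.prod_le_prod' fun u _ => ENNReal.ofReal_le_ofReal ?_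
          have hAk : 0 ≤ A u * k := mul_nonneg ((hY u).trans (hA u)) hk0.le
          have hYj : Y u * j ≤ A u * k := mul_le_mul (hA u) hjk hj0.le ((hY u).trans (hA u))
          have e1 : Real.exp (b * (W.length + 1 : ℕ) / n) = k * Real.exp (b / n) := by
            rw [hk, ← Real.exp_add]; congr 1; push_cast; ring
          rw [List.length_cons, e1]
          -- A copy satisfying `p` enters both powers and scales their difference; any other copy
          -- scales only the first power.
          by_cases hx : p x
          · have e2 : Real.exp (b * (W.countP p + 1 : ℕ) / n) = j * Real.exp (b / n) := by
              rw [hj, ← Real.exp_add]; congr 1; push_cast; ring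
            rw [List.countP_cons_of_pos hx, e2]
            have e3 : g u + (g' u - g u) / n = 1 + (A u * k - Y u * j) * (1 + b / n) := by
              simp only [hgdef, hgdef', hx, if_true]; field_simp; ring
            rw [e3]
            nlinarith [mul_le_mul_of_nonneg_left he (sub_nonneg.2 hYj)]
          · rw [List.countP_cons_of_neg hx, ← hj]
            have e3 : g u + (g' u - g u) / n = 1 + A u * k * (1 + b / n) - Y u * j := by
              simp only [hgdef, hgdef', hx]
              simp only [Bool.false_eq_true, if_false]
              field_simp; ring
            rw [e3]
            nlinarith [mul_le_mul_of_nonneg_left he hAk]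

theorem ex_thin_add_pow (d : ℕ) (p : β → Bool) {b : ℝ} (hb : 0 ≤ b) (l : List β) {A Y : ℝ}
    (hY : 0 ≤ Y) (hA : Y ≤ A) :
    (ex (thin d l) fun l' => ENNReal.ofReal
        (1 + A * (1 + b) ^ l'.length - Y * (1 + b) ^ l'.countP p)) =
      ENNReal.ofReal (1 + A * (1 + keepProb d * b) ^ l.length -
        Y * (1 + keepProb d * b) ^ l.countP p) := by
  have h0 := (keepProb_pos d).le
  have h1 := sub_nonneg.2 (keepProb_le_one d)
  set q := keepProb d with hq
  have hqb : 1 ≤ 1 + q * b := le_add_of_nonneg_right (by positivity)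
  have nn : ∀ {A Y : ℝ}, 0 ≤ Y → Y ≤ A → ∀ l : List β,
      0 ≤ 1 + A * (1 + q * b) ^ l.length - Y * (1 + q * b) ^ l.countP p := by
    intro A Y hY hA l
    have : Y * (1 + q * b) ^ l.countP p ≤ A * (1 + q * b) ^ l.length :=
      mul_le_mul hA (pow_le_pow_right₀ hqb List.countP_le_length) (by positivity) (hY.trans hA)
    linarith
  induction l generalizing A Y with
  | nil => simp [ex_thin_nil]
  | cons x l ih =>
    rw [ex_thin_cons, ← hq, ih hY hA]
    have hA0 : 0 ≤ A := hY.trans hA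
    by_cases hx : p x
    · have hc : ∀ l' : List β, 1 + A * (1 + b) ^ (x :: l').length -
          Y * (1 + b) ^ (x :: l').countP p =
          1 + (A * (1 + b)) * (1 + b) ^ l'.length - (Y * (1 + b)) * (1 + b) ^ l'.countP p := by
        intro l'; rw [List.countP_cons_of_pos hx, List.length_cons]; ring
      have hA' : Y * (1 + b) ≤ A * (1 + b) := by gcongr
      have hY' : 0 ≤ Y * (1 + b) := by positivity
      simp only [hc]
      rw [ih hY' hA', ← ENNReal.ofReal_mul h0, ← ENNReal.ofReal_mul h1,
        ← ENNReal.ofReal_add (mul_nonneg h0 (nn hY' hA' l)) (mul_nonneg h1 (nn hY hA l)),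
        List.countP_cons_of_pos hx, List.length_cons]
      congr 1; ring
    · have hc : ∀ l' : List β, 1 + A * (1 + b) ^ (x :: l').length -
          Y * (1 + b) ^ (x :: l').countP p =
          1 + (A * (1 + b)) * (1 + b) ^ l'.length - Y * (1 + b) ^ l'.countP p := by
        intro l'; rw [List.countP_cons_of_neg hx, List.length_cons]; ring
      have hA' : Y ≤ A * (1 + b) := by nlinarith
      simp only [hc]
      rw [ih hY hA', ← ENNReal.ofReal_mul h0, ← ENNReal.ofReal_mul h1,
        ← ENNReal.ofReal_add (mul_nonneg h0 (nn hY hA' l)) (mul_nonneg h1 (nn hY hA l)),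
        List.countP_cons_of_neg hx, List.length_cons]
      congr 1; ring

/-- Filtering replaces `b` by `keepProb d * b` for old and new copies alike, and
`ex_scatter_prod_le` is applied with this smaller value. -/
theorem ex_scatter_thin_prod_le (d : ℕ) (p : β → Bool) {b : ℝ} (hb : 0 ≤ b) (W : List β)
    (e : Fin n → List β) {A Y : Fin n → ℝ} (hY : ∀ u, 0 ≤ Y u) (hA : ∀ u, Y u ≤ A u) :
    (ex (scatter n W) fun P => ex (indep n fun u => thin d (e u ++ received P u)) fun l =>
        ∏ u, ENNReal.ofReal (1 + A u * (1 + b) ^ (l u).length - Y u * (1 + b) ^ (l u).countP p)) ≤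
      ∏ u, ENNReal.ofReal
        (1 + A u * (1 + keepProb d * b) ^ (e u).length *
            Real.exp (keepProb d * b * W.length / n) -
          Y u * (1 + keepProb d * b) ^ (e u).countP p *
            Real.exp (keepProb d * b * W.countP p / n)) := by
  have h0 := (keepProb_pos d).le
  have hqb : 1 ≤ 1 + keepProb d * b := le_add_of_nonneg_right (by positivity)
  refine le_trans (le_of_eq ?_) (ex_scatter_prod_le p (mul_nonneg h0 hb) W
    (A := fun u => A u * (1 + keepProb d * b) ^ (e u).length)
    (Y := fun u => Y u * (1 + keepProb d * b) ^ (e u).countP p)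
    (fun u => mul_nonneg (hY u) (by positivity))
    (fun u => mul_le_mul (hA u) (pow_le_pow_right₀ hqb List.countP_le_length) (by positivity)
      ((hY u).trans (hA u))))
  congr 1; funext P
  rw [ex_indep_prod n _ fun u (l : List β) => ENNReal.ofReal
    (1 + A u * (1 + b) ^ l.length - Y u * (1 + b) ^ l.countP p)]
  refine Finset.prod_congr rfl fun u _ => ?_
  rw [ex_thin_add_pow d p hb _ (hY u) (hA u), List.length_append, List.countP_append, pow_add,
    pow_add]
  congr 1; ring

end

/-! ### The algorithm together with some bookkeeping -/

/-- A configuration, together with the expected numbers (given how many copies were pushed in each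
iteration) of further copies of all points and of the points of each set, and the number of the
first iteration in which a hitting set was found. -/
structure Tracked (n s : ℕ) where
  cfg : Config n
  mass : ℝ
  setMass : Fin s → ℝ
  found : Option ℕ

/-- No node has halted. -/
def Running {n s : ℕ} (x : Tracked n s) : Prop := ∀ v, (x.cfg.node v).out = none

section
variable {n s : ℕ}

/-- The entries after a possible new one has been added. -/
def addEntry (i : ℕ) (e : ℕ → Option (Finset (Fin n) × Bool)) (o : Option (Finset (Fin n))) :
    ℕ → Option (Finset (Fin n) × Bool) :=
  match o with
  | none => e
  | some R => Function.update e i (some (R, true))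

open Classical in
/-- The effect of the actions `a` on the bookkeeping. -/
def advance (𝒮 : Fin s → Finset (Fin n)) (d i : ℕ) (x : Tracked n s) (a : Fin n → Action n)
    (σ' : Fin n → NodeState n) : Tracked n s where
  cfg := { node := σ', peak := max x.cfg.peak (Finset.univ.sup fun v => (a v).work) }
  mass := keepProb d * (x.mass + ((List.ofFn fun v => (a v).points).flatten.map Prod.snd).length)
  setMass := fun j => keepProb d * (x.setMass j +
    ((List.ofFn fun v => (a v).points).flatten.map Prod.snd).countP (· ∈ 𝒮 j))
  found := match x.found with
    | some t => some t
    | none => if ∃ v, ((a v).state.entries i).isSome then some i else none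

variable [NeZero n]

/-- One iteration with bookkeeping. -/
def trackedStep (𝒮 : Fin s → Finset (Fin n)) (d : ℕ) (c : ℝ) (i : ℕ) (x : Tracked n s) :
    PMF (Tracked n s) :=
  (indep n fun v => act 𝒮 d c i (fun v => check 𝒮 c i (x.cfg.node v)) v).bind fun a =>
    (indep n fun v => absorb d a v).map (advance 𝒮 d i x a)

/-- The initial state with bookkeeping. -/
def trackedInit (n s : ℕ) [NeZero n] : PMF (Tracked n s) :=
  (initial n).map fun γ => ⟨γ, 0, fun _ => 0, none⟩

/-- The bookkeeping is computed from the random choices and never influences them. -/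
theorem ex_run (𝒮 : Fin s → Finset (Fin n)) (d : ℕ) (c : ℝ) (T : ℕ) (f : Config n → ℝ≥0∞) :
    ex (run 𝒮 d c T) f = ex (chain (trackedInit n s) (trackedStep 𝒮 d c) T) fun x => f x.cfg := by
  induction T generalizing f with
  | zero => simp only [run, chain, trackedInit, ex_map]
  | succ T ih =>
    rw [run, chain, ex_bind, ex_bind, ih]
    simp only [iteration, trackedStep, ex_bind, ex_map, advance]

/-- The points pushed by all nodes, given the outcomes of their searches. -/
def pushes (RW : Fin n → Option (Finset (Fin n)) × List (Fin n)) : List (Fin n) :=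
  (List.ofFn fun v => (RW v).2).flatten

/-- The action of a node, given the outcomes of its random choices. -/
def actionOf (d : ℕ) (c : ℝ) (s i : ℕ) (σ : NodeState n)
    (RW : Option (Finset (Fin n)) × List (Fin n)) (P : List (Fin n × Fin n))
    (Q : List (Fin n × Entry n)) : Action n where
  state := { σ with entries := addEntry i σ.entries RW.1 }
  points := P
  msgs := Q
  work := numPulls c n s d + P.length + Q.length

/-- The states after an iteration, given the outcomes of all random choices. -/
def nextNode (i : ℕ) (σ : Fin n → NodeState n)
    (RW : Fin n → Option (Finset (Fin n)) × List (Fin n)) 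
    (Q : Fin n → List (Fin n × Entry n)) (l : Fin n → List (Fin n)) (v : Fin n) : NodeState n :=
  { orig := (σ v).orig
    extra := l v
    entries := addEntry i (σ v).entries (RW v).1
    inbox := delivered Q v
    out := none }

/-- An iteration in which no node halts, as a sequence of random choices. -/
theorem ex_trackedStep (𝒮 : Fin s → Finset (Fin n)) (d : ℕ) (c : ℝ) (i : ℕ) (x : Tracked n s)
    {σ : Fin n → NodeState n} (hσ : σ = fun v => check 𝒮 c i (x.cfg.node v))
    (hout : ∀ v, (σ v).out = none) (F : Tracked n s → ℝ≥0∞) :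
    ex (trackedStep 𝒮 d c i x) F =
      ex (indep n fun v => search 𝒮 d c σ v) fun RW =>
        ex (indep n fun v => scatter n (RW v).2) fun P =>
          ex (indep n fun v => scatter n (entryList i (addEntry i (σ v).entries (RW v).1))) fun Q =>
            ex (indep n fun v => thin d ((σ v).extra ++ delivered P v)) fun l =>
              F (advance 𝒮 d i x (fun v => actionOf d c s i (σ v) (RW v) (P v) (Q v))
                (nextNode i σ RW Q l)) := by
  unfold trackedStep
  rw [← hσ, ex_bind]
  have hact : ∀ v, act 𝒮 d c i σ v = (search 𝒮 d c σ v).bind fun RW =>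
      (scatter n RW.2).bind fun P =>
        (scatter n (entryList i (addEntry i (σ v).entries RW.1))).map fun M =>
          actionOf d c s i (σ v) RW P M := by
    intro v
    unfold act
    rw [if_neg (by simp [hout v])]
    rfl
  simp only [hact, ex_indep_bind, ex_indep_map, ex_map]
  congr 1; funext RW
  congr 1; funext P
  congr 1; funext Q
  have habs : ∀ v, absorb d (fun v => actionOf d c s i (σ v) (RW v) (P v) (Q v)) v =
      (thin d ((σ v).extra ++ delivered P v)).map fun l =>
        { orig := (σ v).orig
          extra := l
          entries := addEntry i (σ v).entries (RW v).1
          inbox := delivered Q v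
          out := none } := by
    intro v
    unfold absorb
    rw [if_neg (by simp [actionOf, hout v])]
    simp only [actionOf, hout v]
  simp only [habs, ex_indep_map]
  rfl

theorem trackedStep_out {𝒮 : Fin s → Finset (Fin n)} {d : ℕ} {c : ℝ} {i : ℕ} {x x' : Tracked n s}
    (hx : x' ∈ (trackedStep 𝒮 d c i x).support) {v : Fin n}
    (hv : (check 𝒮 c i (x.cfg.node v)).out.isSome) :
    x'.cfg.node v = check 𝒮 c i (x.cfg.node v) := by
  unfold trackedStep at hx
  simp only [PMF.mem_support_bind_iff, PMF.mem_support_map_iff] at hx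
  obtain ⟨a, ha, σ', hσ', rfl⟩ := hx
  have h1 := mem_support_of_indep ha v
  have h2 := mem_support_of_indep hσ' v
  rw [act, if_pos hv, PMF.mem_support_pure_iff] at h1
  rw [absorb, if_pos (by rw [h1]; exact hv), PMF.mem_support_pure_iff, h1] at h2
  exact h2

/-- A node that has halted does not halt again, and there is no work left if all nodes have
halted. -/
theorem trackedStep_of_all_out {𝒮 : Fin s → Finset (Fin n)} {d : ℕ} {c : ℝ} {i : ℕ}
    {x x' : Tracked n s} (hx : x' ∈ (trackedStep 𝒮 d c i x).support)
    (hv : ∀ v, (check 𝒮 c i (x.cfg.node v)).out.isSome) :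
    x'.cfg.node = (fun v => check 𝒮 c i (x.cfg.node v)) ∧ x'.cfg.peak = x.cfg.peak := by
  refine ⟨funext fun v => trackedStep_out hx (hv v), ?_⟩
  unfold trackedStep at hx
  simp only [PMF.mem_support_bind_iff, PMF.mem_support_map_iff] at hx
  obtain ⟨a, ha, σ', hσ', rfl⟩ := hx
  have h1 : ∀ v, (a v).work = 0 := by
    intro v
    have h1 := mem_support_of_indep ha v
    rw [act, if_pos (hv v), PMF.mem_support_pure_iff] at h1
    rw [h1]
  simp [advance, h1]

/-- A function of the stored points and of the expected numbers of copies, for states in which no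
node has halted. -/
def loadPot (Φ : (Fin n → List (Fin n)) → (Fin n → List (Fin n)) → ℝ → (Fin s → ℝ) → ℝ≥0∞)
    (x : Tracked n s) : ℝ≥0∞ :=
  open Classical in
  if Running x then
    Φ (fun v => (x.cfg.node v).orig) (fun v => (x.cfg.node v).extra) x.mass x.setMass
  else 0

theorem check_orig (𝒮 : Fin s → Finset (Fin n)) (c : ℝ) (i : ℕ) (v : NodeState n) :
    (check 𝒮 c i v).orig = v.orig := by
  unfold check; split_ifs <;> rfl

theorem check_extra (𝒮 : Fin s → Finset (Fin n)) (c : ℝ) (i : ℕ) (v : NodeState n) :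
    (check 𝒮 c i v).extra = v.extra := by
  unfold check; split_ifs <;> rfl

theorem check_store (𝒮 : Fin s → Finset (Fin n)) (c : ℝ) (i : ℕ) (v : NodeState n) :
    (check 𝒮 c i v).store = v.store := by
  simp only [NodeState.store, check_orig, check_extra]

/-- A halted node never resumes. Potentials supported on running states therefore need to be studied
only in iterations in which no node halts. -/
theorem ex_trackedStep_eq_zero {𝒮 : Fin s → Finset (Fin n)} {d : ℕ} {c : ℝ} {i : ℕ}
    {x : Tracked n s} (hx : ¬ ∀ v, (check 𝒮 c i (x.cfg.node v)).out = none)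
    {F : Tracked n s → ℝ≥0∞} (hF : ∀ x, ¬ Running x → F x = 0) :
    ex (trackedStep 𝒮 d c i x) F = 0 := by
  push Not at hx
  obtain ⟨v, hv⟩ := hx
  rw [← le_zero_iff]
  refine ex_le_of_forall _ fun x' hx' => (hF x' fun h => ?_).le
  have := trackedStep_out hx' (Option.isSome_iff_ne_none.2 hv)
  exact hv (this ▸ h v)

theorem running_of_check {𝒮 : Fin s → Finset (Fin n)} {c : ℝ} {i : ℕ} {x : Tracked n s}
    (hx : ∀ v, (check 𝒮 c i (x.cfg.node v)).out = none) : Running x := by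
  intro v
  by_contra h
  have := hx v
  rw [check, if_pos (Option.isSome_iff_ne_none.2 h)] at this
  exact h this

/-- The expectation of a function of the stored points after an iteration. -/
theorem ex_trackedStep_loadPot (𝒮 : Fin s → Finset (Fin n)) (d : ℕ) (c : ℝ) (i : ℕ)
    (x : Tracked n s) (hout : ∀ v, (check 𝒮 c i (x.cfg.node v)).out = none)
    (Φ : (Fin n → List (Fin n)) → (Fin n → List (Fin n)) → ℝ → (Fin s → ℝ) → ℝ≥0∞) :
    ex (trackedStep 𝒮 d c i x) (loadPot Φ) =
      ex (indep n fun v => search 𝒮 d c (fun v => check 𝒮 c i (x.cfg.node v)) v) fun RW =>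
        ex (scatter n (pushes RW)) fun P =>
          ex (indep n fun v => thin d ((x.cfg.node v).extra ++ received P v)) fun l =>
            Φ (fun v => (x.cfg.node v).orig) l (keepProb d * (x.mass + (pushes RW).length))
              (fun j => keepProb d * (x.setMass j + (pushes RW).countP (· ∈ 𝒮 j))) := by
  rw [ex_trackedStep 𝒮 d c i x rfl hout]
  congr 1; funext RW
  have hrun : ∀ a Q l, Running (advance 𝒮 d i x a
      (nextNode i (fun v => check 𝒮 c i (x.cfg.node v)) RW Q l)) := fun a Q l v => rfl
  simp only [loadPot, hrun, if_true]
  simp only [advance, nextNode, actionOf, check_orig, check_extra, ex_const]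
  have h := ex_indep_scatter n (fun v => (RW v).2) fun P =>
    ex (indep n fun v => thin d ((x.cfg.node v).extra ++ received P v)) fun l =>
      Φ (fun v => (x.cfg.node v).orig) l (keepProb d * (x.mass + (pushes RW).length))
        (fun j => keepProb d * (x.setMass j + (pushes RW).countP (· ∈ 𝒮 j)))
  refine Eq.trans (ex_congr_of_support _ fun P hP => ?_) h
  -- The contents pushed are determined by the searches; only the receivers are random here. So the
  -- new masses do not depend on `P`.
  have hmap : (List.ofFn fun v => P v).flatten.map Prod.snd = pushes RW := by
    rw [pushes, List.map_flatten, List.map_ofFn]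
    congr 2
    funext v
    exact map_snd_of_mem_support_scatter (mem_support_of_indep hP v)
  simp only [hmap, delivered_eq_received]

/-- A bound for an iteration that holds for all possible pushes. -/
theorem ex_trackedStep_loadPot_le {𝒮 : Fin s → Finset (Fin n)} {d : ℕ} {c : ℝ} {i : ℕ}
    {x : Tracked n s}
    {Φ Φ' : (Fin n → List (Fin n)) → (Fin n → List (Fin n)) → ℝ → (Fin s → ℝ) → ℝ≥0∞}
    (h : ∀ W : List (Fin n),
      (ex (scatter n W) fun P =>
        ex (indep n fun v => thin d ((x.cfg.node v).extra ++ received P v)) fun l =>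
          Φ (fun v => (x.cfg.node v).orig) l (keepProb d * (x.mass + W.length))
            (fun j => keepProb d * (x.setMass j + W.countP (· ∈ 𝒮 j)))) ≤
        Φ' (fun v => (x.cfg.node v).orig) (fun v => (x.cfg.node v).extra) x.mass x.setMass) :
    ex (trackedStep 𝒮 d c i x) (loadPot Φ) ≤ loadPot Φ' x := by
  by_cases hout : ∀ v, (check 𝒮 c i (x.cfg.node v)).out = none
  · rw [ex_trackedStep_loadPot 𝒮 d c i x hout, loadPot, if_pos (running_of_check hout)]
    exact ex_le_of_forall _ fun RW _ => h (pushes RW)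
  · rw [ex_trackedStep_eq_zero hout fun x hx => by rw [loadPot, if_neg hx]]
    exact zero_le

end

/-! ### The loads of the nodes -/

section
variable {n : ℕ}

/-- The weight that anticipates the copies that are still to come within the budget `B n`, if the
expected number of copies is `χ` and `m` iterations remain. -/
def budgetWeight (b B : ℝ) (n d m : ℕ) (χ : ℝ) : ℝ :=
  Real.exp (b * B - b - b * keepProb d ^ m * χ / n)

/-- The exponential weight of the load of a node. -/
def loadWeight (b : ℝ) (d m : ℕ) (i j : ℕ) : ℝ := (1 + b) ^ i * (1 + b * keepProb d ^ m) ^ j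

/-- A product potential. The predicate `p` singles out the points that do not belong to a given
set. -/
def productPot (b B : ℝ) (ζ : Fin n → ℝ) (y : ℝ) (p : Fin n → Bool) (d m : ℕ)
    (o e : Fin n → List (Fin n)) (χ : ℝ) : ℝ≥0∞ :=
  ∏ u, ENNReal.ofReal (1 + ζ u * budgetWeight b B n d m χ *
      loadWeight b d m (o u).length (e u).length -
    y * (ζ u * budgetWeight b B n d m χ *
      loadWeight b d m ((o u).countP p) ((e u).countP p)))

theorem budgetWeight_pos (b B : ℝ) (n d m : ℕ) (χ : ℝ) : 0 < budgetWeight b B n d m χ :=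
  Real.exp_pos _

theorem loadWeight_pos {b : ℝ} (hb : 0 ≤ b) (d m i j : ℕ) : 0 < loadWeight b d m i j := by
  have := keepProb_pos d
  unfold loadWeight; positivity

theorem loadWeight_mono {b : ℝ} (hb : 0 ≤ b) (d m : ℕ) {i i' j j' : ℕ} (hi : i ≤ i')
    (hj : j ≤ j') : loadWeight b d m i j ≤ loadWeight b d m i' j' := by
  have h := (keepProb_pos d).le
  unfold loadWeight
  have h1 : 1 ≤ 1 + b * keepProb d ^ m := le_add_of_nonneg_right (by positivity)
  gcongr
  linarith

theorem received_ofFn (place : Fin n → Fin n) (v : Fin n) :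
    received (List.ofFn fun i => (place i, i)) v =
      (List.finRange n).filter fun x => place x = v := by
  unfold received
  rw [List.ofFn_eq_map, List.filter_map, List.map_map]
  simp [Function.comp_def]

variable [NeZero n]

/-- With m iterations left, an extra copy survives with probability q^m and has weight 1 + b q^m, so
filtering is accounted for exactly. The growth caused by pushes is paid by the budget weight, which
decreases in the mass. This holds for every list `W`, hence for adaptive choices. The budget is
charged for all of `W` while the subtracted power grows only through copies satisfying `p`; the last
factor pays for this mismatch, with `D` bounding the average weight. -/
theorem ex_productPot_le {b B : ℝ} (hb : 0 ≤ b) {ζ : Fin n → ℝ} (hζ : ∀ u, 0 ≤ ζ u) {y : ℝ}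
    (hy : 0 ≤ y) (hy1 : y ≤ 1) (p : Fin n → Bool) (d m : ℕ) (o e : Fin n → List (Fin n)) {χ D : ℝ}
    (hD : y * ∑ u, ζ u * budgetWeight b B n d (m + 1) χ *
      loadWeight b d (m + 1) (o u).length (e u).length ≤ n * D) (W : List (Fin n)) :
    (ex (scatter n W) fun P => ex (indep n fun u => thin d (e u ++ received P u)) fun l =>
      productPot b B ζ y p d m o l (keepProb d * (χ + W.length))) ≤
      productPot b B ζ y p d (m + 1) o e χ *
        ENNReal.ofReal (Real.exp (D * (b * keepProb d ^ (m + 1) * W.countP (fun x => ¬ p x)))) := by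
  have hn : (0 : ℝ) < n := by exact_mod_cast Nat.pos_of_ne_zero (NeZero.ne n)
  have hq := keepProb_pos d
  set q := keepProb d with hqd
  set w := budgetWeight b B n d m (q * (χ + W.length)) with hw
  set w' := budgetWeight b B n d (m + 1) χ with hw'
  have hw0 : 0 < w := Real.exp_pos _
  have hw'0 : 0 < w' := Real.exp_pos _
  have hbm : 0 ≤ b * q ^ m := by positivity
  have h := ex_scatter_thin_prod_le d p hbm W e
    (A := fun u => ζ u * w * (1 + b) ^ (o u).length)
    (Y := fun u => y * (ζ u * w * (1 + b) ^ (o u).countP p))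
    (fun u => by have := hζ u; positivity)
    (fun u => by
      have := hζ u
      have h1 : (1 + b) ^ (o u).countP p ≤ (1 + b) ^ (o u).length :=
        pow_le_pow_right₀ (by linarith) List.countP_le_length
      have h2 : ζ u * w * (1 + b) ^ (o u).countP p ≤ ζ u * w * (1 + b) ^ (o u).length := by gcongr
      have h3 : 0 ≤ ζ u * w * (1 + b) ^ (o u).countP p := by positivity
      nlinarith)
  refine le_trans (le_of_eq ?_) (h.trans ?_)
  · congr 1; funext P; congr 1; funext l
    refine Finset.prod_congr rfl fun u _ => ?_
    congr 1
    simp only [loadWeight, ← hqd, ← hw]; ring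
  -- The budget weight loses exactly the factor by which the pushes increase the weights.
  have hww : w * Real.exp (b * q ^ (m + 1) * W.length / n) = w' := by
    rw [hw, hw', budgetWeight, budgetWeight, ← Real.exp_add, ← hqd]
    congr 1; field_simp; ring
  set N : ℝ := ((W.countP (fun x => ¬ p x) : ℕ) : ℝ) with hN
  have hlen : (W.length : ℝ) = W.countP p + N := by
    rw [hN]; exact_mod_cast List.length_eq_countP_add_countP p
  set Z : Fin n → ℝ := fun u => y * (ζ u * w' * loadWeight b d (m + 1) ((o u).countP p)
    ((e u).countP p)) with hZ
  have hZ0 : ∀ u, 0 ≤ Z u := fun u => by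
    have := hζ u; have := loadWeight_pos hb d (m + 1) ((o u).countP p) ((e u).countP p)
    simp only [hZ]; positivity
  set X : Fin n → ℝ := fun u => ζ u * w' * loadWeight b d (m + 1) (o u).length (e u).length with hX
  have hZX : ∀ u, Z u ≤ y * X u := fun u => by
    have := hζ u
    have := loadWeight_mono hb d (m + 1) (List.countP_le_length (p := p) (l := o u))
      (List.countP_le_length (p := p) (l := e u))
    simp only [hZ, hX]; gcongr
  have hX0 : ∀ u, 0 ≤ X u := fun u => by
    have := hζ u; have := loadWeight_pos hb d (m + 1) (o u).length (e u).length
    simp only [hX]; positivity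
  have hZX' : ∀ u, Z u ≤ X u := fun u => (hZX u).trans (by nlinarith [hX0 u])
  set δ : ℝ := b * q ^ (m + 1) * N / n with hδ
  have hδ0 : 0 ≤ δ := by positivity
  -- The subtracted term `Z` shrinks to Z exp(-δ), and 1 + X - Z exp(-δ) ≤ 1 + X - Z + Zδ ≤ (1 + X -
  -- Z) exp(Zδ), because Z ≤ X.
  have step : ∀ u, 1 + ζ u * w * (1 + b) ^ (o u).length * (1 + q * (b * q ^ m)) ^ (e u).length *
        Real.exp (q * (b * q ^ m) * W.length / n) -
      y * (ζ u * w * (1 + b) ^ (o u).countP p) * (1 + q * (b * q ^ m)) ^ (e u).countP p *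
        Real.exp (q * (b * q ^ m) * W.countP p / n) ≤ (1 + X u - Z u) * Real.exp (Z u * δ) := by
    intro u
    have e1 : q * (b * q ^ m) = b * q ^ (m + 1) := by ring
    have e2 : Real.exp (q * (b * q ^ m) * W.countP p / n) =
        Real.exp (b * q ^ (m + 1) * W.length / n) * Real.exp (-δ) := by
      rw [← Real.exp_add, e1, hδ, hlen]; congr 1; ring
    rw [e2, e1]
    have e3 : ζ u * w * (1 + b) ^ (o u).length * (1 + b * q ^ (m + 1)) ^ (e u).length *
        Real.exp (b * q ^ (m + 1) * W.length / n) = X u := by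
      simp only [hX, loadWeight, ← hww, ← hqd]; ring
    have e4 : y * (ζ u * w * (1 + b) ^ (o u).countP p) *
        (1 + b * q ^ (m + 1)) ^ (e u).countP p *
        (Real.exp (b * q ^ (m + 1) * W.length / n) * Real.exp (-δ)) = Z u * Real.exp (-δ) := by
      simp only [hZ, loadWeight, ← hww, ← hqd]; ring
    rw [e3, e4]
    have h1 : 1 - δ ≤ Real.exp (-δ) := by have := Real.add_one_le_exp (-δ); linarith
    have h2 : 1 + Z u * δ ≤ Real.exp (Z u * δ) := by
      have := Real.add_one_le_exp (Z u * δ); linarith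
    have h3 : 0 ≤ Z u * δ := mul_nonneg (hZ0 u) hδ0
    nlinarith [mul_le_mul_of_nonneg_left h1 (hZ0 u), hZX' u,
      mul_le_mul_of_nonneg_left h2 (by linarith [hZX' u] : 0 ≤ 1 + X u - Z u),
      mul_nonneg (sub_nonneg.2 (hZX' u)) h3]
  calc _ ≤ ∏ u, ENNReal.ofReal ((1 + X u - Z u) * Real.exp (Z u * δ)) :=
        Finset.prod_le_prod' fun u _ => ENNReal.ofReal_le_ofReal (step u)
    _ = productPot b B ζ y p d (m + 1) o e χ * ENNReal.ofReal (Real.exp (∑ u, Z u * δ)) := by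
        rw [Real.exp_sum, ENNReal.ofReal_prod_of_nonneg fun u _ => (Real.exp_pos _).le, productPot,
          ← Finset.prod_mul_distrib]
        refine Finset.prod_congr rfl fun u _ => ?_
        rw [ENNReal.ofReal_mul]
        linarith [hZX' u]
    _ ≤ _ := by
        gcongr
        rw [← Finset.sum_mul]
        have h1 : ∑ u, Z u ≤ n * D := (Finset.sum_le_sum fun u _ => hZX u).trans
          (by rw [← Finset.mul_sum]; exact hD)
        calc (∑ u, Z u) * δ ≤ n * D * δ := by gcongr
          _ = _ := by rw [hδ]; field_simp

theorem ex_trackedInit (s : ℕ) (F : Tracked n s → ℝ≥0∞) :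
    ex (trackedInit n s) F = ex (scatter n (List.finRange n)) fun P =>
      F ⟨⟨fun v => ⟨received P v, [], fun _ => none, [], none⟩, 0⟩, 0, fun _ => 0, none⟩ := by
  have h := ex_scatter_ofFn n (fun i : Fin n => i) fun P =>
    F ⟨⟨fun v => ⟨received P v, [], fun _ => none, [], none⟩, 0⟩, 0, fun _ => 0, none⟩
  rw [show (List.ofFn fun i : Fin n => i) = List.finRange n from List.ofFn_id n] at h
  rw [trackedInit, initial, ex_map, ex_map]
  refine Eq.trans ?_ h
  simp only [received_ofFn]

/-- The n initial points contribute a factor exp(b) to each weight, which cancels the term -b in the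
exponent of the budget weight. -/
theorem ex_init_productPot_le {b B : ℝ} (hb : 0 ≤ b) {ζ : Fin n → ℝ} (hζ : ∀ u, 0 ≤ ζ u) {y : ℝ}
    (hy : 0 ≤ y) (hy1 : y ≤ 1) (p : Fin n → Bool) (d m : ℕ) :
    (ex (scatter n (List.finRange n)) fun P => productPot b B ζ y p d m (received P) (fun _ => [])
      0) ≤ ∏ u, ENNReal.ofReal (1 + ζ u * Real.exp (b * B) *
        (1 - y * Real.exp (-(b * (List.finRange n).countP (fun x => ¬ p x) / n)))) := by
  have hn : (0 : ℝ) < n := by exact_mod_cast Nat.pos_of_ne_zero (NeZero.ne n)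
  set w := budgetWeight b B n d m 0 with hw
  have hw0 : 0 < w := Real.exp_pos _
  have h := ex_scatter_prod_le p hb (List.finRange n) (A := fun u => ζ u * w)
    (Y := fun u => y * (ζ u * w)) (fun u => by have := hζ u; positivity)
    (fun u => by
      have : 0 ≤ ζ u * w := mul_nonneg (hζ u) hw0.le
      nlinarith)
  refine le_trans (le_of_eq ?_) (h.trans (le_of_eq ?_))
  · congr 1; funext P
    refine Finset.prod_congr rfl fun u _ => ?_
    congr 1
    simp only [loadWeight, ← hw, List.length_nil, List.countP_nil, pow_zero, mul_one]; ring
  · refine Finset.prod_congr rfl fun u _ => ?_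
    congr 1
    have hlen : (n : ℝ) = ((List.finRange n).countP p : ℕ) +
        (((List.finRange n).countP fun x => ¬ p x : ℕ) : ℝ) := by
      have := List.length_eq_countP_add_countP p (l := List.finRange n)
      rw [List.length_finRange] at this
      exact_mod_cast this
    have e1 : w * Real.exp (b * (List.finRange n).length / n) = Real.exp (b * B) := by
      rw [hw, budgetWeight, ← Real.exp_add, List.length_finRange]
      congr 1; field_simp; ring
    have e2 : Real.exp (b * (List.finRange n).countP p / n) =
        Real.exp (b * (List.finRange n).length / n) *
          Real.exp (-(b * (List.finRange n).countP (fun x => ¬ p x) / n)) := by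
      rw [← Real.exp_add, List.length_finRange]
      congr 1
      nth_rw 2 [hlen]
      field_simp; ring
    rw [e2, ← e1]; ring

end

/-! ### Tail bounds for the loads -/

section
variable {n s : ℕ}

/-- The copies of points of `S` that are stored at nodes with at least `M` copies. -/
def crowded (S : Finset (Fin n)) (M : ℕ) (x : Tracked n s) : ℕ :=
  ∑ u, if M ≤ (x.cfg.node u).store.length then (x.cfg.node u).store.countP (· ∈ S) else 0

/-- The number of non-initial copies of points of `S`. -/
def extraCount (S : Finset (Fin n)) (x : Tracked n s) : ℕ :=
  ∑ u, (x.cfg.node u).extra.countP (· ∈ S)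

theorem budgetWeight_le {b B χ : ℝ} (hb : 0 ≤ b) (hχ : 0 ≤ χ) (d m : ℕ) :
    budgetWeight b B n d m χ ≤ Real.exp (b * B) := by
  have := keepProb_pos d
  refine Real.exp_le_exp.2 ?_
  have : 0 ≤ b * keepProb d ^ m * χ / n := by positivity
  linarith

theorem countP_not (S : Finset (Fin n)) (l : List (Fin n)) :
    l.countP (fun x => ¬ (decide (x ∉ S)) = true) = l.countP (· ∈ S) := by
  congr 1; funext x; simp

theorem countP_finRange (S : Finset (Fin n)) : (List.finRange n).countP (· ∈ S) = S.card := by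
  rw [List.countP_eq_length_filter, ← List.toFinset_card_of_nodup
    ((List.nodup_finRange n).filter _)]
  congr 1; ext x; simp

variable [NeZero n] {𝒮 : Fin s → Finset (Fin n)} {d : ℕ} {c : ℝ}

/-- With `y = 0` nothing is subtracted, so `D = 0` is admissible and no property of the good states
is needed. -/
theorem killed_productPot_le (G : ℕ → Tracked n s → Prop) {b B : ℝ} (hb : 0 ≤ b) {ζ : Fin n → ℝ}
    (hζ : ∀ u, 0 ≤ ζ u) (t m : ℕ) :
    killed (trackedInit n s) (trackedStep 𝒮 d c) G t
      (loadPot fun o e χ _ => productPot b B ζ 0 (fun _ => true) d m o e χ) ≤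
      ∏ u, ENNReal.ofReal (1 + ζ u * Real.exp (b * B)) := by
  have h := killed_le_of_remaining (trackedInit n s) (trackedStep 𝒮 d c) G
    (f := fun m => loadPot fun o e χ _ => productPot b B ζ 0 (fun _ => true) d m o e χ)
    (T := t + m) (fun t x _ m _ => ex_trackedStep_loadPot_le fun W => by
      refine (ex_productPot_le hb hζ le_rfl zero_le_one _ d m _ _ (D := 0) (by simp) W).trans ?_
      simp) (t := t) (m := m) le_rfl
  refine h.trans ?_
  rw [ex_trackedInit]
  have h2 := ex_init_productPot_le (B := B) hb hζ le_rfl zero_le_one (fun _ => true) d (m + t)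
  simp only [zero_mul, sub_zero, mul_one] at h2
  refine le_trans (ex_mono _ fun P => ?_) h2
  unfold loadPot
  split_ifs
  · exact le_rfl
  · exact zero_le

theorem one_le_budgetWeight {b B χ : ℝ} (hb : 0 ≤ b) (hχ : χ ≤ (B - 1) * n) (d : ℕ) :
    1 ≤ budgetWeight b B n d 0 χ := by
  have hn : (0 : ℝ) < n := by exact_mod_cast Nat.pos_of_ne_zero (NeZero.ne n)
  rw [budgetWeight, Real.one_le_exp_iff, pow_zero, mul_one, mul_div_assoc]
  have : χ / n ≤ B - 1 := (div_le_iff₀ hn).2 hχ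
  nlinarith

/-- The product potential concentrated on the node `u`. At the end the budget weight is at least 1
because the mass is at most (B - 1)n. -/
theorem killed_load_le (G : ℕ → Tracked n s → Prop) {b B Z : ℝ} (hb : 0 ≤ b) (hZ : 0 < Z)
    (t : ℕ) (u : Fin n) :
    (killed (trackedInit n s) (trackedStep 𝒮 d c) G t fun x =>
      ind (Running x ∧ x.mass ≤ (B - 1) * n ∧ Z ≤ (1 + b) ^ (x.cfg.node u).store.length)) ≤ ENNReal.ofReal ((1 + Real.exp (b * B)) / Z) := by
  have h := killed_productPot_le (𝒮 := 𝒮) (d := d) (c := c) G (B := B) hb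
    (ζ := fun v => if v = u then 1 else 0) (fun v => by split_ifs <;> norm_num) t 0
  refine killed_markov _ _ _ t (y := ENNReal.ofReal (1 / Z)) (fun x hx => ?_)
    (le_trans (mul_le_mul_right h _) ?_)
  · obtain ⟨h1, h2, h3⟩ := hx
    rw [loadPot, if_pos h1, productPot, ← Finset.mul_prod_erase _ _ (Finset.mem_univ u)]
    rw [Finset.prod_eq_one (s := Finset.univ.erase u) fun v hv => by
      simp [Finset.ne_of_mem_erase hv]]
    rw [mul_one, ← ENNReal.ofReal_mul (by positivity), ENNReal.one_le_ofReal, one_div,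
      ← div_eq_inv_mul, le_div_iff₀ hZ, one_mul]
    simp only [if_true, one_mul, zero_mul, sub_zero]
    have h4 := one_le_budgetWeight hb h2 d
    have h5 : loadWeight b d 0 (x.cfg.node u).orig.length (x.cfg.node u).extra.length =
        (1 + b) ^ (x.cfg.node u).store.length := by
      simp [loadWeight, NodeState.store, pow_add]
    rw [h5]
    have h6 : 0 < (1 + b) ^ (x.cfg.node u).store.length := by positivity
    nlinarith
  · rw [← Finset.mul_prod_erase _ _ (Finset.mem_univ u)]
    rw [Finset.prod_eq_one (s := Finset.univ.erase u) fun v hv => by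
      simp [Finset.ne_of_mem_erase hv]]
    rw [mul_one, ← ENNReal.ofReal_mul (by positivity)]
    refine ENNReal.ofReal_le_ofReal (le_of_eq ?_)
    simp only [if_true]; ring

theorem exp_half_le_one_add {x : ℝ} (h0 : 0 ≤ x) (h1 : x ≤ 1) : Real.exp (x / 2) ≤ 1 + x := by
  have h := Real.add_one_le_exp (-(x / 2))
  have h2 : Real.exp (x / 2) * Real.exp (-(x / 2)) = 1 := by rw [← Real.exp_add]; simp
  nlinarith [Real.exp_pos (x / 2)]

/-- A bound for the average weight, needed as `D` in `ex_productPot_le`. On the event the potential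
is at least exp(3n/(2Z)), whereas its expectation is at most exp(n/Z). -/
theorem killed_loadWeight_le (G : ℕ → Tracked n s → Prop) {b B Z : ℝ} (hb : 0 ≤ b) (hZ : 0 < Z)
    (t m : ℕ) :
    (killed (trackedInit n s) (trackedStep 𝒮 d c) G t fun x =>
      ind (Running x ∧ 0 ≤ x.mass ∧ (∀ u, (1 + b) ^ (x.cfg.node u).store.length ≤ Z) ∧
        3 * n * Real.exp (b * B) ≤ ∑ u, budgetWeight b B n d m x.mass *
          loadWeight b d m (x.cfg.node u).orig.length (x.cfg.node u).extra.length)) ≤ ENNReal.ofReal (Real.exp (-(n / (2 * Z)))) := by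
  have hn : (0 : ℝ) < n := by exact_mod_cast Nat.pos_of_ne_zero (NeZero.ne n)
  have hq := keepProb_pos d
  -- Scaled so that every summand `X u` is at most 1, where 1 + x ≥ exp(x/2) applies.
  set ζ : ℝ := (Real.exp (b * B))⁻¹ / Z with hζ
  have hζ0 : 0 < ζ := by positivity
  have hζB : ζ * Real.exp (b * B) = 1 / Z := by rw [hζ]; field_simp
  have h := killed_productPot_le (𝒮 := 𝒮) (d := d) (c := c) G (B := B) hb
    (ζ := fun _ => ζ) (fun v => hζ0.le) t m
  refine killed_markov _ _ _ t (y := ENNReal.ofReal (Real.exp (-(3 * n / (2 * Z)))))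
    (fun x hx => ?_) (le_trans (mul_le_mul_right h _) ?_)
  · obtain ⟨h1, h2, h3, h4⟩ := hx
    rw [loadPot, if_pos h1]
    set X : Fin n → ℝ := fun u => ζ * (budgetWeight b B n d m x.mass *
          loadWeight b d m (x.cfg.node u).orig.length (x.cfg.node u).extra.length) with hX
    have hX0 : ∀ u, 0 ≤ X u := fun u => by
      have := loadWeight_pos hb d m (x.cfg.node u).orig.length (x.cfg.node u).extra.length
      have := budgetWeight_pos b B n d m x.mass
      simp only [hX]; positivity
    have hX1 : ∀ u, X u ≤ 1 := fun u => by
      have e1 : loadWeight b d m (x.cfg.node u).orig.length (x.cfg.node u).extra.length ≤ Z := by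
        refine le_trans ?_ (h3 u)
        rw [NodeState.store, List.length_append, pow_add, loadWeight]
        gcongr
        exact mul_le_of_le_one_right hb (pow_le_one₀ hq.le (keepProb_le_one d))
      have e2 := budgetWeight_le (n := n) (B := B) hb h2 d m
      have := loadWeight_pos hb d m (x.cfg.node u).orig.length (x.cfg.node u).extra.length
      calc X u ≤ ζ * (Real.exp (b * B) * Z) := by simp only [hX]; gcongr
        _ = 1 := by rw [← mul_assoc, hζB]; field_simp
    have h5 : ∏ u, ENNReal.ofReal (Real.exp (X u / 2)) ≤
        productPot b B (fun _ => ζ) 0 (fun _ => true) d m (fun v => (x.cfg.node v).orig)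
          (fun v => (x.cfg.node v).extra) x.mass := by
      refine Finset.prod_le_prod' fun u _ => ENNReal.ofReal_le_ofReal ?_
      refine (exp_half_le_one_add (hX0 u) (hX1 u)).trans (le_of_eq ?_)
      simp only [hX]; ring
    refine le_trans ?_ (mul_le_mul_right h5 _)
    rw [← ENNReal.ofReal_prod_of_nonneg fun u _ => (Real.exp_pos _).le, ← Real.exp_sum,
      ← ENNReal.ofReal_mul (Real.exp_pos _).le, ← Real.exp_add, ENNReal.one_le_ofReal,
      Real.one_le_exp_iff, ← Finset.sum_div]
    have h6 : 3 * n / Z ≤ ∑ u, X u := by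
      rw [← Finset.mul_sum]
      calc 3 * n / Z = ζ * (3 * n * Real.exp (b * B)) := by
            rw [mul_comm (3 * (n : ℝ)), ← mul_assoc, hζB]; ring
        _ ≤ _ := by gcongr
    have h7 : 3 * (n : ℝ) / (2 * Z) = 3 * n / Z / 2 := by field_simp
    rw [h7]; linarith
  · rw [← ENNReal.ofReal_prod_of_nonneg fun u _ => by positivity,
      ← ENNReal.ofReal_mul (Real.exp_pos _).le]
    refine ENNReal.ofReal_le_ofReal ?_
    have h8 : ∏ _u : Fin n, (1 + ζ * Real.exp (b * B)) ≤ Real.exp (n / Z) := by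
      rw [hζB, Finset.prod_const, Finset.card_univ, Fintype.card_fin]
      calc (1 + 1 / Z) ^ n ≤ Real.exp (1 / Z) ^ n := by
            gcongr; linarith [Real.add_one_le_exp (1 / Z)]
        _ = _ := by rw [← Real.exp_nat_mul]; congr 1; ring
    calc _ ≤ Real.exp (-(3 * n / (2 * Z))) * Real.exp (n / Z) := by gcongr
      _ = _ := by rw [← Real.exp_add]; congr 1; field_simp; ring

/-- For L = 1000 + j the left side is at most 2x with x = exp(j/1000), and 2x ≤ 1 + x² ≤ 1 +
(5/4)^j. A crowded node can thus be credited log 2 / 1000 per copy in the exponent. -/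
theorem two_pow_le_one_add {M k L : ℕ} (hM : M = 1000) (hL : M ≤ L) (hk : k ≤ L) :
    Real.exp (Real.log 2 * k / M) ≤ 1 + (5 / 4 : ℝ) ^ ((L : ℤ) - M) := by
  subst hM
  obtain ⟨j, rfl⟩ := Nat.exists_eq_add_of_le hL
  have e0 : (((1000 + j : ℕ) : ℤ) - (1000 : ℕ)) = (j : ℤ) := by push_cast; ring
  rw [e0, zpow_natCast]
  have hl0 : 0 < Real.log 2 := Real.log_pos (by norm_num)
  have hl1 : Real.log 2 ≤ 1 := by have := Real.log_two_lt_d9; linarith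
  have h1 : Real.exp (Real.log 2 * k / (1000 : ℕ)) ≤ 2 * Real.exp (j / 1000) := by
    nth_rw 2 [← Real.exp_log (show (0 : ℝ) < 2 by norm_num)]
    rw [← Real.exp_add]
    refine Real.exp_le_exp.2 ?_
    have : (k : ℝ) ≤ 1000 + j := by exact_mod_cast hk
    push_cast
    have : Real.log 2 * k ≤ Real.log 2 * (1000 + j) := by gcongr
    have : Real.log 2 * j ≤ 1 * j := by gcongr
    linarith
  refine h1.trans ?_
  have h2 : Real.exp (1 / 500) ≤ 5 / 4 := by
    have := exp_half_le_one_add (x := 1 / 250) (by norm_num) (by norm_num)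
    norm_num at this ⊢; linarith
  have h3 : Real.exp (j / 1000 : ℝ) ^ 2 ≤ (5 / 4) ^ j := by
    rw [← Real.exp_nat_mul]
    calc Real.exp ((2 : ℕ) * (j / 1000 : ℝ)) = Real.exp (1 / 500) ^ j := by
          rw [← Real.exp_nat_mul]; congr 1; push_cast; ring
      _ ≤ _ := by gcongr
  nlinarith [sq_nonneg (Real.exp (j / 1000 : ℝ) - 1)]

/-- The weight of the potential that controls the crowded copies of a set. -/
def crowdedWeight : ℝ := 5 * (4 / 5) ^ 1000

/-- Subtracting the weight of the copies outside the set makes a factor exceed 1 only at nodes that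
hold copies of the set. The logarithm of the expected potential then scales with the set rather than
with n, and a deviation of order n/d becomes visible. -/
theorem killed_crowded_le (G : ℕ → Tracked n s → Prop) {B : ℝ} {T : ℕ}
    (hG : ∀ t x, G t x → Running x → ∀ m, t + m < T → ∑ u, budgetWeight (1 / 4) B n d (m + 1) x.mass *
          loadWeight (1 / 4) d (m + 1) (x.cfg.node u).orig.length (x.cfg.node u).extra.length ≤
            3 * n * Real.exp (1 / 4 * B)) (j : Fin s) {t : ℕ} (ht : t ≤ T) (z : ℝ) :
    (killed (trackedInit n s) (trackedStep 𝒮 d c) G t fun x =>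
      ind (Running x ∧ x.mass ≤ (B - 1) * n ∧ 0 ≤ x.setMass j ∧
        crowdedWeight * Real.exp (1 / 4 * B) * (x.setMass j + (𝒮 j).card) + z ≤
          Real.log 2 * crowded (𝒮 j) 1000 x / 1000)) ≤ ENNReal.ofReal (Real.exp (-z)) := by
  have hn : (0 : ℝ) < n := by exact_mod_cast Nat.pos_of_ne_zero (NeZero.ne n)
  have hq := keepProb_pos d
  set ζ : ℝ := crowdedWeight with hζ
  have hζ0 : 0 < ζ := by rw [hζ, crowdedWeight]; positivity
  -- By `hG` the sum of the weights is at most 3n exp(B/4), and each is scaled by ζ.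
  set D : ℝ := 3 * ζ * Real.exp (1 / 4 * B) with hD
  have hD0 : 0 < D := by positivity
  set p : Fin n → Bool := fun x => decide (x ∉ 𝒮 j) with hp
  -- The exponential of the set's mass absorbs the extra factor that `ex_productPot_le` yields for
  -- pushed copies of the set.
  set f : ℕ → Tracked n s → ℝ≥0∞ := fun m => loadPot fun o e χ κ =>
    productPot (1 / 4) B (fun _ => ζ) 1 p d m o e χ *
      ENNReal.ofReal (Real.exp (-(D * (1 / 4 * keepProb d ^ m * κ j)))) with hf
  have h := killed_le_of_remaining (trackedInit n s) (trackedStep 𝒮 d c) G (f := f)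
    (T := T) (fun t x hx m hm => by
      by_cases hr : Running x
      · refine ex_trackedStep_loadPot_le fun W => ?_
        simp only [ex_mul_const]
        have h1 := ex_productPot_le (by norm_num : (0 : ℝ) ≤ 1 / 4) (B := B)
          (ζ := fun _ : Fin n => ζ) (fun _ => hζ0.le) zero_le_one le_rfl p d m
          (fun v => (x.cfg.node v).orig) (fun v => (x.cfg.node v).extra) (χ := x.mass) (D := D)
          (by
            have := hG t x hx hr m hm
            rw [one_mul]
            simp only [mul_assoc]
            rw [← Finset.mul_sum]
            calc _ ≤ ζ * (3 * n * Real.exp (1 / 4 * B)) := by gcongr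
              _ = _ := by rw [hD]; ring) W
        refine (mul_le_mul_left h1 _).trans (le_of_eq ?_)
        rw [mul_assoc, ← ENNReal.ofReal_mul (Real.exp_pos _).le, ← Real.exp_add]
        congr 3
        rw [hp, countP_not]; ring
      · have hout : ¬ ∀ v, (check 𝒮 c t (x.cfg.node v)).out = none :=
          fun h => hr (running_of_check h)
        rw [ex_trackedStep_eq_zero hout fun x hx => by simp only [hf, loadPot, if_neg hx]]
        exact zero_le) (t := t) (m := 0) (by simpa using ht)
  have hinit : ex (trackedInit n s) (f (0 + t)) ≤
      ENNReal.ofReal (Real.exp (ζ * Real.exp (1 / 4 * B) * (𝒮 j).card / 4)) := by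
    rw [ex_trackedInit]
    have h2 := ex_init_productPot_le (B := B) (by norm_num : (0 : ℝ) ≤ 1 / 4)
      (ζ := fun _ : Fin n => ζ) (fun _ => hζ0.le) zero_le_one le_rfl p d (0 + t)
    refine le_trans (ex_mono _ fun P => ?_) (h2.trans ?_)
    · simp only [hf, loadPot]
      split_ifs
      · simp
      · exact zero_le
    · rw [hp, countP_not, countP_finRange, ← ENNReal.ofReal_prod_of_nonneg]
      · refine ENNReal.ofReal_le_ofReal ?_
        rw [Finset.prod_const, Finset.card_univ, Fintype.card_fin]
        set r : ℝ := 1 / 4 * (𝒮 j).card / n with hr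
        have h3 : 1 + ζ * Real.exp (1 / 4 * B) * (1 - 1 * Real.exp (-r)) ≤
            Real.exp (ζ * Real.exp (1 / 4 * B) * r) := by
          have e1 := Real.add_one_le_exp (-r)
          have e2 := Real.add_one_le_exp (ζ * Real.exp (1 / 4 * B) * r)
          have e3 : 0 < ζ * Real.exp (1 / 4 * B) := by positivity
          nlinarith
        have h4 : 0 ≤ 1 + ζ * Real.exp (1 / 4 * B) * (1 - 1 * Real.exp (-r)) := by
          have : Real.exp (-r) ≤ 1 := Real.exp_le_one_iff.2 (by rw [hr]; simp; positivity)
          have e3 : 0 < ζ * Real.exp (1 / 4 * B) := by positivity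
          nlinarith
        calc _ ≤ Real.exp (ζ * Real.exp (1 / 4 * B) * r) ^ n := by gcongr
          _ = _ := by rw [← Real.exp_nat_mul, hr]; congr 1; field_simp
      · intro u _
        have : Real.exp (-(1 / 4 * ((𝒮 j).card : ℝ) / n)) ≤ 1 :=
          Real.exp_le_one_iff.2 (by simp; positivity)
        have e3 : 0 < ζ * Real.exp (1 / 4 * B) := by positivity
        nlinarith
  have h := h.trans hinit
  refine killed_markov _ _ _ t (y := ENNReal.ofReal (Real.exp
    (-(ζ * Real.exp (1 / 4 * B) * (𝒮 j).card / 4) - z))) (fun x hx => ?_)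
    (le_trans (mul_le_mul_right h _) ?_)
  · obtain ⟨h1, h2, hκ, h3⟩ := hx
    simp only [hf, loadPot, if_pos h1]
    have h4 := one_le_budgetWeight (by norm_num : (0 : ℝ) ≤ 1 / 4) h2 d
    set w := budgetWeight (1 / 4) B n d 0 x.mass with hw
    have h5 : ∏ u, ENNReal.ofReal (Real.exp (if 1000 ≤ (x.cfg.node u).store.length then
        Real.log 2 * (x.cfg.node u).store.countP (· ∈ 𝒮 j) / 1000 else 0)) ≤
        productPot (1 / 4) B (fun _ => ζ) 1 p d 0 (fun v => (x.cfg.node v).orig)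
          (fun v => (x.cfg.node v).extra) x.mass := by
      refine Finset.prod_le_prod' fun u _ => ENNReal.ofReal_le_ofReal ?_
      have e0 : ∀ l l' : List (Fin n), loadWeight (1 / 4) d 0 l.length l'.length =
          (5 / 4) ^ (l ++ l').length := by
        intro l l'
        rw [loadWeight, List.length_append, pow_add]; norm_num
      have e1 : ∀ l l' : List (Fin n), loadWeight (1 / 4) d 0 (l.countP p) (l'.countP p) =
          (5 / 4) ^ (l ++ l').countP p := by
        intro l l'
        rw [loadWeight, List.countP_append, pow_add]; norm_num
      rw [e0, e1, ← hw]
      change _ ≤ 1 + ζ * w * (5 / 4) ^ (x.cfg.node u).store.length -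
        1 * (ζ * w * (5 / 4) ^ (x.cfg.node u).store.countP p)
      generalize (x.cfg.node u).store = l
      have hlp : l.length = l.countP p + l.countP (· ∈ 𝒮 j) := by
        rw [List.length_eq_countP_add_countP p, hp, countP_not]
      have hmono : (5 / 4 : ℝ) ^ l.countP p ≤ (5 / 4) ^ l.length :=
        pow_le_pow_right₀ (by norm_num) List.countP_le_length
      have hζw : ζ ≤ ζ * w := le_mul_of_one_le_right hζ0.le h4
      split_ifs with hL
      · rcases Nat.eq_zero_or_pos (l.countP (· ∈ 𝒮 j)) with hk | hk
        · rw [hk]; simp only [Nat.cast_zero, mul_zero, zero_div, Real.exp_zero]; nlinarith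
        · have h6 := two_pow_le_one_add (k := l.countP (· ∈ 𝒮 j)) rfl hL List.countP_le_length
          push_cast at h6
          refine h6.trans ?_
          -- One copy of the set already leaves a fifth of the full weight after the subtraction.
          -- The factor 5 in `crowdedWeight` makes up for it.
          have h7 : (5 / 4 : ℝ) ^ l.countP p * (5 / 4) ≤ (5 / 4) ^ l.length := by
            rw [← pow_succ]; exact pow_le_pow_right₀ (by norm_num) (by omega)
          have h8 : (5 / 4 : ℝ) ^ ((l.length : ℤ) - 1000) = ζ * ((5 / 4) ^ l.length * (1 / 5)) := by
            rw [zpow_sub₀ (by norm_num), zpow_natCast, hζ, crowdedWeight, div_eq_mul_inv,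
              show ((5 / 4 : ℝ) ^ (1000 : ℤ))⁻¹ = (4 / 5) ^ 1000 by
                rw [show (1000 : ℤ) = ((1000 : ℕ) : ℤ) from rfl, zpow_natCast, ← inv_pow]
                norm_num only [inv_div]]
            ring
          rw [h8]
          have h9 : (5 / 4 : ℝ) ^ l.length * (1 / 5) ≤
              (5 / 4) ^ l.length - (5 / 4) ^ l.countP p := by linarith
          have h10 : 0 ≤ (5 / 4 : ℝ) ^ l.length - (5 / 4) ^ l.countP p := by linarith
          nlinarith [mul_le_mul_of_nonneg_left h9 hζ0.le, mul_le_mul_of_nonneg_right hζw h10]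
      · rw [Real.exp_zero]; nlinarith
    refine le_trans ?_ (mul_le_mul_right (mul_le_mul_left h5 _) _)
    rw [← ENNReal.ofReal_prod_of_nonneg fun u _ => (Real.exp_pos _).le, ← Real.exp_sum,
      ← ENNReal.ofReal_mul (Real.exp_pos _).le, ← ENNReal.ofReal_mul (Real.exp_pos _).le,
      ← Real.exp_add, ← Real.exp_add, ENNReal.one_le_ofReal, Real.one_le_exp_iff]
    have h6 : (∑ u, if 1000 ≤ (x.cfg.node u).store.length then
        Real.log 2 * (x.cfg.node u).store.countP (· ∈ 𝒮 j) / 1000 else 0) =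
        Real.log 2 * crowded (𝒮 j) 1000 x / 1000 := by
      rw [crowded]; push_cast
      rw [Finset.mul_sum, Finset.sum_div]
      refine Finset.sum_congr rfl fun u _ => ?_
      split_ifs <;> simp
    rw [h6, pow_zero, hD]
    have e3 : 0 < ζ * Real.exp (1 / 4 * B) := by positivity
    nlinarith [mul_nonneg e3.le hκ, mul_nonneg e3.le (Nat.cast_nonneg (α := ℝ) (𝒮 j).card)]
  · rw [← ENNReal.ofReal_mul (Real.exp_pos _).le, ← Real.exp_add]
    refine ENNReal.ofReal_le_ofReal (Real.exp_le_exp.2 (le_of_eq ?_)); ring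

end

/-! ### Lower tail for the number of non-initial copies of a set -/

section
variable {n s : ℕ} [NeZero n] {𝒮 : Fin s → Finset (Fin n)} {d : ℕ} {c : ℝ}

theorem sum_countP_received {β : Type} (p : β → Bool) (P : List (Fin n × β)) :
    ∑ u, (received P u).countP p = (P.map Prod.snd).countP p := by
  induction P with
  | nil => simp [received]
  | cons z P ih =>
    obtain ⟨v, x⟩ := z
    simp only [received_cons, List.map_cons, List.countP_cons, ← ih]
    rw [← Finset.add_sum_erase _ _ (Finset.mem_univ v),
      ← Finset.add_sum_erase _ _ (Finset.mem_univ v), if_pos rfl, List.countP_cons]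
    rw [Finset.sum_congr rfl fun u hu => by rw [if_neg (Finset.ne_of_mem_erase hu)]]
    ring

/-- The filtering step, for the number of all copies satisfying `p`. -/
theorem ex_indep_thin_pow (p : Fin n → Bool) {y : ℝ} (hy : 0 ≤ y) (l : Fin n → List (Fin n)) :
    (ex (indep n fun u => thin d (l u)) fun l' => ENNReal.ofReal (y ^ ∑ u, (l' u).countP p)) =
      ENNReal.ofReal ((1 - keepProb d + keepProb d * y) ^ ∑ u, (l u).countP p) := by
  have h := ex_indep_prod n (fun u => thin d (l u)) fun _ (l' : List (Fin n)) =>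
    ENNReal.ofReal (y ^ l'.countP p)
  have h0 := (keepProb_pos d).le
  have h1 := sub_nonneg.2 (keepProb_le_one d)
  simp only [ex_thin_pow d p hy] at h
  rw [← ENNReal.ofReal_prod_of_nonneg (fun u _ => by positivity), Finset.prod_pow_eq_pow_sum] at h
  rw [← h]
  congr 1; funext l'
  rw [← ENNReal.ofReal_prod_of_nonneg (fun u _ => by positivity), Finset.prod_pow_eq_pow_sum]

/-- The number of further copies of a set is not much smaller than expected. -/
theorem killed_extraCount_le (G : ℕ → Tracked n s → Prop) (j : Fin s) (t : ℕ) (z : ℝ) :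
    (killed (trackedInit n s) (trackedStep 𝒮 d c) G t fun x =>
      ind (Running x ∧ Real.log 2 * extraCount (𝒮 j) x + z ≤ x.setMass j / 2)) ≤
      ENNReal.ofReal (Real.exp (-z)) := by
  have hq := keepProb_pos d
  have hq1 := keepProb_le_one d
  set q := keepProb d with hqd
  have hqm : ∀ m, q ^ m ≤ 1 := fun m => pow_le_one₀ hq.le hq1
  -- A present extra copy survives m filterings with probability q^m, and 1 - q^m/2 is the
  -- expectation of (1/2)^(indicator of survival). The exponential of the mass compensates for the
  -- pushed copies.
  set f : ℕ → Tracked n s → ℝ≥0∞ := fun m => loadPot fun _ e _ κ =>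
    ENNReal.ofReal ((1 - q ^ m / 2) ^ ∑ u, (e u).countP (· ∈ 𝒮 j)) *
      ENNReal.ofReal (Real.exp (q ^ m / 2 * κ j)) with hf
  have h := killed_le_of_remaining (trackedInit n s) (trackedStep 𝒮 d c) G (f := f)
    (T := t) (fun t x _ m _ => ex_trackedStep_loadPot_le fun W => by
      simp only [ex_mul_const]
      have hy : 0 ≤ 1 - q ^ m / 2 := by linarith [hqm m]
      have hy' : 0 ≤ 1 - q ^ (m + 1) / 2 := by linarith [hqm (m + 1)]
      have e1 : ∀ P : List (Fin n × Fin n), P ∈ (scatter n W).support →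
          (ex (indep n fun v => thin d ((x.cfg.node v).extra ++ received P v)) fun l =>
            ENNReal.ofReal ((1 - q ^ m / 2) ^ ∑ u, (l u).countP (· ∈ 𝒮 j))) =
          ENNReal.ofReal ((1 - q ^ (m + 1) / 2) ^ (∑ u, (x.cfg.node u).extra.countP (· ∈ 𝒮 j) +
            W.countP (· ∈ 𝒮 j))) := by
        intro P hP
        rw [ex_indep_thin_pow _ hy, ← hqd]
        simp only [List.countP_append, Finset.sum_add_distrib]
        rw [sum_countP_received, map_snd_of_mem_support_scatter hP]
        congr 2; ring
      rw [ex_congr_of_support _ e1, ex_const, pow_add, ENNReal.ofReal_mul (by positivity), mul_assoc]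
      refine mul_le_mul_right ?_ _
      rw [← ENNReal.ofReal_mul (by positivity)]
      refine ENNReal.ofReal_le_ofReal ?_
      have e2 : (1 - q ^ (m + 1) / 2) ^ W.countP (· ∈ 𝒮 j) ≤
          Real.exp (-(q ^ (m + 1) / 2 * W.countP (· ∈ 𝒮 j))) := by
        calc _ ≤ Real.exp (-(q ^ (m + 1) / 2)) ^ W.countP (· ∈ 𝒮 j) := by
              gcongr
              linarith [Real.add_one_le_exp (-(q ^ (m + 1) / 2))]
          _ = _ := by rw [← Real.exp_nat_mul]; congr 1; ring
      calc _ ≤ Real.exp (-(q ^ (m + 1) / 2 * W.countP (· ∈ 𝒮 j))) *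
            Real.exp (q ^ m / 2 * (q * (x.setMass j + W.countP (· ∈ 𝒮 j)))) := by gcongr
        _ = _ := by rw [← Real.exp_add]; congr 1; ring) (t := t) (m := 0) (by simp)
  have hinit : ex (trackedInit n s) (f (0 + t)) ≤ 1 := by
    rw [ex_trackedInit]
    refine ex_le_of_forall _ fun P _ => ?_
    simp only [hf, loadPot]
    split_ifs
    · simp
    · exact zero_le
  refine killed_markov _ _ _ t (y := ENNReal.ofReal (Real.exp (-z))) (fun x hx => ?_)
    (le_trans (mul_le_mul_right (h.trans hinit) _) (by simp))
  obtain ⟨h1, h2⟩ := hx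
  simp only [hf, loadPot, if_pos h1]
  rw [← ENNReal.ofReal_mul (by norm_num), ← ENNReal.ofReal_mul (by positivity),
    ENNReal.one_le_ofReal]
  have e1 : (1 - q ^ 0 / 2 : ℝ) ^ (∑ u, (x.cfg.node u).extra.countP (· ∈ 𝒮 j)) =
      Real.exp (-(Real.log 2 * extraCount (𝒮 j) x)) := by
    rw [pow_zero, show (1 - 1 / 2 : ℝ) = Real.exp (-Real.log 2) by
      rw [Real.exp_neg, Real.exp_log (by norm_num)]; norm_num, ← Real.exp_nat_mul, extraCount]
    congr 1; ring
  rw [e1, ← Real.exp_add, ← Real.exp_add, Real.one_le_exp_iff]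
  rw [pow_zero]; linarith

end

/-! ### Collecting distinct items -/

/-- A decreasing function of the number of collected items, which vanishes as soon as there are
`G` of them. -/
def lack (y : ℝ) (G g : ℕ) : ℝ := y ^ min g G - y ^ G

theorem lack_nonneg {y : ℝ} (hy : 0 ≤ y) (hy1 : y ≤ 1) (G g : ℕ) : 0 ≤ lack y G g :=
  sub_nonneg.2 (pow_le_pow_of_le_one hy hy1 (min_le_right _ _))

theorem lack_anti {y : ℝ} (hy : 0 ≤ y) (hy1 : y ≤ 1) (G : ℕ) {g g' : ℕ} (h : g ≤ g') :
    lack y G g' ≤ lack y G g :=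
  sub_le_sub_right (pow_le_pow_of_le_one hy hy1 (min_le_min_right _ h)) _

theorem lack_zero_le {y : ℝ} (hy : 0 ≤ y) (G : ℕ) : lack y G 0 ≤ 1 := by
  simp [lack]; positivity

/-- Truncation at `G` makes the contraction valid in all cases: for g ≥ G, where nothing is known
about p, both sides vanish. -/
theorem lack_succ_le {y : ℝ} (hy : 0 ≤ y) (hy1 : y ≤ 1) {G g : ℕ} {p p₀ : ℝ} (hp₀ : 0 ≤ p₀)
    (hp : g < G → p₀ ≤ p) :
    lack y G (g + 1) * p + lack y G g * (1 - p) ≤ (1 - (1 - y) * p₀) * lack y G g := by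
  rcases lt_or_ge g G with h | h
  · have hp := hp h
    have e1 : min (g + 1) G = g + 1 := min_eq_left h
    have e2 : min g G = g := min_eq_left h.le
    simp only [lack, e1, e2]
    have h1 : 0 ≤ y ^ g := by positivity
    have h2 : 0 ≤ y ^ G := by positivity
    have h3 : 0 ≤ (1 - y) := by linarith
    rw [pow_succ]
    nlinarith [mul_nonneg h3 h1, mul_nonneg (mul_nonneg h3 h2) hp₀,
      mul_le_mul_of_nonneg_left hp (mul_nonneg h3 h1)]
  · have e1 : min (g + 1) G = G := min_eq_right (by omega)
    have e2 : min g G = G := min_eq_right h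
    simp [lack, e1, e2]

theorem ex_ind_le_ofReal {α : Type} (p : PMF α) (A : α → Prop) {z₀ z₁ : ℝ} (h1 : 0 ≤ z₁)
    (h0 : 0 ≤ z₀) : (ex p fun a => ENNReal.ofReal z₁ * ind (A a) + ENNReal.ofReal z₀ * ind (¬ A a)) =
      ENNReal.ofReal (z₁ * (ex p fun a => ind (A a)).toReal +
        z₀ * (1 - (ex p fun a => ind (A a)).toReal)) := by
  have h := ex_ind_compl p A
  have hA : (ex p fun a => ind (A a)) ≠ ⊤ :=
    ne_top_of_le_ne_top ENNReal.one_ne_top (h ▸ le_self_add)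
  have hA' : (ex p fun a => ind (¬ A a)) = ENNReal.ofReal (1 - (ex p fun a => ind (A a)).toReal) := by
    rw [ENNReal.ofReal_sub _ ENNReal.toReal_nonneg, ENNReal.ofReal_toReal hA, ENNReal.ofReal_one,
      ← h, ENNReal.add_sub_cancel_left hA]
  have h2 : (ex p fun a => ind (A a)).toReal ≤ 1 := by
    have := ENNReal.toReal_mono ENNReal.one_ne_top (h ▸ le_self_add : (ex p fun a => ind (A a)) ≤ 1)
    simpa using this
  rw [ex_add, ex_const_mul, ex_const_mul, hA', ENNReal.ofReal_add, ENNReal.ofReal_mul h1,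
    ENNReal.ofReal_mul h0, ENNReal.ofReal_toReal hA]
  · exact mul_nonneg h1 ENNReal.toReal_nonneg
  · exact mul_nonneg h0 (by linarith)

theorem ofReal_sum_le {ι : Type} (t : Finset ι) (f : ι → ℝ) :
    ENNReal.ofReal (∑ i ∈ t, f i) ≤ ∑ i ∈ t, ENNReal.ofReal (f i) := by
  classical
  induction t using Finset.induction_on with
  | empty => simp
  | insert i t hi ih =>
    rw [Finset.sum_insert hi, Finset.sum_insert hi]
    exact ENNReal.ofReal_add_le.trans (add_le_add_right ih _)

theorem sum_ind {ι : Type} (t : Finset ι) (A : ι → Prop) [DecidablePred A] :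
    ∑ i ∈ t, ind (A i) = ((t.filter A).card : ℝ≥0∞) := by
  classical
  rw [Finset.card_filter]
  push_cast
  refine Finset.sum_congr rfl fun i _ => ?_
  by_cases h : A i
  · rw [ind_pos h, if_pos h]
  · rw [ind_neg h, if_neg h]

/-! ### Occupied nodes -/

section
variable {n : ℕ} [NeZero n]

theorem card_insert_cases (B : Finset (Fin n)) (v : Fin n) (y : ℝ) (G : ℕ) :
    ENNReal.ofReal (lack y G (insert v B).card) =
      ENNReal.ofReal (lack y G (B.card + 1)) * ind (v ∉ B) +
        ENNReal.ofReal (lack y G B.card) * ind (¬ v ∉ B) := by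
  by_cases h : v ∈ B
  · rw [ind_neg (not_not.2 h), ind_pos (not_not.2 h), Finset.insert_eq_of_mem h]; simp
  · rw [ind_pos h, ind_neg (not_not.2 h), Finset.card_insert_of_notMem h]; simp

theorem ex_uniform_notMem (B : Finset (Fin n)) :
    (ex (PMF.uniformOfFintype (Fin n)) fun v => ind (v ∉ B)).toReal = 1 - B.card / n := by
  classical
  have hn : (0 : ℝ) < n := by exact_mod_cast Nat.pos_of_ne_zero (NeZero.ne n)
  rw [ex_uniformOfFintype, Fintype.card_fin]
  have : ∑ v : Fin n, ind (v ∉ B) = ((n - B.card : ℕ) : ℝ≥0∞) := by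
    rw [sum_ind]
    congr 1
    rw [Finset.filter_notMem_eq_sdiff, Finset.card_sdiff_of_subset (Finset.subset_univ _)]
    simp
  rw [this, ENNReal.toReal_div, ENNReal.toReal_natCast, ENNReal.toReal_natCast,
    Nat.cast_sub (by simpa using Finset.card_le_univ B), sub_div, div_self hn.ne']

/-- While fewer than `G` nodes are occupied, the next item reaches a new one with probability at
least 1 - G/n ≥ p₀, so every item contracts `lack`. -/
theorem ex_scatter_lack_le {β : Type} {y p₀ : ℝ} (hy : 0 ≤ y) (hy1 : y ≤ 1) (hp₀ : 0 ≤ p₀) {G : ℕ}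
    (hG : p₀ ≤ 1 - G / n) (hp₀1 : p₀ ≤ 1) (W : List β) (B : Finset (Fin n)) :
    (ex (scatter n W) fun P => ENNReal.ofReal (lack y G (B ∪ (P.map Prod.fst).toFinset).card)) ≤
      ENNReal.ofReal ((1 - (1 - y) * p₀) ^ W.length * lack y G B.card) := by
  have hn : (0 : ℝ) < n := by exact_mod_cast Nat.pos_of_ne_zero (NeZero.ne n)
  have hρ : 0 ≤ 1 - (1 - y) * p₀ := by nlinarith
  induction W generalizing B with
  | nil => simp [ex_scatter_nil]
  | cons x W ih =>
    have hs := ex_scatter_cons x W fun P : List (Fin n × β) =>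
      ENNReal.ofReal (lack y G (B ∪ (P.map Prod.fst).toFinset).card)
    rw [hs]
    simp only [List.map_cons, List.toFinset_cons, Finset.union_insert, ← Finset.insert_union]
    calc _ ≤ (∑ v : Fin n, ENNReal.ofReal ((1 - (1 - y) * p₀) ^ W.length) *
          ENNReal.ofReal (lack y G (insert v B).card)) / n := by
          gcongr with v _
          rw [← ENNReal.ofReal_mul (by positivity)]
          exact ih _
      _ = ENNReal.ofReal ((1 - (1 - y) * p₀) ^ W.length) *
          ex (PMF.uniformOfFintype (Fin n)) (fun v =>
            ENNReal.ofReal (lack y G (insert v B).card)) := by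
          rw [ex_uniformOfFintype, Fintype.card_fin, ← Finset.mul_sum, mul_div_assoc]
      _ ≤ _ := by
          simp only [fun v => card_insert_cases B v y G]
          rw [ex_ind_le_ofReal _ _ (lack_nonneg hy hy1 _ _) (lack_nonneg hy hy1 _ _),
            ← ENNReal.ofReal_mul (by positivity)]
          refine ENNReal.ofReal_le_ofReal ?_
          rw [List.length_cons, pow_succ, mul_assoc]
          gcongr
          refine lack_succ_le hy hy1 hp₀ fun hg => ?_
          rw [ex_uniform_notMem]
          have : (B.card : ℝ) / n ≤ G / n := by gcongr
          linarith

/-- With high probability, at least one eighth of the nodes receive something if `n` items are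
placed at random. -/
theorem ex_scatter_occupied_le {β : Type} (W : List β) (hW : W.length = n) (hn8 : 8 ≤ n) :
    (ex (scatter n W) fun P => ind (8 * (P.map Prod.fst).toFinset.card < n)) ≤
      ENNReal.ofReal (2 * 64 * (1 / 2) ^ n) := by
  have hn : (0 : ℝ) < n := by exact_mod_cast Nat.pos_of_ne_zero (NeZero.ne n)
  set G := (n + 7) / 8 with hG
  have hG1 : 1 ≤ G := by omega
  have hG2 : (G : ℝ) ≤ n / 4 := by
    rw [le_div_iff₀ (by norm_num)]
    exact_mod_cast (by omega : G * 4 ≤ n)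
  have hGn : G ≤ n / 8 + 1 := by omega
  -- With y = 1/64 the price 64^G is about 64^(n/8) ≤ 1.7^n, and 1.7 times the contraction 1 -
  -- (63/64)(3/4) is below 1/2.
  have h := ex_scatter_lack_le (n := n) (y := 1 / 64) (p₀ := 3 / 4) (by norm_num) (by norm_num)
    (by norm_num) (G := G) (by
      have : (G : ℝ) / n ≤ 1 / 4 := by rw [div_le_iff₀ hn]; linarith
      linarith) (by norm_num) W ∅
  rw [hW] at h
  have key : ∀ P : List (Fin n × β), ind (8 * (P.map Prod.fst).toFinset.card < n) ≤
      ENNReal.ofReal (64 ^ G * 2) *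
        ENNReal.ofReal (lack (1 / 64) G (∅ ∪ (P.map Prod.fst).toFinset).card) := by
    intro P
    by_cases hP : 8 * (P.map Prod.fst).toFinset.card < n
    · rw [ind_pos hP, ← ENNReal.ofReal_mul (by positivity), ENNReal.one_le_ofReal, Finset.empty_union]
      set g := (P.map Prod.fst).toFinset.card
      have hg : g ≤ G - 1 := by omega
      have h1 := lack_anti (y := 1 / 64) (by norm_num) (by norm_num) G hg
      have h2 : (1 / 2 : ℝ) * (1 / 64) ^ G ≤ lack (1 / 64) G (G - 1) := by
        obtain ⟨k, hk⟩ := Nat.exists_eq_add_of_le' hG1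
        rw [hk, Nat.add_sub_cancel, lack, min_eq_left (Nat.le_succ k), pow_succ]
        have : (0 : ℝ) < (1 / 64) ^ k := by positivity
        nlinarith
      have h3 : (64 : ℝ) ^ G * (1 / 64) ^ G = 1 := by rw [← mul_pow]; norm_num
      have h4 : (0 : ℝ) < 64 ^ G := by positivity
      nlinarith [mul_le_mul_of_nonneg_left (h2.trans h1) h4.le]
    · rw [ind_neg hP]; exact zero_le
  refine (ex_mono _ key).trans ?_
  rw [ex_const_mul]
  refine (mul_le_mul_right h _).trans ?_
  rw [← ENNReal.ofReal_mul (by positivity)]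
  refine ENNReal.ofReal_le_ofReal ?_
  have h5 : lack (1 / 64) G (∅ : Finset (Fin n)).card ≤ 1 := lack_zero_le (by norm_num) G
  have h6 : (64 : ℝ) ^ G ≤ 64 * (17 / 10) ^ n := by
    calc (64 : ℝ) ^ G ≤ 64 ^ (n / 8 + 1) := pow_le_pow_right₀ (by norm_num) hGn
      _ = 64 * 64 ^ (n / 8) := by rw [pow_succ]; ring
      _ ≤ 64 * ((17 / 10) ^ 8) ^ (n / 8) := by gcongr; norm_num
      _ = 64 * (17 / 10) ^ (8 * (n / 8)) := by rw [pow_mul]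
      _ ≤ _ := by
        gcongr
        · norm_num
        · omega
  have h7 : (0 : ℝ) ≤ (1 - (1 - 1 / 64) * (3 / 4)) ^ n := by positivity
  calc (64 : ℝ) ^ G * 2 * ((1 - (1 - 1 / 64) * (3 / 4)) ^ n *
        lack (1 / 64) G (∅ : Finset (Fin n)).card) ≤
        64 * (17 / 10) ^ n * 2 * ((1 - (1 - 1 / 64) * (3 / 4)) ^ n * 1) := by
          have h8 := lack_nonneg (y := 1 / 64) (by norm_num) (by norm_num) G
            (∅ : Finset (Fin n)).card
          gcongr
    _ = 2 * 64 * ((17 / 10) * (1 - (1 - 1 / 64) * (3 / 4))) ^ n := by rw [mul_pow]; ring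
    _ ≤ _ := by gcongr; norm_num

end

/-! ### Sampling -/

section
variable {n : ℕ}

/-- The probability that a pull operation returns a copy of a point satisfying `p`. -/
def pullMass (σ : Fin n → NodeState n) (p : Fin n → Bool) : ℝ :=
  (∑ u, ((σ u).store.countP p : ℝ) / (σ u).store.length) / n

theorem pullMass_nonneg (σ : Fin n → NodeState n) (p : Fin n → Bool) : 0 ≤ pullMass σ p := by
  unfold pullMass; positivity

variable [NeZero n]

theorem ex_pull (σ : Fin n → NodeState n) (f : Option (Copy n) → ℝ≥0∞) :
    ex (pull σ) f = (∑ u, if (σ u).store.length = 0 then f none else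
      (∑ k : Fin (σ u).store.length, f (some (u, (k : ℕ), (σ u).store.get k))) /
        (σ u).store.length) / n := by
  rw [pull, ex_bind, ex_uniformOfFintype, Fintype.card_fin]
  congr 1
  refine Finset.sum_congr rfl fun u _ => ?_
  by_cases h : 0 < (σ u).store.length
  · rw [dif_pos h, if_neg h.ne']
    have : Nonempty (Fin (σ u).store.length) := ⟨⟨0, h⟩⟩
    rw [ex_map, ex_uniformOfFintype, Fintype.card_fin]
  · rw [dif_neg h, if_pos (by omega), ex_pure]

/-- The copies of points satisfying `p`. -/
def copiesOf (p : Fin n → Bool) (B : Finset (Copy n)) : Finset (Copy n) :=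
  B.filter fun z => p z.2.2

/-- The pull operation returns a copy of a point satisfying `p` that is not in `B`. -/
def NewCopy (p : Fin n → Bool) (B : Finset (Copy n)) (a : Option (Copy n)) : Prop :=
  ∃ z, a = some z ∧ p z.2.2 ∧ z ∉ B

theorem countP_eq_card_fin {β : Type} (l : List β) (p : β → Bool) :
    l.countP p = (Finset.univ.filter fun k : Fin l.length => p (l.get k)).card := by
  conv_lhs => rw [← List.ofFn_get l]
  rw [List.ofFn_eq_map, List.countP_map, List.countP_eq_length_filter,
    ← List.toFinset_card_of_nodup ((List.nodup_finRange _).filter _)]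
  congr 1; ext k; simp

/-- A single copy is returned with probability at most 1/n, so the copies already seen reduce the
chance of a new one by at most their number over n. -/
theorem le_ex_pull_newCopy (σ : Fin n → NodeState n) (p : Fin n → Bool) (B : Finset (Copy n)) :
    pullMass σ p - (copiesOf p B).card / n ≤
      (ex (pull σ) fun a => ind (NewCopy p B a)).toReal := by
  classical
  have hn : (0 : ℝ) < n := by exact_mod_cast Nat.pos_of_ne_zero (NeZero.ne n)
  set Bu : Fin n → Finset (Copy n) := fun u => (copiesOf p B).filter fun z => z.1 = u with hBu
  have hcard : (copiesOf p B).card = ∑ u, (Bu u).card :=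
    Finset.card_eq_sum_card_fiberwise fun _ _ => Finset.mem_coe.2 (Finset.mem_univ _)
  have key : ENNReal.ofReal (pullMass σ p - (copiesOf p B).card / n) ≤
      ex (pull σ) fun a => ind (NewCopy p B a) := by
    rw [ex_pull]
    have e1 : pullMass σ p - (copiesOf p B).card / n =
        (∑ u, (((σ u).store.countP p : ℝ) / (σ u).store.length - (Bu u).card)) / n := by
      rw [pullMass, hcard, Finset.sum_sub_distrib, sub_div]; push_cast; rfl
    rw [e1, ENNReal.ofReal_div_of_pos hn, ENNReal.ofReal_natCast]
    gcongr
    refine (ofReal_sum_le _ _).trans (Finset.sum_le_sum fun u _ => ?_)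
    by_cases h0 : (σ u).store.length = 0
    · rw [if_pos h0, ENNReal.ofReal_of_nonpos]
      · exact zero_le
      · rw [h0]; simp
    · rw [if_neg h0]
      have hL : (0 : ℝ) < (σ u).store.length := by exact_mod_cast Nat.pos_of_ne_zero h0
      have e3 : ∑ k : Fin (σ u).store.length,
          ind (NewCopy p B (some (u, (k : ℕ), (σ u).store.get k))) =
          ((Finset.univ.filter fun k : Fin (σ u).store.length =>
            NewCopy p B (some (u, (k : ℕ), (σ u).store.get k))).card : ℝ≥0∞) := sum_ind _ _
      rw [e3, ← ENNReal.ofReal_natCast, ← ENNReal.ofReal_natCast, ← ENNReal.ofReal_div_of_pos hL]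
      refine ENNReal.ofReal_le_ofReal ?_
      have e4 : (σ u).store.countP p ≤ (Finset.univ.filter fun k : Fin (σ u).store.length =>
            NewCopy p B (some (u, (k : ℕ), (σ u).store.get k))).card + (Bu u).card := by
        rw [countP_eq_card_fin, ← Finset.card_filter_add_card_filter_not (s :=
          Finset.univ.filter fun k : Fin (σ u).store.length => p ((σ u).store.get k))
          (fun k => NewCopy p B (some (u, (k : ℕ), (σ u).store.get k)))]
        refine Nat.add_le_add (Finset.card_le_card fun k hk => ?_) ?_
        · simp only [Finset.mem_filter] at hk ⊢
          exact ⟨hk.1.1, hk.2⟩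
        · refine Finset.card_le_card_of_injOn
            (fun k : Fin (σ u).store.length => (u, (k : ℕ), (σ u).store.get k)) ?_ ?_
          · intro k hk
            simp only [Finset.coe_filter, Finset.mem_filter, Finset.mem_univ, true_and,
              Set.mem_ofPred_eq] at hk
            obtain ⟨hk1, hk2⟩ := hk
            simp only [hBu, copiesOf, Finset.coe_filter, Finset.mem_filter, Set.mem_ofPred_eq,
              and_true]
            refine ⟨?_, hk1⟩
            by_contra hB
            exact hk2 ⟨_, rfl, hk1, hB⟩
          · intro k _ k' _ h
            simp only [Prod.mk.injEq] at h
            exact Fin.ext h.2.1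
      have e5 : ((σ u).store.countP p : ℝ) ≤ ((Finset.univ.filter fun k : Fin (σ u).store.length =>
            NewCopy p B (some (u, (k : ℕ), (σ u).store.get k))).card : ℝ) + (Bu u).card := by
        exact_mod_cast e4
      -- A nonempty store has length at least 1, so the copies already seen at `u` cost at most
      -- their number even before division by the length.
      have hL1 : (1 : ℝ) ≤ (σ u).store.length := by exact_mod_cast Nat.one_le_iff_ne_zero.2 h0
      rw [sub_le_iff_le_add, div_add' _ _ _ hL.ne', div_le_div_iff_of_pos_right hL]
      nlinarith [Nat.cast_nonneg (α := ℝ) (Bu u).card]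
  have h1 : (ex (pull σ) fun a => ind (NewCopy p B a)) ≠ ⊤ :=
    ne_top_of_le_ne_top ENNReal.one_ne_top (ex_le_of_forall _ fun a _ => ind_le_one _)
  rcases le_or_gt 0 (pullMass σ p - (copiesOf p B).card / n) with h0 | h0
  · rw [← ENNReal.toReal_ofReal h0]
    exact ENNReal.toReal_mono h1 key
  · exact h0.le.trans ENNReal.toReal_nonneg

end

/-! ### Distinct copies returned by the pulls, and samples from them -/

section
variable {n : ℕ}

/-- The set of distinct copies returned by a sequence of pull operations. -/
def gotCopies {N : ℕ} (a : Fin N → Option (Copy n)) : Finset (Copy n) :=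
  Finset.univ.biUnion fun k => (a k).toFinset

theorem gotCopies_cons {N : ℕ} (x : Option (Copy n)) (a : Fin N → Option (Copy n)) :
    gotCopies (Fin.cons x a : Fin (N + 1) → Option (Copy n)) = x.toFinset ∪ gotCopies a := by
  ext z
  simp [gotCopies, Fin.exists_fin_succ]

theorem card_gotCopies_le {N : ℕ} (a : Fin N → Option (Copy n)) : (gotCopies a).card ≤ N := by
  refine Finset.card_biUnion_le.trans ?_
  calc _ ≤ ∑ _k : Fin N, 1 := Finset.sum_le_sum fun k _ => by cases a k <;> simp
    _ = N := by simp

theorem lack_copiesOf_union (p : Fin n → Bool) (B : Finset (Copy n)) (a : Option (Copy n)) (y : ℝ)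
    (G : ℕ) :
    ENNReal.ofReal (lack y G (copiesOf p (B ∪ a.toFinset)).card) =
      ENNReal.ofReal (lack y G ((copiesOf p B).card + 1)) * ind (NewCopy p B a) +
        ENNReal.ofReal (lack y G (copiesOf p B).card) * ind (¬ NewCopy p B a) := by
  by_cases h : NewCopy p B a
  · rw [ind_pos h, ind_neg (not_not.2 h)]
    obtain ⟨z, rfl, hz, hB⟩ := h
    have : copiesOf p (B ∪ (some z).toFinset) = insert z (copiesOf p B) := by
      rw [copiesOf, Option.toFinset_some, Finset.filter_union, Finset.filter_singleton, if_pos hz,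
        Finset.union_comm]; rfl
    have hz' : z ∉ copiesOf p B := fun h => hB (Finset.mem_filter.1 h).1
    rw [this, Finset.card_insert_of_notMem hz']; simp
  · rw [ind_neg h, ind_pos h]
    have : copiesOf p (B ∪ a.toFinset) = copiesOf p B := by
      ext z
      simp only [copiesOf, Finset.mem_filter, Finset.mem_union, Option.mem_toFinset,
        Option.mem_def]
      constructor
      · rintro ⟨h1 | h1, h2⟩
        · exact ⟨h1, h2⟩
        · by_contra h3
          exact h ⟨z, h1, h2, fun hB => h3 ⟨hB, h2⟩⟩
      · exact fun ⟨h1, h2⟩ => ⟨Or.inl h1, h2⟩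
    rw [this]; simp

variable [NeZero n]

theorem ex_gotCopies_lack_le (σ : Fin n → NodeState n) (p : Fin n → Bool) {y p₀ : ℝ} (hy : 0 ≤ y)
    (hy1 : y ≤ 1) (hp₀ : 0 ≤ p₀) {G : ℕ} (hG : p₀ + G / n ≤ pullMass σ p) (hp₀1 : p₀ ≤ 1) (N : ℕ)
    (B : Finset (Copy n)) :
    (ex (indep N fun _ => pull σ) fun a =>
      ENNReal.ofReal (lack y G (copiesOf p (B ∪ gotCopies a)).card)) ≤
      ENNReal.ofReal ((1 - (1 - y) * p₀) ^ N * lack y G (copiesOf p B).card) := by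
  have hn : (0 : ℝ) < n := by exact_mod_cast Nat.pos_of_ne_zero (NeZero.ne n)
  have hρ : 0 ≤ 1 - (1 - y) * p₀ := by nlinarith
  induction N generalizing B with
  | zero => rw [ex_indep_zero]; simp [gotCopies]
  | succ N ih =>
    rw [ex_indep_succ]
    simp only [gotCopies_cons, ← Finset.union_assoc]
    calc _ ≤ ex (pull σ) fun a => ENNReal.ofReal ((1 - (1 - y) * p₀) ^ N) *
          ENNReal.ofReal (lack y G (copiesOf p (B ∪ a.toFinset)).card) := by
          refine ex_mono _ fun a => ?_
          rw [← ENNReal.ofReal_mul (by positivity)]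
          exact ih _
      _ ≤ _ := by
          simp only [lack_copiesOf_union]
          rw [ex_const_mul, ex_ind_le_ofReal _ _ (lack_nonneg hy hy1 _ _) (lack_nonneg hy hy1 _ _),
            ← ENNReal.ofReal_mul (by positivity)]
          refine ENNReal.ofReal_le_ofReal ?_
          rw [pow_succ, mul_assoc]
          gcongr
          refine lack_succ_le hy hy1 hp₀ fun hg => ?_
          have h1 := le_ex_pull_newCopy σ p B
          have : ((copiesOf p B).card : ℝ) / n ≤ G / n := by gcongr
          linarith

theorem ex_sample (N r : ℕ) (σ : Fin n → NodeState n) (f : Option (Finset (Fin n)) → ℝ≥0∞) :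
    ex (sample N r σ) f = ex (indep N fun _ => pull σ) fun a =>
      if r ≤ (gotCopies a).card then
        (∑ Q ∈ (gotCopies a).powersetCard r, f (some (Q.image fun z => z.2.2))) /
          (gotCopies a).card.choose r
      else f none := by
  rw [sample, ex_bind]
  congr 1; funext a
  change ex (if h : r ≤ (gotCopies a).card then _ else _) f = _
  split_ifs with h
  · rw [ex_map, ex_uniformOfFinset, Finset.card_powersetCard]
    rfl
  · rw [ex_pure]

/-- Factor by factor in falling factorials: (D - g - i) D ≤ (D - i)(D - g). -/
theorem choose_sub_mul_pow_le (D g r : ℕ) (hg : g ≤ D) :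
    (D - g).choose r * D ^ r ≤ D.choose r * (D - g) ^ r := by
  have h : (D - g).descFactorial r * D ^ r ≤ D.descFactorial r * (D - g) ^ r := by
    induction r with
    | zero => simp
    | succ r ih =>
      rw [Nat.descFactorial_succ, Nat.descFactorial_succ, pow_succ, pow_succ]
      have h1 : (D - g - r) * D ≤ (D - r) * (D - g) := by
        rcases le_or_gt (D - g) r with h2 | h2
        · rw [Nat.sub_eq_zero_of_le h2]; simp
        · obtain ⟨k, hk⟩ := Nat.exists_eq_add_of_lt h2
          have e1 : D - g - r = k + 1 := by omega
          have e2 : D = r + k + 1 + g := by omega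
          have e3 : D - r = k + 1 + g := by omega
          rw [e1, e3, hk, e2]
          nlinarith
      calc _ = ((D - g - r) * D) * ((D - g).descFactorial r * D ^ r) := by ring
        _ ≤ ((D - r) * (D - g)) * (D.descFactorial r * (D - g) ^ r) := Nat.mul_le_mul h1 ih
        _ = _ := by ring
  rw [Nat.descFactorial_eq_factorial_mul_choose, Nat.descFactorial_eq_factorial_mul_choose,
    mul_assoc, mul_assoc] at h
  exact Nat.le_of_mul_le_mul_left h (Nat.factorial_pos r)

/-- The probability that a random r-subset avoids g of the D items is at most (1 - g/D)^r. Passing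
from D to N makes the base independent of the number of distinct copies. -/
theorem choose_div_choose_le {D g r N : ℕ} (hg : g ≤ D) (hr : r ≤ D) (hD : D ≤ N) :
    ((D - g).choose r : ℝ) / D.choose r ≤ Real.exp (-(r / N)) ^ g := by
  rcases Nat.eq_zero_or_pos D with h0 | h0
  · have : g = 0 := by omega
    have hr0 : r = 0 := by omega
    subst this hr0; simp
  have hc : (0 : ℝ) < D.choose r := by exact_mod_cast Nat.choose_pos hr
  have hD0 : (0 : ℝ) < D := by exact_mod_cast h0
  have hN0 : (0 : ℝ) < N := by exact_mod_cast h0.trans_le hD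
  have h1 : ((D - g).choose r : ℝ) * D ^ r ≤ D.choose r * ((D - g : ℕ) : ℝ) ^ r := by
    exact_mod_cast choose_sub_mul_pow_le D g r hg
  calc ((D - g).choose r : ℝ) / D.choose r ≤ (((D - g : ℕ) : ℝ) / D) ^ r := by
        rw [div_pow, div_le_div_iff₀ hc (by positivity)]; linarith
    _ ≤ (1 - g / N) ^ r := by
        gcongr
        rw [Nat.cast_sub hg, sub_div, div_self hD0.ne']
        have : (g : ℝ) / N ≤ g / D := by gcongr
        linarith
    _ ≤ Real.exp (-(g / N)) ^ r := by
        have : (g : ℝ) / N ≤ 1 := by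
          rw [div_le_one hN0]; exact_mod_cast hg.trans hD
        refine pow_le_pow_left₀ (by linarith) ?_ r
        have := Real.add_one_le_exp (-((g : ℝ) / N))
        linarith
    _ = _ := by rw [← Real.exp_nat_mul, ← Real.exp_nat_mul]; congr 1; ring

/-- The sample is a set of points that is disjoint from `S`. -/
def Misses (S : Finset (Fin n)) (o : Option (Finset (Fin n))) : Prop :=
  ∃ R, o = some R ∧ S ∩ R = ∅

/-- Given g distinct copies of `S` among the pulled ones, the sample misses `S` with probability at
most y^g, where y = exp(-r/N). This is at most `lack y G g` + y^G, and `lack` contracts in each of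
the N pulls. -/
theorem ex_sample_misses_le (σ : Fin n → NodeState n) (S : Finset (Fin n)) {N r G : ℕ} {p₀ : ℝ}
    (hp₀ : 0 ≤ p₀) (hG : p₀ + G / n ≤ pullMass σ (· ∈ S)) (hp₀1 : p₀ ≤ 1) :
    (ex (sample N r σ) fun o => ind (Misses S o)) ≤
      ENNReal.ofReal ((1 - (1 - Real.exp (-(r / N))) * p₀) ^ N + Real.exp (-(r / N)) ^ G) := by
  classical
  set y := Real.exp (-((r : ℝ) / N)) with hy
  have hy0 : 0 ≤ y := (Real.exp_pos _).le
  have hy1 : y ≤ 1 := Real.exp_le_one_iff.2 (by simp; positivity)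
  have hρ : 0 ≤ 1 - (1 - y) * p₀ := by nlinarith
  set p : Fin n → Bool := fun x => decide (x ∈ S) with hp
  rw [ex_sample]
  have h := ex_gotCopies_lack_le σ p hy0 hy1 hp₀ hG hp₀1 N ∅
  calc _ ≤ ex (indep N fun _ => pull σ) fun a =>
        ENNReal.ofReal (lack y G (copiesOf p (∅ ∪ gotCopies a)).card) + ENNReal.ofReal (y ^ G) := by
        refine ex_mono _ fun a => ?_
        set B := gotCopies a with hB
        split_ifs with hr
        · rw [sum_ind]
          have e1 : ((B.powersetCard r).filter fun Q =>
              Misses S (some (Q.image fun z => z.2.2))) ⊆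
              (B \ copiesOf p B).powersetCard r := by
            intro Q hQ
            rw [Finset.mem_filter, Finset.mem_powersetCard] at hQ
            obtain ⟨⟨h1, h2⟩, R, hR, h3⟩ := hQ
            rw [Finset.mem_powersetCard]
            refine ⟨fun z hz => Finset.mem_sdiff.2 ⟨h1 hz, fun hz' => ?_⟩, h2⟩
            have hz2 : z.2.2 ∈ S := by simpa [hp] using (Finset.mem_filter.1 hz').2
            have : z.2.2 ∈ S ∩ R := by
              rw [← Option.some.inj hR]
              exact Finset.mem_inter.2 ⟨hz2, Finset.mem_image_of_mem _ hz⟩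
            rw [h3] at this
            exact Finset.notMem_empty _ this
          have hsub : copiesOf p B ⊆ B := Finset.filter_subset _ _
          have e2 := Finset.card_le_card e1
          rw [Finset.card_powersetCard, Finset.card_sdiff_of_subset hsub] at e2
          have e3 := choose_div_choose_le (Finset.card_le_card hsub) hr (card_gotCopies_le a)
          have hc : (0 : ℝ) < B.card.choose r := by exact_mod_cast Nat.choose_pos hr
          rw [← ENNReal.ofReal_natCast, ← ENNReal.ofReal_natCast, ← ENNReal.ofReal_div_of_pos hc,
            ← ENNReal.ofReal_add (lack_nonneg hy0 hy1 _ _) (by positivity)]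
          refine ENNReal.ofReal_le_ofReal ?_
          have e4 : (((B.powersetCard r).filter fun Q =>
              Misses S (some (Q.image fun z => z.2.2))).card : ℝ) / B.card.choose r ≤
              ((B.card - (copiesOf p B).card).choose r : ℝ) / B.card.choose r := by
            gcongr
          refine (e4.trans e3).trans ?_
          rw [Finset.empty_union, lack, sub_add_cancel]
          exact pow_le_pow_of_le_one hy0 hy1 (min_le_left _ _)
        · rw [ind_neg (by rintro ⟨R, hR, -⟩; exact absurd hR (by simp))]; exact zero_le
    _ ≤ ENNReal.ofReal ((1 - (1 - y) * p₀) ^ N) + ENNReal.ofReal (y ^ G) := by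
        rw [ex_add, ex_const]
        gcongr
        refine h.trans (ENNReal.ofReal_le_ofReal ?_)
        have h0 : lack y G (copiesOf p ∅).card ≤ 1 := by
          simpa [copiesOf] using lack_zero_le hy0 G
        exact mul_le_of_le_one_right (by positivity) h0
    _ = _ := by rw [ENNReal.ofReal_add (by positivity) (by positivity)]

/-- If fewer than r distinct copies were returned, `lack` with y = 1/2 and G = r is at least 2^(-r).
-/
theorem ex_sample_none_le (σ : Fin n → NodeState n) {N r : ℕ} {p₀ : ℝ}
    (hp₀ : 0 ≤ p₀) (hG : p₀ + r / n ≤ pullMass σ fun _ => true) (hp₀1 : p₀ ≤ 1) :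
    (ex (sample N r σ) fun o => ind (o = none)) ≤ ENNReal.ofReal (2 ^ r * (1 - p₀ / 2) ^ N) := by
  rw [ex_sample]
  have h := ex_gotCopies_lack_le σ (fun _ => true) (y := 1 / 2) (by norm_num) (by norm_num) hp₀ hG
    hp₀1 N ∅
  calc _ ≤ ex (indep N fun _ => pull σ) fun a => ENNReal.ofReal (2 ^ r) *
        ENNReal.ofReal (lack (1 / 2) r (copiesOf (fun _ => true) (∅ ∪ gotCopies a)).card) := by
        refine ex_mono _ fun a => ?_
        split_ifs with hr
        · simp [ind_neg]
        · rw [ind_pos rfl, ← ENNReal.ofReal_mul (by positivity), ENNReal.one_le_ofReal,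
            Finset.empty_union]
          have e1 : (copiesOf (fun _ => true) (gotCopies a)).card ≤ r - 1 := by
            refine (Finset.card_filter_le _ _).trans ?_
            omega
          have h1 := lack_anti (y := 1 / 2) (by norm_num) (by norm_num) r e1
          obtain ⟨k, hk⟩ : ∃ k, r = k + 1 := ⟨r - 1, by omega⟩
          have h2 : lack (1 / 2) r (r - 1) = (1 / 2) ^ r := by
            rw [hk, Nat.add_sub_cancel, lack, min_eq_left (Nat.le_succ k), pow_succ]; ring
          rw [h2] at h1
          calc (1 : ℝ) = 2 ^ r * (1 / 2) ^ r := by rw [← mul_pow]; norm_num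
            _ ≤ _ := by gcongr
    _ ≤ _ := by
        rw [ex_const_mul]
        refine (mul_le_mul_right h _).trans ?_
        rw [← ENNReal.ofReal_mul (by positivity)]
        refine ENNReal.ofReal_le_ofReal ?_
        have h0 : lack (1 / 2) r (copiesOf (fun _ : Fin n => true) ∅).card ≤ 1 := by
          simpa [copiesOf] using lack_zero_le (y := 1 / 2) (by norm_num) r
        have hρ : (0 : ℝ) ≤ 1 - (1 - 1 / 2) * p₀ := by linarith
        calc _ ≤ 2 ^ r * ((1 - (1 - 1 / 2) * p₀) ^ N * 1) := by gcongr
          _ = _ := by rw [mul_one]; congr 2; ring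

end

/-! ### The choice made by a node from its sample -/

section
variable {n s : ℕ}

/-- The random choice in an iteration: a hitting set that is reported, or a set whose elements are
pushed, or nothing. -/
def choice [NeZero n] (𝒮 : Fin s → Finset (Fin n)) (d : ℕ) (c : ℝ)
    (σ : Fin n → NodeState n) : PMF (Option (Finset (Fin n)) × Option (Fin s)) :=
  (sample (numPulls c n s d) (sampleSize d s) σ).bind fun o =>
    match o with
    | none => PMF.pure (none, none)
    | some R =>
      if h : (unhit 𝒮 R).Nonempty then
        (PMF.uniformOfFinset (unhit 𝒮 R) h).map fun j => (none, some j)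
      else PMF.pure (some R, none)

open Classical in
/-- The copies pushed by a node that has chosen a set. -/
def pushList (𝒮 : Fin s → Finset (Fin n)) (d : ℕ) (c : ℝ) (v : NodeState n) (j : Option (Fin s)) :
    List (Fin n) :=
  match j with
  | none => []
  | some j => if ((v.store.filter fun x => x ∈ 𝒮 j).length : ℝ) ≤ c * d * Real.log n then
      v.store.filter fun x => x ∈ 𝒮 j else []

theorem length_pushList_le (𝒮 : Fin s → Finset (Fin n)) (d : ℕ) (c : ℝ) (v : NodeState n)
    (j : Option (Fin s)) : (pushList 𝒮 d c v j).length ≤ v.store.length := by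
  unfold pushList
  split
  · simp
  · split_ifs
    · exact List.length_filter_le _ _
    · simp

theorem pushList_of_le {𝒮 : Fin s → Finset (Fin n)} {d : ℕ} {c : ℝ} {v : NodeState n}
    (h : (v.store.length : ℝ) ≤ c * d * Real.log n) (j : Fin s) :
    pushList 𝒮 d c v (some j) = v.store.filter fun x => x ∈ 𝒮 j := by
  refine if_pos (le_trans ?_ h)
  exact_mod_cast List.length_filter_le _ _

variable [NeZero n] {𝒮 : Fin s → Finset (Fin n)} {d : ℕ} {c : ℝ} {σ : Fin n → NodeState n}

/-- The choice has the same law at all nodes; the node itself matters only for the copies it then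
pushes. -/
theorem search_eq (v : Fin n) :
    search 𝒮 d c σ v = (choice 𝒮 d c σ).map fun z => (z.1, pushList 𝒮 d c (σ v) z.2) := by
  unfold search choice
  rw [PMF.map_bind]
  congr 1; funext o
  cases o with
  | none => simp [PMF.pure_map, pushList]
  | some R =>
    dsimp only
    split_ifs with h
    · rw [PMF.map_comp]
      congr 1
    · simp [PMF.pure_map, pushList]

theorem ex_search (F : (Fin n → Option (Finset (Fin n)) × List (Fin n)) → ℝ≥0∞) :
    ex (indep n fun v => search 𝒮 d c σ v) F =
      ex (indep n fun _ => choice 𝒮 d c σ) fun z =>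
        F fun v => ((z v).1, pushList 𝒮 d c (σ v) (z v).2) := by
  simp only [search_eq, ex_indep_map]

theorem ex_choice_pick_le (j : Fin s) :
    (ex (choice 𝒮 d c σ) fun z => ind (z.2 = some j)) ≤
      ex (sample (numPulls c n s d) (sampleSize d s) σ) fun o => ind (Misses (𝒮 j) o) := by
  rw [choice, ex_bind]
  refine ex_mono _ fun o => ?_
  cases o with
  | none => simp [ex_pure, ind_neg]
  | some R =>
    dsimp only
    split_ifs with h
    · by_cases hj : 𝒮 j ∩ R = ∅
      · rw [ind_pos ⟨R, rfl, hj⟩]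
        exact ex_le_of_forall _ fun _ _ => ind_le_one _
      · rw [ex_map]
        refine (ex_le_of_forall _ fun k hk => ?_).trans (zero_le)
        rw [PMF.mem_support_uniformOfFinset_iff, unhit, Finset.mem_filter] at hk
        rw [ind_neg]
        rintro h
        rw [Option.some.inj h] at hk
        exact hj hk.2
    · simp [ex_pure, ind_neg]

theorem ex_choice_none_le :
    (ex (choice 𝒮 d c σ) fun z => ind (z.1 = none ∧ z.2 = none)) ≤
      ex (sample (numPulls c n s d) (sampleSize d s) σ) fun o => ind (o = none) := by
  rw [choice, ex_bind]
  refine ex_mono _ fun o => ?_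
  cases o with
  | none => simp [ex_pure, ind_pos]
  | some R =>
    dsimp only
    split_ifs with h
    · rw [ex_map]; simp [ind_neg, ex_const]
    · simp [ex_pure, ind_neg]

theorem card_le_of_mem_support_sample {N r : ℕ} {R : Finset (Fin n)}
    (h : some R ∈ (sample N r σ).support) : R.card ≤ r := by
  simp only [sample, PMF.mem_support_bind_iff] at h
  obtain ⟨a, -, h⟩ := h
  split_ifs at h with hr
  · rw [PMF.mem_support_map_iff] at h
    obtain ⟨Q, hQ, hR⟩ := h
    rw [PMF.mem_support_uniformOfFinset_iff, Finset.mem_powersetCard] at hQ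
    rw [← Option.some.inj hR, ← hQ.2]
    exact Finset.card_image_le
  · rw [PMF.mem_support_pure_iff] at h
    exact absurd h (by simp)

theorem isHittingSet_of_mem_support_choice {z : Option (Finset (Fin n)) × Option (Fin s)}
    (hz : z ∈ (choice 𝒮 d c σ).support) {R : Finset (Fin n)} (hR : z.1 = some R) :
    IsHittingSet 𝒮 R ∧ R.card ≤ sampleSize d s ∧ z.2 = none := by
  rw [choice, PMF.mem_support_bind_iff] at hz
  obtain ⟨o, ho, hz⟩ := hz
  cases o with
  | none =>
    rw [PMF.mem_support_pure_iff] at hz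
    rw [hz] at hR; exact absurd hR (by simp)
  | some R' =>
    dsimp only at hz
    split_ifs at hz with h
    · rw [PMF.mem_support_map_iff] at hz
      obtain ⟨j, -, rfl⟩ := hz
      exact absurd hR (by simp)
    · rw [PMF.mem_support_pure_iff] at hz
      subst hz
      cases Option.some.inj hR
      refine ⟨fun j => ?_, card_le_of_mem_support_sample ho, rfl⟩
      by_contra hj
      refine h ⟨j, ?_⟩
      rw [unhit, Finset.mem_filter]
      exact ⟨Finset.mem_univ _, Finset.not_nonempty_iff_eq_empty.1 hj⟩

theorem ex_sum_pick_le_one :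
    ∑ j, (ex (choice 𝒮 d c σ) fun z => ind (z.2 = some j)) ≤ 1 := by
  rw [← ex_finset_sum]
  refine ex_le_of_forall _ fun z _ => ?_
  rcases h : z.2 with - | k
  · simp [ind_neg]
  · rw [Finset.sum_eq_single k]
    · exact ind_le_one _
    · intro b _ hb
      exact ind_neg fun h => hb (Option.some.inj h).symm
    · simp

/-! ### Numerical bounds for the sampling -/

theorem one_le_log_twelve {d s : ℕ} (hd : 1 ≤ d) (hs : 1 ≤ s) :
    1 ≤ Real.log (12 * d * s) := by
  have h1 : (1 : ℝ) ≤ d * s := by exact_mod_cast Nat.mul_pos hd hs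
  rw [Real.le_log_iff_exp_le (by nlinarith)]
  have := Real.exp_one_lt_d9
  nlinarith

theorem one_sub_pow_le_exp {x : ℝ} (hx : x ≤ 1) (N : ℕ) : (1 - x) ^ N ≤ Real.exp (-(N * x)) := by
  have := Real.add_one_le_exp (-x)
  calc (1 - x) ^ N ≤ Real.exp (-x) ^ N := pow_le_pow_left₀ (by linarith) (by linarith) _
    _ = _ := by rw [← Real.exp_nat_mul]; congr 1; ring

theorem le_numPulls (c : ℝ) (n s d : ℕ) :
    c * ((sampleSize d s : ℝ) + Real.log n) ≤ numPulls c n s d := Nat.le_ceil _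

theorem le_sampleSize (d s : ℕ) : 6 * (d : ℝ) * Real.log (12 * d * s) ≤ sampleSize d s :=
  Nat.le_ceil _

/-- With L = log(12ds), both terms of `ex_sample_misses_le` are at most exp(-L) = 1/(12ds). This
works since r/(5d) ≥ 6L/5, and the excess over L covers the losses. -/
theorem ex_sample_misses_le_of_pullMass (hd : 1 ≤ d) (hs : 1 ≤ s) (hc : 200 ≤ c)
    (hN : (numPulls c n s d : ℝ) ≤ n / 20) (hdn : 100 * (d : ℝ) ≤ n) (S : Finset (Fin n))
    (hS : 1 / (5 * (d : ℝ)) ≤ pullMass σ (· ∈ S)) :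
    (ex (sample (numPulls c n s d) (sampleSize d s) σ) fun o => ind (Misses S o)) ≤
      ENNReal.ofReal (1 / (6 * d * s)) := by
  have hL := one_le_log_twelve hd hs
  set L := Real.log (12 * d * s) with hLdef
  set N := numPulls c n s d with hNdef
  set r := sampleSize d s with hrdef
  have hd1 : (1 : ℝ) ≤ d := by exact_mod_cast hd
  have hs1 : (1 : ℝ) ≤ s := by exact_mod_cast hs
  have hn1 : (1 : ℝ) ≤ n := by exact_mod_cast NeZero.one_le
  have hr : 6 * (d : ℝ) * L ≤ r := le_sampleSize d s
  have hr1 : (0 : ℝ) < r := by nlinarith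
  have hlog : 0 ≤ Real.log n := Real.log_nonneg hn1
  have hNr : 200 * (r : ℝ) ≤ N := by
    refine le_trans ?_ (le_numPulls c n s d)
    nlinarith
  have hN0 : (0 : ℝ) < N := by linarith
  set q : ℝ := 1 / (5 * d) with hq
  have hq0 : 0 < q := by positivity
  have hqd : q * d = 1 / 5 := by rw [hq]; field_simp
  have hq1 : q ≤ 1 := by rw [hq, div_le_one (by positivity)]; linarith
  -- About the number of copies of `S` that N pulls return on average. As N ≤ n/20, having seen that
  -- many reduces the pull probability by at most a tenth of q.
  set G := ⌈(N : ℝ) * q⌉₊ with hG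
  have hG1 : (N : ℝ) * q ≤ G := Nat.le_ceil _
  have hG2 : (G : ℝ) < N * q + 1 := Nat.ceil_lt_add_one (by positivity)
  have hGn : (G : ℝ) / n ≤ q / 10 := by
    rw [div_le_iff₀ (by linarith)]
    nlinarith [hdn]
  set p₀ : ℝ := 9 / 10 * q with hp₀
  have h := ex_sample_misses_le (N := N) (r := r) (G := G) (p₀ := p₀) σ S (by positivity)
    (by linarith) (by linarith)
  refine h.trans (ENNReal.ofReal_le_ofReal ?_)
  set x : ℝ := r / N with hx
  have hx0 : 0 < x := by positivity
  have hxN : x * N = r := by rw [hx]; field_simp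
  have hx1 : x ≤ 1 / 200 := by rw [hx, div_le_iff₀ hN0]; linarith
  -- Since c ≥ 200 forces x = r/N ≤ 1/200, linearising the exponential loses almost nothing.
  have hexp : 200 / 201 * x ≤ 1 - Real.exp (-x) := by
    have h1 := Real.add_one_le_exp x
    have h2 : Real.exp (-x) ≤ 1 / (x + 1) := by
      rw [Real.exp_neg, ← one_div]; exact one_div_le_one_div_of_le (by linarith) h1
    have h3 : 1 / (x + 1) ≤ 1 - 200 / 201 * x := by
      rw [div_le_iff₀ (by linarith)]; nlinarith
    linarith
  have hexp1 : 1 - Real.exp (-x) ≤ 1 := by linarith [Real.exp_pos (-x)]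
  have hpos : (0 : ℝ) < 12 * d * s := by positivity
  have hEL : Real.exp (-L) = 1 / (12 * d * s) := by
    rw [Real.exp_neg, hLdef, Real.exp_log hpos, one_div]
  have hrq : 6 / 5 * L ≤ r * q := by nlinarith
  have e1 : (1 - (1 - Real.exp (-x)) * p₀) ^ N ≤ Real.exp (-L) := by
    refine (one_sub_pow_le_exp (by nlinarith) N).trans (Real.exp_le_exp.2 ?_)
    have : 200 / 201 * x * p₀ ≤ (1 - Real.exp (-x)) * p₀ := by gcongr
    have h2 : (N : ℝ) * (200 / 201 * x * p₀) ≤ N * ((1 - Real.exp (-x)) * p₀) := by gcongr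
    have h3 : (N : ℝ) * (200 / 201 * x * p₀) = 200 / 201 * (9 / 10) * (r * q) := by
      rw [hp₀, ← hxN]; ring
    linarith
  have e2 : Real.exp (-x) ^ G ≤ Real.exp (-L) := by
    rw [← Real.exp_nat_mul]
    refine Real.exp_le_exp.2 ?_
    have : x * (N * q) ≤ x * G := by gcongr
    have h3 : x * (N * q) = r * q := by rw [← hxN]; ring
    linarith
  calc _ ≤ Real.exp (-L) + Real.exp (-L) := add_le_add e1 e2
    _ = _ := by rw [hEL]; field_simp; norm_num

theorem ex_sample_none_le_of_occupied (hd : 1 ≤ d) (hs : 1 ≤ s) (hc : 200 ≤ c)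
    (hN : (numPulls c n s d : ℝ) ≤ n / 20)
    (hocc : 1 / 8 ≤ pullMass σ fun _ => true) :
    (ex (sample (numPulls c n s d) (sampleSize d s) σ) fun o => ind (o = none)) ≤
      ENNReal.ofReal (1 / 20) := by
  have hL := one_le_log_twelve hd hs
  set L := Real.log (12 * d * s) with hLdef
  set N := numPulls c n s d with hNdef
  set r := sampleSize d s with hrdef
  have hd1 : (1 : ℝ) ≤ d := by exact_mod_cast hd
  have hn1 : (1 : ℝ) ≤ n := by exact_mod_cast NeZero.one_le
  have hr : 6 * (d : ℝ) * L ≤ r := le_sampleSize d s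
  have hr1 : (6 : ℝ) ≤ r := by nlinarith
  have hlog : 0 ≤ Real.log n := Real.log_nonneg hn1
  have hNr : 200 * (r : ℝ) ≤ N := by
    refine le_trans ?_ (le_numPulls c n s d)
    nlinarith
  have hrn : (r : ℝ) / n ≤ 1 / 16 := by rw [div_le_iff₀ (by linarith)]; linarith
  refine (ex_sample_none_le (N := N) (r := r) (p₀ := 1 / 16) σ (by norm_num) (by linarith)
    (by norm_num)).trans (ENNReal.ofReal_le_ofReal ?_)
  have h1 : (2 : ℝ) ^ r ≤ Real.exp r := by
    have : (2 : ℝ) ≤ Real.exp 1 := by linarith [Real.exp_one_gt_d9]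
    calc (2 : ℝ) ^ r ≤ Real.exp 1 ^ r := by gcongr
      _ = _ := by rw [← Real.exp_nat_mul, mul_one]
  calc (2 : ℝ) ^ r * (1 - 1 / 16 / 2) ^ N ≤ Real.exp r * Real.exp (-(N * (1 / 16 / 2))) := by
        gcongr
        exact one_sub_pow_le_exp (by norm_num) N
    _ = Real.exp (r - N / 32) := by rw [← Real.exp_add]; congr 1; ring
    _ ≤ Real.exp (-30) := Real.exp_le_exp.2 (by linarith)
    _ ≤ 1 / 20 := by
        rw [Real.exp_neg, inv_eq_one_div]
        refine one_div_le_one_div_of_le (by norm_num) ?_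
        linarith [Real.add_one_le_exp (30 : ℝ)]

end

/-! ### Balanced states and the number of pushed copies -/

section
variable {n s : ℕ}

/-- The number of stored copies of points that satisfy `p`. -/
def copyCount (p : Fin n → Bool) (x : Tracked n s) : ℕ :=
  ∑ u, (x.cfg.node u).store.countP p

/-- The size restrictions under which the algorithm is analysed. -/
structure Regime (n s d : ℕ) (c : ℝ) : Prop where
  one_le_d : 1 ≤ d
  one_le_s : 1 ≤ s
  le_c : 200 ≤ c
  numPulls_le : (numPulls c n s d : ℝ) ≤ n / 20
  hundred_mul_le : 100 * (d : ℝ) ≤ n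
  one_le_log : 1 ≤ Real.log n

/-- The stored copies are distributed in a balanced way. -/
structure Balanced (𝒮 : Fin s → Finset (Fin n)) (d : ℕ) (x : Tracked n s) : Prop where
  load : ∀ u, ((x.cfg.node u).store.length : ℝ) ≤ Real.log n
  crowded : ∀ j, Real.log 2 * crowded (𝒮 j) 1000 x / 1000 ≤
    crowdedWeight * Real.exp (1 / 4 * 800) * (x.setMass j + (𝒮 j).card) + 1 / 1000 * (n / d)
  extra : ∀ j, x.setMass j / 2 ≤ Real.log 2 * extraCount (𝒮 j) x + 1 / 1000 * (n / d)
  occupied : 1 / 8 ≤ pullMass x.cfg.node fun _ => true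
  orig : ∀ p, ∑ u, (x.cfg.node u).orig.countP p = (List.finRange n).countP p

theorem pullMass_congr {σ σ' : Fin n → NodeState n} (h : ∀ u, (σ u).store = (σ' u).store)
    (p : Fin n → Bool) : pullMass σ p = pullMass σ' p := by
  simp only [pullMass, h]

/-- At a node with fewer than M copies, each copy is returned with probability at least 1/M once the
node is contacted. The copies outside crowded nodes are therefore visible to pulls. -/
theorem copyCount_le_crowded_add (S : Finset (Fin n)) (M : ℕ) (x : Tracked n s) [NeZero n] :
    (copyCount (· ∈ S) x : ℝ) ≤ crowded S M x + M * n * pullMass x.cfg.node (· ∈ S) := by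
  have hn : (n : ℝ) ≠ 0 := by exact_mod_cast NeZero.ne n
  rw [pullMass, mul_assoc, mul_div_cancel₀ _ hn, copyCount, crowded, Finset.mul_sum]
  push_cast
  rw [← Finset.sum_add_distrib]
  refine Finset.sum_le_sum fun u _ => ?_
  set k := (x.cfg.node u).store.countP (· ∈ S) with hk
  have hkl : k ≤ (x.cfg.node u).store.length := List.countP_le_length
  set l := (x.cfg.node u).store.length
  split_ifs with h
  · exact le_add_of_nonneg_right (by positivity)
  · rw [zero_add]
    rcases Nat.eq_zero_or_pos k with h0 | h0
    · rw [h0]; simp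
    · have hl : (0 : ℝ) < l := by exact_mod_cast h0.trans_le hkl
      have hM : (l : ℝ) ≤ M := by exact_mod_cast (not_le.1 h).le
      rw [mul_div_assoc', le_div_iff₀ hl, mul_comm]
      gcongr

theorem pullMass_le_one (σ : Fin n → NodeState n) (p : Fin n → Bool) : pullMass σ p ≤ 1 := by
  unfold pullMass
  refine div_le_one_of_le₀ ?_ (Nat.cast_nonneg _)
  calc _ ≤ ∑ _u : Fin n, (1 : ℝ) := Finset.sum_le_sum fun u _ =>
        div_le_one_of_le₀ (by exact_mod_cast List.countP_le_length) (Nat.cast_nonneg _)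
    _ = n := by simp

/-- This explains the threshold 1000: (4/5)^1000 has to beat the constant exp(200) that comes from
the budget 800. It does, as (4/5)^5 e < 9/10. -/
theorem crowdedWeight_mul_exp_le : crowdedWeight * Real.exp (1 / 4 * 800) ≤ 1 / 10 ^ 7 := by
  have h : Real.exp (1 / 4 * 800) = Real.exp 1 ^ 200 := by
    rw [← Real.exp_nat_mul]; norm_num
  have h2 : crowdedWeight = 5 * ((4 / 5 : ℝ) ^ 5) ^ 200 := by
    rw [crowdedWeight, ← pow_mul]
  rw [h, h2, mul_assoc, ← mul_pow]
  have h3 : (4 / 5 : ℝ) ^ 5 * Real.exp 1 ≤ 0.9 := by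
    have := Real.exp_one_lt_d9
    norm_num at this ⊢
    linarith
  calc 5 * ((4 / 5 : ℝ) ^ 5 * Real.exp 1) ^ 200 ≤ 5 * 0.9 ^ 200 := by gcongr
    _ ≤ _ := by norm_num

/-- The crowded copies are bounded by a tiny multiple of the expected number of copies, which in
turn is bounded by the actual number. Absorbing this multiple on the left costs the factor 101/100.
-/
theorem Balanced.copyCount_le [NeZero n] {𝒮 : Fin s → Finset (Fin n)} {d : ℕ} {x : Tracked n s}
    (h : Balanced 𝒮 d x) (j : Fin s) : (copyCount (· ∈ 𝒮 j) x : ℝ) ≤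
      101 / 100 * (1000 * n * pullMass x.cfg.node (· ∈ 𝒮 j) + 3 / 2 * (n / d)) := by
  have h1 := copyCount_le_crowded_add (𝒮 j) 1000 x
  have h4 := h.crowded j
  have h5 := h.extra j
  have hk : copyCount (· ∈ 𝒮 j) x = (𝒮 j).card + extraCount (𝒮 j) x := by
    simp only [copyCount, extraCount, NodeState.store, List.countP_append, Finset.sum_add_distrib]
    rw [h.orig, countP_finRange]
  have hk' : (copyCount (· ∈ 𝒮 j) x : ℝ) = (𝒮 j).card + extraCount (𝒮 j) x := by exact_mod_cast hk
  have hw := crowdedWeight_mul_exp_le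
  have hw0 : 0 ≤ crowdedWeight * Real.exp (1 / 4 * 800) := by unfold crowdedWeight; positivity
  set w := crowdedWeight * Real.exp (1 / 4 * 800)
  have hl1 := Real.log_two_gt_d9
  have hl2 := Real.log_two_lt_d9
  set l := Real.log 2
  have hπ := pullMass_nonneg x.cfg.node (· ∈ 𝒮 j)
  have hP : 0 ≤ (n : ℝ) * pullMass x.cfg.node (· ∈ 𝒮 j) := by positivity
  have hQ : (0 : ℝ) ≤ n / d := by positivity
  rw [mul_assoc] at h1
  rw [mul_assoc 1000]
  generalize (n : ℝ) * pullMass x.cfg.node (· ∈ 𝒮 j) = P at *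
  generalize (n : ℝ) / d = Q at *
  generalize x.setMass j = κ at *
  have hc0 : (0 : ℝ) ≤ Gossip.crowded (𝒮 j) 1000 x := by positivity
  have he0 : (0 : ℝ) ≤ extraCount (𝒮 j) x := by positivity
  have hs0 : (0 : ℝ) ≤ (𝒮 j).card := by positivity
  have hk0 : (0 : ℝ) ≤ copyCount (· ∈ 𝒮 j) x := by positivity
  generalize (Gossip.crowded (𝒮 j) 1000 x : ℝ) = C at *
  generalize (extraCount (𝒮 j) x : ℝ) = E at *
  generalize ((𝒮 j).card : ℝ) = K at *
  generalize (copyCount (· ∈ 𝒮 j) x : ℝ) = k at *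
  have a1 : κ ≤ 2 * (0.7 * E) + 2 * (1 / 1000 * Q) := by nlinarith
  have a2 : κ + K ≤ 2 * k + Q := by linarith
  have a3 : w * (κ + K) ≤ 1 / 10 ^ 7 * (2 * k + Q) := by
    calc w * (κ + K) ≤ w * (2 * k + Q) := by gcongr
      _ ≤ _ := by gcongr
  have a4 : 0.69 * C ≤ l * C := by gcongr; linarith
  norm_num at h1 a3 a4 ⊢
  linarith

/-- Sets that are visible (π at least 1/(5d)) are picked so rarely that all s of them together
contribute at most (1010/6)N/d. Every other set has at most (101/100)(200 + 3/2)N/d copies, and the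
picking probabilities sum to at most 1. -/
theorem sum_pick_mul_le {ι : Type} [Fintype ι] {s d : ℕ} (hs : Fintype.card ι = s) (hs1 : 1 ≤ s)
    (hd : 1 ≤ d) {N : ℝ} (hN : 0 ≤ N) {p k π : ι → ℝ} (hp : ∀ j, 0 ≤ p j) (hp1 : ∑ j, p j ≤ 1)
    (hπ0 : ∀ j, 0 ≤ π j)
    (hπ : ∀ j, π j ≤ 1) (hpπ : ∀ j, 1 / (5 * (d : ℝ)) ≤ π j → p j ≤ 1 / (6 * d * s))
    (hk : ∀ j, k j ≤ 101 / 100 * (1000 * N * π j + 3 / 2 * (N / d))) :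
    ∑ j, p j * k j ≤ 373 * (N / d) := by
  have hd1 : (1 : ℝ) ≤ d := by exact_mod_cast hd
  have hs1 : (1 : ℝ) ≤ s := by exact_mod_cast hs1
  have hterm : ∀ j, p j * k j ≤
      p j * (101 / 100 * (403 / 2) * (N / d)) + 1 / (6 * d * s) * (1010 * N) := by
    intro j
    have h1 : p j * k j ≤ p j * (101 / 100 * (1000 * N * π j + 3 / 2 * (N / d))) :=
      mul_le_mul_of_nonneg_left (hk j) (hp j)
    have hQ : 0 ≤ N / d := by positivity
    rcases le_or_gt (1 / (5 * (d : ℝ))) (π j) with h | h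
    · have h2 : p j * (π j * (1010 * N)) ≤ 1 / (6 * d * s) * (1 * (1010 * N)) := by
        have := hπ0 j
        gcongr
        · exact hpπ j h
        · exact hπ j
      have h3 := mul_nonneg (hp j) hQ
      linarith
    · have h2 : p j * (N * π j) ≤ p j * (N * (1 / (5 * d))) := by
        have := hp j
        gcongr
      have h3 : N * (1 / (5 * (d : ℝ))) = 1 / 5 * (N / d) := by field_simp
      rw [h3] at h2
      have h4 : 0 ≤ 1 / (6 * d * s) * (1010 * N) := by positivity
      linarith
  calc _ ≤ ∑ j, (p j * (101 / 100 * (403 / 2) * (N / d)) + 1 / (6 * d * s) * (1010 * N)) :=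
        Finset.sum_le_sum fun j _ => hterm j
    _ = (∑ j, p j) * (101 / 100 * (403 / 2) * (N / d)) + s * (1 / (6 * d * s) * (1010 * N)) := by
        rw [Finset.sum_add_distrib, Finset.sum_mul, Finset.sum_const, Finset.card_univ, hs,
          nsmul_eq_mul]
    _ ≤ 1 * (101 / 100 * (403 / 2) * (N / d)) + s * (1 / (6 * d * s) * (1010 * N)) := by
        gcongr
    _ = (101 / 100 * (403 / 2) + 1010 / 6) * (N / d) := by field_simp
    _ ≤ _ := by
        have : 0 ≤ N / d := by positivity
        nlinarith

variable [NeZero n] {𝒮 : Fin s → Finset (Fin n)} {d : ℕ} {c : ℝ} {σ : Fin n → NodeState n}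
  {x : Tracked n s}

/-- The probability that a given set is chosen. -/
def pickProb (𝒮 : Fin s → Finset (Fin n)) (d : ℕ) (c : ℝ) (σ : Fin n → NodeState n) (j : Fin s) :
    ℝ := (ex (choice 𝒮 d c σ) fun z => ind (z.2 = some j)).toReal

theorem ex_ind_ne_top {α : Type} (p : PMF α) (A : α → Prop) : (ex p fun a => ind (A a)) ≠ ⊤ :=
  ((ex_le_of_forall _ fun _ _ => ind_le_one _).trans_lt ENNReal.one_lt_top).ne

theorem ofReal_pickProb (j : Fin s) : ENNReal.ofReal (pickProb 𝒮 d c σ j) =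
    ex (choice 𝒮 d c σ) fun z => ind (z.2 = some j) :=
  ENNReal.ofReal_toReal (ex_ind_ne_top _ _)

theorem Balanced.sum_pickProb_mul_le (h : Balanced 𝒮 d x) (hr : Regime n s d c)
    (hσ : ∀ u, (σ u).store = (x.cfg.node u).store) :
    ∑ j, pickProb 𝒮 d c σ j * copyCount (· ∈ 𝒮 j) x ≤ 373 * ((n : ℝ) / d) := by
  refine sum_pick_mul_le (Fintype.card_fin s) hr.one_le_s hr.one_le_d (Nat.cast_nonneg n)
    (π := fun j => pullMass x.cfg.node (· ∈ 𝒮 j)) (fun j => ENNReal.toReal_nonneg) ?_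
    (fun j => pullMass_nonneg _ _) (fun j => pullMass_le_one _ _) (fun j hj => ?_)
    (fun j => h.copyCount_le j)
  · unfold pickProb
    rw [← ENNReal.toReal_sum fun j _ => ex_ind_ne_top _ _]
    exact ENNReal.toReal_le_of_le_ofReal zero_le_one (by simpa using ex_sum_pick_le_one)
  · refine ENNReal.toReal_le_of_le_ofReal (by positivity) ((ex_choice_pick_le j).trans ?_)
    refine ex_sample_misses_le_of_pullMass hr.one_le_d hr.one_le_s hr.le_c hr.numPulls_le
      hr.hundred_mul_le _ ?_
    rwa [pullMass_congr hσ]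

theorem exp_le_one_add {y : ℝ} (h0 : 0 ≤ y) (h1 : y ≤ 1 / 20) :
    Real.exp y ≤ 1 + 21 / 20 * y := by
  have := Real.abs_exp_sub_one_sub_id_le (x := y) (by rw [abs_of_nonneg h0]; linarith)
  have := (abs_le.1 this).2
  nlinarith

theorem length_pushList_some_le (v : NodeState n) (j : Fin s) :
    (pushList 𝒮 d c v (some j)).length ≤ v.store.countP (· ∈ 𝒮 j) := by
  rw [List.countP_eq_length_filter]
  unfold pushList
  dsimp only
  split_ifs
  · exact le_rfl
  · simp

/-- For exponents up to 1/20 the exponential is linear up to a factor 21/20, so the moment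
generating function is controlled by the mean. -/
theorem ex_exp_length_pushList_le {θ : ℝ} (hθ : 0 ≤ θ) (v : NodeState n)
    (hv : θ * v.store.length ≤ 1 / 20) :
    (ex (choice 𝒮 d c σ) fun z =>
      ENNReal.ofReal (Real.exp (θ * (pushList 𝒮 d c v z.2).length))) ≤
      ENNReal.ofReal (Real.exp
        (21 / 20 * θ * ∑ j, pickProb 𝒮 d c σ j * v.store.countP (· ∈ 𝒮 j))) := by
  calc _ ≤ ex (choice 𝒮 d c σ) fun z => 1 + ∑ j, ind (z.2 = some j) *
        ENNReal.ofReal (21 / 20 * θ * v.store.countP (· ∈ 𝒮 j)) := by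
        refine ex_mono _ fun z => ?_
        rcases z.2 with - | k
        · simp [pushList]
        · rw [Finset.sum_eq_single k (fun b _ hb => by
            rw [ind_neg fun h => hb (Option.some.inj h).symm, zero_mul]) (by simp), ind_pos rfl,
            one_mul, ← ENNReal.ofReal_one, ← ENNReal.ofReal_add zero_le_one (by positivity)]
          refine ENNReal.ofReal_le_ofReal ?_
          have h1 : θ * (pushList 𝒮 d c v (some k)).length ≤ θ * v.store.countP (· ∈ 𝒮 k) := by
            gcongr; exact length_pushList_some_le _ _
          have h2 : θ * v.store.countP (· ∈ 𝒮 k) ≤ θ * v.store.length := by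
            gcongr; exact List.countP_le_length
          have := exp_le_one_add (y := θ * v.store.countP (· ∈ 𝒮 k)) (by positivity) (by linarith)
          refine (Real.exp_le_exp.2 h1).trans (this.trans_eq (by ring))
    _ = ENNReal.ofReal (1 + 21 / 20 * θ * ∑ j, pickProb 𝒮 d c σ j *
          v.store.countP (· ∈ 𝒮 j)) := by
        have hp : ∀ j, 0 ≤ pickProb 𝒮 d c σ j := fun j => ENNReal.toReal_nonneg
        rw [ex_add, ex_const, ex_finset_sum, Finset.mul_sum, ENNReal.ofReal_add zero_le_one
          (Finset.sum_nonneg fun j _ => by have := hp j; positivity), ENNReal.ofReal_one,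
          ENNReal.ofReal_sum_of_nonneg fun j _ => by have := hp j; positivity]
        congr 1
        refine Finset.sum_congr rfl fun j _ => ?_
        rw [ex_mul_const, ← ofReal_pickProb, ← ENNReal.ofReal_mul (hp j)]
        congr 1; ring
    _ ≤ _ := ENNReal.ofReal_le_ofReal (by rw [add_comm]; exact Real.add_one_le_exp _)

/-- The nodes choose independently, so the exponents add up to (21/20)·373 ≤ 392 times θn/d. -/
theorem Balanced.ex_exp_pushes_le (h : Balanced 𝒮 d x) (hr : Regime n s d c)
    (hσ : ∀ u, (σ u).store = (x.cfg.node u).store) {θ : ℝ} (hθ : 0 ≤ θ)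
    (hθ1 : θ * Real.log n ≤ 1 / 20) :
    (ex (indep n fun v => search 𝒮 d c σ v) fun RW =>
      ENNReal.ofReal (Real.exp (θ * (pushes RW).length))) ≤
      ENNReal.ofReal (Real.exp (392 * θ * (n / d))) := by
  rw [ex_search]
  calc _ = ex (indep n fun _ => choice 𝒮 d c σ) fun z => ∏ v,
        ENNReal.ofReal (Real.exp (θ * (pushList 𝒮 d c (σ v) (z v).2).length)) := by
        congr 1; funext z
        rw [← ENNReal.ofReal_prod_of_nonneg fun _ _ => (Real.exp_pos _).le, ← Real.exp_sum,
          ← Finset.mul_sum]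
        congr 3
        simp [pushes, List.sum_ofFn]
    _ ≤ ∏ v, ENNReal.ofReal (Real.exp
        (21 / 20 * θ * ∑ j, pickProb 𝒮 d c σ j * (σ v).store.countP (· ∈ 𝒮 j))) := by
        refine (ex_indep_prod n (fun _ => choice 𝒮 d c σ) fun v z =>
          ENNReal.ofReal (Real.exp (θ * (pushList 𝒮 d c (σ v) z.2).length))).trans_le ?_
        refine Finset.prod_le_prod' fun v _ => ex_exp_length_pushList_le hθ _ ?_
        rw [hσ]
        have := h.load v
        calc θ * ((x.cfg.node v).store.length : ℝ) ≤ θ * Real.log n := by gcongr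
          _ ≤ _ := hθ1
    _ ≤ _ := by
        rw [← ENNReal.ofReal_prod_of_nonneg fun _ _ => (Real.exp_pos _).le, ← Real.exp_sum,
          ← Finset.mul_sum, Finset.sum_comm]
        refine ENNReal.ofReal_le_ofReal (Real.exp_le_exp.2 ?_)
        have h1 := h.sum_pickProb_mul_le hr hσ
        have h2 : ∑ j, ∑ v, pickProb 𝒮 d c σ j * ((σ v).store.countP (· ∈ 𝒮 j) : ℝ) =
            ∑ j, pickProb 𝒮 d c σ j * copyCount (· ∈ 𝒮 j) x := by
          refine Finset.sum_congr rfl fun j _ => ?_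
          rw [← Finset.mul_sum, copyCount]
          push_cast
          simp only [hσ]
        rw [h2]
        have hQ : (0 : ℝ) ≤ θ * (n / d) := by positivity
        calc _ ≤ 21 / 20 * θ * (373 * ((n : ℝ) / d)) := by gcongr
          _ ≤ _ := by nlinarith

theorem sum_keepProb_pow_le (hd : 1 ≤ d) (m : ℕ) :
    ∑ i ∈ Finset.range m, keepProb d ^ (i + 1) ≤ 2 * d := by
  have hd1 : (1 : ℝ) ≤ d := by exact_mod_cast hd
  have hq : keepProb d * (2 * d + 1) = 2 * d := by unfold keepProb; field_simp
  have hq0 := keepProb_pos d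
  have h : ∑ i ∈ Finset.range m, keepProb d ^ (i + 1) = 2 * d * (1 - keepProb d ^ m) := by
    induction m with
    | zero => simp
    | succ m ih =>
      rw [Finset.sum_range_succ, ih, pow_succ]
      linear_combination keepProb d ^ m * hq
  rw [h]
  have : 0 ≤ keepProb d ^ m := by positivity
  nlinarith

/-- The expected number of copies stays bounded. -/
theorem killed_mass_le (G : ℕ → Tracked n s → Prop) (hr : Regime n s d c)
    (hG : ∀ t x, G t x → Running x → Balanced 𝒮 d x) (t : ℕ) :
    (killed (trackedInit n s) (trackedStep 𝒮 d c) G t fun x =>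
      ind (Running x ∧ (800 - 1) * n < x.mass)) ≤
      ENNReal.ofReal (Real.exp (-(3 / 4 * (n / Real.log n)))) := by
  have hl := hr.one_le_log
  have hl0 : 0 < Real.log n := by linarith
  -- The largest exponent for which loads up to log n satisfy the restriction of the linearisation.
  set η : ℝ := 1 / 20 / Real.log n with hη
  have hη0 : 0 < η := by positivity
  have hηl : η * Real.log n = 1 / 20 := by rw [hη]; field_simp
  have hd1 : (1 : ℝ) ≤ d := by exact_mod_cast hr.one_le_d
  set A : ℝ := 392 * η * (n / d) with hA
  have hA0 : 0 ≤ A := by positivity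
  -- The first term is the share of the present mass that survives m more filterings. The sum is
  -- reserved for the pushes of the remaining m iterations; it is at most 2d A = 784 η n in total.
  set Φ : ℕ → (Fin n → List (Fin n)) → (Fin n → List (Fin n)) → ℝ → (Fin s → ℝ) → ℝ≥0∞ :=
    fun m _ _ χ _ => ENNReal.ofReal (Real.exp (η * keepProb d ^ m * χ +
      A * ∑ i ∈ Finset.range m, keepProb d ^ (i + 1))) with hΦ
  have hstep : ∀ t x, G t x → ∀ m, t + m < t + m + 1 →
      ex (trackedStep 𝒮 d c t x) (loadPot (Φ m)) ≤ loadPot (Φ (m + 1)) x := by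
    intro t x hx m _
    by_cases hout : ∀ v, (check 𝒮 c t (x.cfg.node v)).out = none
    · have hrun := running_of_check hout
      rw [ex_trackedStep_loadPot 𝒮 d c t x hout, loadPot, if_pos hrun]
      simp only [hΦ, ex_const]
      have hq0 := keepProb_pos d
      have hq1 : keepProb d ^ (m + 1) ≤ 1 := pow_le_one₀ hq0.le (keepProb_le_one d)
      have hb := (hG t x hx hrun).ex_exp_pushes_le hr
        (σ := fun v => check 𝒮 c t (x.cfg.node v)) (fun u => check_store _ _ _ _)
        (θ := η * keepProb d ^ (m + 1)) (by positivity) (by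
          calc η * keepProb d ^ (m + 1) * Real.log n ≤ η * 1 * Real.log n := by gcongr
            _ = 1 / 20 := by rw [mul_one, hηl]
            _ ≤ _ := le_rfl)
      calc _ = ex (indep n fun v => search 𝒮 d c (fun v => check 𝒮 c t (x.cfg.node v)) v)
            fun RW => ENNReal.ofReal (Real.exp (η * keepProb d ^ (m + 1) * x.mass +
              A * ∑ i ∈ Finset.range m, keepProb d ^ (i + 1))) *
              ENNReal.ofReal (Real.exp (η * keepProb d ^ (m + 1) * (pushes RW).length)) := by
            congr 1; funext RW
            rw [← ENNReal.ofReal_mul (Real.exp_pos _).le, ← Real.exp_add]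
            congr 2; ring
        _ ≤ _ := by
            rw [ex_const_mul]
            refine (mul_le_mul_right hb _).trans_eq ?_
            rw [← ENNReal.ofReal_mul (Real.exp_pos _).le, ← Real.exp_add, Finset.sum_range_succ]
            congr 2; rw [hA]; ring
    · rw [ex_trackedStep_eq_zero hout fun x hx => by rw [loadPot, if_neg hx]]
      exact zero_le
  have hle : killed (trackedInit n s) (trackedStep 𝒮 d c) G t (loadPot (Φ 0)) ≤
      ENNReal.ofReal (Real.exp (784 * η * n)) := by
    refine (killed_le_of_remaining (f := fun m => loadPot (Φ m)) (T := t) _ _ _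
      (fun t' x hx m hm => hstep t' x hx m (Nat.lt_succ_self _)) (le_refl (t + 0))).trans ?_
    rw [ex_trackedInit]
    refine ex_le_of_forall _ fun P _ => ?_
    rw [loadPot]
    split_ifs
    · refine ENNReal.ofReal_le_ofReal (Real.exp_le_exp.2 ?_)
      simp only [mul_zero, zero_add]
      have := sum_keepProb_pow_le hr.one_le_d t
      calc A * ∑ i ∈ Finset.range t, keepProb d ^ (i + 1) ≤ A * (2 * d) := by gcongr
        _ = _ := by rw [hA]; field_simp; ring
    · exact zero_le
  -- The gap between 799 and 784 leaves the exponent 15 η n = (3/4) n / log n.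
  refine killed_markov (y := ENNReal.ofReal (Real.exp (-(799 * η * n)))) _ _ _ _
    (f := loadPot (Φ 0)) (fun x hx => ?_) ?_
  · rw [loadPot, if_pos hx.1, ← ENNReal.ofReal_mul (Real.exp_pos _).le, ← Real.exp_add,
      ENNReal.one_le_ofReal]
    refine Real.one_le_exp ?_
    have h1 : η * ((800 - 1) * n) ≤ η * x.mass := by gcongr; exact hx.2.le
    simp only [pow_zero, Finset.range_zero, Finset.sum_empty]
    nlinarith
  · refine (mul_le_mul_right hle _).trans_eq ?_
    rw [← ENNReal.ofReal_mul (Real.exp_pos _).le, ← Real.exp_add]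
    congr 2
    rw [hη]; field_simp; ring

end

/-! ### The scarcity of the points of a hitting set under filtering and pushing -/

theorem prod_rpow_le_average {ι : Type} {H : Finset ι} {d : ℕ} (hH : H.card = d) (hd : 1 ≤ d)
    {z : ι → ℝ} (hz : ∀ h, 0 ≤ z h) :
    ∏ h ∈ H, z h ^ (1 / (d : ℝ)) ≤ (∑ h ∈ H, z h) / d := by
  have hd0 : (0 : ℝ) < d := by exact_mod_cast hd
  have := Real.geom_mean_le_arith_mean_weighted H (fun _ => 1 / (d : ℝ)) z
    (fun _ _ => by positivity) (by
      rw [Finset.sum_const, hH, nsmul_eq_mul]; field_simp) (fun h _ => hz h)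
  refine this.trans_eq ?_
  rw [← Finset.mul_sum]; ring

theorem rpow_half_inv {d : ℕ} {y : ℝ} (hy : 0 ≤ y) :
    y ^ (1 / (2 * (d : ℝ))) = (y ^ (1 / 2 : ℝ)) ^ (1 / (d : ℝ)) := by
  rw [← Real.rpow_mul hy]; congr 1
  rw [div_mul_div_comm, one_mul]

theorem lintegral_pow (k : ℕ) :
    ∫⁻ x in Set.Ioc (0 : ℝ) 1, ENNReal.ofReal (x ^ k) = ENNReal.ofReal (1 / (1 + k)) := by
  rw [← MeasureTheory.ofReal_integral_eq_lintegral_ofReal,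
    ← intervalIntegral.integral_of_le zero_le_one, integral_pow]
  · simp [add_comm]
  · exact (intervalIntegrable_iff_integrableOn_Ioc_of_le zero_le_one).1
      (Continuous.intervalIntegrable (by fun_prop) _ _)
  · filter_upwards [MeasureTheory.ae_restrict_mem measurableSet_Ioc] with x hx
    have := hx.1.le
    positivity

theorem lintegral_affine_pow_le {q : ℝ} (hq : 0 < q) (hq1 : q ≤ 1) (k : ℕ) :
    ∫⁻ x in Set.Ioc (0 : ℝ) 1, ENNReal.ofReal ((1 - q + q * x) ^ k) ≤
      ENNReal.ofReal (1 / (q * (1 + k))) := by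
  rw [← MeasureTheory.ofReal_integral_eq_lintegral_ofReal,
    ← intervalIntegral.integral_of_le zero_le_one]
  · have h := intervalIntegral.integral_comp_add_mul (fun x : ℝ => x ^ k) (a := 0) (b := 1)
      hq.ne' (1 - q)
    rw [h, integral_pow]
    refine ENNReal.ofReal_le_ofReal ?_
    have h1 : 0 ≤ (1 - q) ^ (k + 1) := pow_nonneg (by linarith) _
    rw [smul_eq_mul]
    have e1 : (1 - q + q * 1 : ℝ) = 1 := by ring
    rw [e1, one_pow, mul_zero, add_zero, inv_eq_one_div, div_mul_div_comm, one_mul, add_comm (1 : ℝ)]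
    gcongr
    linarith
  · exact (intervalIntegrable_iff_integrableOn_Ioc_of_le zero_le_one).1
      (Continuous.intervalIntegrable (by fun_prop) _ _)
  · filter_upwards [MeasureTheory.ae_restrict_mem measurableSet_Ioc] with x hx
    have := hx.1
    exact pow_nonneg (by nlinarith) _

theorem ex_lintegral {α : Type} [Countable α] (p : PMF α) (μ : MeasureTheory.Measure ℝ)
    {f : α → ℝ → ℝ≥0∞} (hf : ∀ a, Measurable (f a)) :
    (ex p fun a => ∫⁻ x, f a x ∂μ) = ∫⁻ x, ex p (fun a => f a x) ∂μ := by
  unfold ex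
  rw [MeasureTheory.lintegral_tsum fun a => ((hf a).const_mul _).aemeasurable]
  exact tsum_congr fun a => (MeasureTheory.lintegral_const_mul _ (hf a)).symm

section
variable {n s : ℕ} [NeZero n]

/-- Writing 1/(1 + k) as the integral of x^k over [0, 1] turns the mean of a reciprocal into the
integral of a generating function, which is known exactly for independent filtering. -/
theorem ex_indep_thin_inv_le (d : ℕ) (p : Fin n → Bool) (l : Fin n → List (Fin n)) :
    (ex (indep n fun u => thin d (l u)) fun l' =>
      ENNReal.ofReal (1 / (1 + (∑ u, (l' u).countP p : ℕ)))) ≤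
      ENNReal.ofReal (1 / (keepProb d * (1 + (∑ u, (l u).countP p : ℕ)))) := by
  simp only [← lintegral_pow]
  rw [ex_lintegral _ _ fun a => by fun_prop]
  refine le_trans (MeasureTheory.setLIntegral_mono' measurableSet_Ioc fun x hx => ?_)
    (lintegral_affine_pow_le (keepProb_pos d) (keepProb_le_one d) _)
  exact (ex_indep_thin_pow p hx.1.le l).le

/-- The inequality of arithmetic and geometric means for the roots √y, followed by √y ≤ (1 + y)/2.
-/
theorem prod_rpow_le_half_add {H : Finset (Fin n)} {d : ℕ} (hH : H.card = d) (hd : 1 ≤ d)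
    {y : Fin n → ℝ} (hy : ∀ h, 0 ≤ y h) :
    ∏ h ∈ H, y h ^ (1 / (2 * (d : ℝ))) ≤ 1 / 2 + ∑ h ∈ H, 1 / (2 * (d : ℝ)) * y h := by
  have hd0 : (0 : ℝ) < d := by exact_mod_cast hd
  calc _ = ∏ h ∈ H, (y h ^ (1 / 2 : ℝ)) ^ (1 / (d : ℝ)) :=
        Finset.prod_congr rfl fun h _ => rpow_half_inv (hy h)
    _ ≤ (∑ h ∈ H, y h ^ (1 / 2 : ℝ)) / d :=
        prod_rpow_le_average hH hd fun h => Real.rpow_nonneg (hy h) _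
    _ ≤ (∑ h ∈ H, (1 / 2 + 1 / 2 * y h)) / d := by
        gcongr with h _
        rw [← Real.sqrt_eq_rpow]
        have h1 := Real.sq_sqrt (hy h)
        nlinarith [sq_nonneg (Real.sqrt (y h) - 1)]
    _ = _ := by
        rw [Finset.sum_add_distrib, Finset.sum_const, hH, nsmul_eq_mul, ← Finset.mul_sum,
          ← Finset.mul_sum]
        field_simp

/-- The product of the multiplicities of the points of `H`, to the power `-1 / (2 d)`. -/
def scarcity (H : Finset (Fin n)) (d : ℕ) (m : Fin n → ℕ) : ℝ :=
  ∏ h ∈ H, (1 / (m h : ℝ)) ^ (1 / (2 * (d : ℝ)))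

theorem scarcity_nonneg (H : Finset (Fin n)) (d : ℕ) (m : Fin n → ℕ) : 0 ≤ scarcity H d m :=
  Finset.prod_nonneg fun _ _ => by positivity

theorem scarcity_le_one (H : Finset (Fin n)) (d : ℕ) (m : Fin n → ℕ) : scarcity H d m ≤ 1 := by
  refine Finset.prod_le_one (fun _ _ => by positivity) fun h _ => ?_
  refine Real.rpow_le_one (by positivity) ?_ (by positivity)
  rcases Nat.eq_zero_or_pos (m h) with h0 | h0
  · simp [h0]
  · rw [div_le_one (by exact_mod_cast h0)]; exact_mod_cast h0

theorem scarcity_anti (H : Finset (Fin n)) (d : ℕ) {m m' : Fin n → ℕ} (h0 : ∀ h, 1 ≤ m h)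
    (hm : ∀ h, m h ≤ m' h) : scarcity H d m' ≤ scarcity H d m := by
  refine Finset.prod_le_prod (fun _ _ => by positivity) fun h _ => ?_
  refine Real.rpow_le_rpow (by positivity) ?_ (by positivity)
  exact one_div_le_one_div_of_le (by exact_mod_cast h0 h) (by exact_mod_cast hm h)

/-- The d exponents 1/(2d) sum to 1/2, so multiplicities up to n² cost at most a factor n. -/
theorem le_scarcity {H : Finset (Fin n)} {d : ℕ} (hH : H.card = d) (hd : 1 ≤ d)
    {m : Fin n → ℕ} (h0 : ∀ h, 1 ≤ m h) (hm : ∀ h, m h ≤ n ^ 2) : 1 / (n : ℝ) ≤ scarcity H d m := by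
  refine le_trans ?_ (scarcity_anti H d (m' := fun _ => n ^ 2) h0 hm)
  have hd0 : (0 : ℝ) < d := by exact_mod_cast hd
  rw [scarcity, Finset.prod_const, hH, ← Real.rpow_natCast, ← Real.rpow_mul (by positivity)]
  have e : 1 / (2 * (d : ℝ)) * d = 1 / 2 := by field_simp
  rw [e, ← Real.sqrt_eq_rpow]
  push_cast
  refine Real.le_sqrt_of_sq_le (le_of_eq ?_)
  rw [div_pow, one_pow]

/-- The summand 1 is the initial copy, which is never filtered and prevents division by zero. On
average the reciprocal multiplicity grows by at most 1/q = 1 + 1/(2d). Half of this growth enters,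
which gives 1 + 1/(4d). -/
theorem ex_thin_scarcity_le {H : Finset (Fin n)} {d : ℕ} (hH : H.card = d) (hd : 1 ≤ d)
    (l : Fin n → List (Fin n)) :
    (ex (indep n fun u => thin d (l u)) fun l' => ENNReal.ofReal
      (scarcity H d fun h => 1 + ∑ u, (l' u).countP (· = h))) ≤
      ENNReal.ofReal ((1 + 1 / (4 * d)) * scarcity H d fun h => 1 + ∑ u, (l u).countP (· = h)) := by
  have hd0 : (0 : ℝ) < d := by exact_mod_cast hd
  set E : Fin n → ℕ := fun h => ∑ u, (l u).countP (· = h) with hE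
  set Z := scarcity H d fun h => 1 + E h with hZ
  have hZ0 : 0 ≤ Z := scarcity_nonneg _ _ _
  calc _ ≤ ex (indep n fun u => thin d (l u)) fun l' => ENNReal.ofReal Z *
        (ENNReal.ofReal (1 / 2) + ∑ h ∈ H, ENNReal.ofReal (1 / (2 * d) * (1 + E h)) *
          ENNReal.ofReal (1 / (1 + (∑ u, (l' u).countP (· = h) : ℕ)))) := by
        refine ex_mono _ fun l' => ?_
        have h1 : scarcity H d (fun h => 1 + ∑ u, (l' u).countP (· = h)) =
            Z * ∏ h ∈ H, ((1 + E h) / (1 + (∑ u, (l' u).countP (· = h) : ℕ)) : ℝ) ^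
              (1 / (2 * (d : ℝ))) := by
          rw [hZ, scarcity, scarcity, ← Finset.prod_mul_distrib]
          refine Finset.prod_congr rfl fun h _ => ?_
          rw [← Real.mul_rpow (by positivity) (by positivity)]
          congr 1
          push_cast
          field_simp
        rw [h1, ENNReal.ofReal_mul hZ0]
        refine mul_le_mul_right ?_ _
        have h2 := prod_rpow_le_half_add hH hd (y := fun h =>
          ((1 + E h) / (1 + (∑ u, (l' u).countP (· = h) : ℕ)) : ℝ)) fun h => by positivity
        refine (ENNReal.ofReal_le_ofReal h2).trans_eq ?_
        rw [ENNReal.ofReal_add (by norm_num) (Finset.sum_nonneg fun h _ => by positivity),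
          ENNReal.ofReal_sum_of_nonneg fun h _ => by positivity]
        congr 1
        refine Finset.sum_congr rfl fun h _ => ?_
        rw [← ENNReal.ofReal_mul (by positivity)]
        congr 1
        rw [mul_assoc, ← mul_div_assoc (1 + (E h : ℝ)), mul_one]
    _ ≤ ENNReal.ofReal Z * (ENNReal.ofReal (1 / 2) +
          ∑ h ∈ H, ENNReal.ofReal (1 / (2 * d) * (1 / keepProb d))) := by
        rw [ex_const_mul, ex_add, ex_const, ex_finset_sum]
        gcongr with h _
        rw [ex_const_mul]
        refine (mul_le_mul_right (ex_indep_thin_inv_le d (fun y => decide (y = h)) l) _).trans_eq ?_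
        rw [← ENNReal.ofReal_mul (by positivity)]
        congr 1
        have := keepProb_pos d
        have : (0 : ℝ) < 1 + E h := by positivity
        change 1 / (2 * (d : ℝ)) * (1 + E h) * (1 / (keepProb d * (1 + E h))) = _
        field_simp
    _ = _ := by
        have hq := keepProb_pos d
        rw [Finset.sum_const, hH, nsmul_eq_mul, ← ENNReal.ofReal_natCast,
          ← ENNReal.ofReal_mul (by positivity), ← ENNReal.ofReal_add (by norm_num) (by positivity),
          ← ENNReal.ofReal_mul hZ0]
        congr 1
        have : 1 / keepProb d = 1 + 1 / (2 * d) := by unfold keepProb; field_simp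
        rw [this, mul_comm Z]
        congr 1
        field_simp
        ring

/-- A convex function lies below its chord; 71/100 slightly exceeds the value 1/√2 at v = 1. -/
theorem rpow_neg_half_le {v : ℝ} (h0 : 0 ≤ v) (h1 : v ≤ 1) :
    (1 / (1 + v)) ^ (1 / 2 : ℝ) ≤ 71 / 100 + 29 / 100 * (1 - v) := by
  rw [← Real.sqrt_eq_rpow]
  refine Real.sqrt_le_iff.2 ⟨by linarith, ?_⟩
  rw [div_le_iff₀ (by linarith)]
  have : 0 ≤ v * (42 / 100 - 4959 / 10000 * v + 841 / 10000 * v ^ 2) := by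
    apply mul_nonneg h0
    nlinarith
  nlinarith

/-- The effect of a larger multiplicity of the points of `H`. -/
theorem scarcity_add_le {H : Finset (Fin n)} {d : ℕ} (hH : H.card = d) (hd : 1 ≤ d)
    {m N : Fin n → ℕ} (hm : ∀ h, 1 ≤ m h) (hN : ∀ h, N h ≤ m h) :
    scarcity H d (fun h => m h + N h) ≤ scarcity H d m *
      (71 / 100 + 29 / (100 * d) * ∑ h ∈ H, (1 - (N h : ℝ) / m h)) := by
  have hd0 : (0 : ℝ) < d := by exact_mod_cast hd
  have hm0 : ∀ h, (0 : ℝ) < m h := fun h => by exact_mod_cast hm h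
  have h1 : scarcity H d (fun h => m h + N h) =
      scarcity H d m * ∏ h ∈ H, ((1 / (1 + (N h : ℝ) / m h)) ^ (1 / 2 : ℝ)) ^ (1 / (d : ℝ)) := by
    rw [scarcity, scarcity, ← Finset.prod_mul_distrib]
    refine Finset.prod_congr rfl fun h _ => ?_
    have := hm0 h
    rw [← rpow_half_inv (by positivity), ← Real.mul_rpow (by positivity) (by positivity)]
    congr 1
    push_cast
    field_simp
  rw [h1]
  refine mul_le_mul_of_nonneg_left ?_ (scarcity_nonneg _ _ _)
  refine (prod_rpow_le_average hH hd fun h => by positivity).trans ?_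
  calc _ ≤ (∑ h ∈ H, (71 / 100 + 29 / 100 * (1 - (N h : ℝ) / m h))) / d := by
        gcongr with h _
        exact rpow_neg_half_le (by have := hm0 h; positivity)
          ((div_le_one (hm0 h)).2 (by exact_mod_cast hN h))
    _ = _ := by
        rw [Finset.sum_add_distrib, Finset.sum_const, hH, nsmul_eq_mul, ← Finset.mul_sum]
        field_simp

end

/-! ### Progress until a hitting set is found -/

section
variable {n s : ℕ} [NeZero n] {𝒮 : Fin s → Finset (Fin n)} {d : ℕ} {c : ℝ}
  {σ : Fin n → NodeState n} {x : Tracked n s}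

/-- The chosen set contains `h`. -/
def Contains (𝒮 : Fin s → Finset (Fin n)) (h : Fin n) (o : Option (Fin s)) : Prop :=
  ∃ j, o = some j ∧ h ∈ 𝒮 j

theorem countP_finRange_eq (h : Fin n) : (List.finRange n).countP (· = h) = 1 := by
  have := countP_finRange ({h} : Finset (Fin n))
  rw [Finset.card_singleton] at this
  rw [← this]
  congr 1; funext y; simp

theorem copyCount_eq_add (p : Fin n → Bool) (x : Tracked n s) :
    copyCount p x = ∑ u, (x.cfg.node u).orig.countP p + ∑ u, (x.cfg.node u).extra.countP p := by
  simp only [copyCount, NodeState.store, List.countP_append, Finset.sum_add_distrib]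

theorem Balanced.one_le_copyCount (h : Balanced 𝒮 d x) (y : Fin n) :
    1 ≤ copyCount (· = y) x := by
  rw [copyCount_eq_add, h.orig, countP_finRange_eq]
  exact Nat.le_add_right _ _

theorem countP_pushList {v : NodeState n} (hv : (v.store.length : ℝ) ≤ c * d * Real.log n)
    (o : Option (Fin s)) (h : Fin n) :
    ((pushList 𝒮 d c v o).countP (· = h) = v.store.countP (· = h) ∧ Contains 𝒮 h o) ∨
      ((pushList 𝒮 d c v o).countP (· = h) = 0 ∧ ¬ Contains 𝒮 h o) := by
  rcases o with - | j
  · right; simp [pushList, Contains]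
  · rw [pushList_of_le hv, List.countP_filter]
    by_cases hj : h ∈ 𝒮 j
    · left
      refine ⟨?_, j, rfl, hj⟩
      congr 1; funext y
      by_cases hy : y = h
      · simp [hy, hj]
      · simp [hy]
    · right
      refine ⟨?_, by rintro ⟨k, hk, hk'⟩; rw [← Option.some.inj hk] at hk'; exact hj hk'⟩
      rw [List.countP_eq_zero]
      intro y _
      simp only [Bool.and_eq_true, decide_eq_true_eq, not_and]
      rintro rfl; exact hj

theorem Balanced.length_le (h : Balanced 𝒮 d x) (hr : Regime n s d c) (u : Fin n) :
    ((x.cfg.node u).store.length : ℝ) ≤ c * d * Real.log n := by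
  have h1 := h.load u
  have h2 := hr.one_le_log
  have h3 := hr.le_c
  have h4 : (1 : ℝ) ≤ d := by exact_mod_cast hr.one_le_d
  have h5 : 1 ≤ c * d := by nlinarith
  nlinarith

/-- Every chosen set contains some point of `H`, so it omits at most d - 1 of them; d can be omitted
only if no set is chosen. -/
theorem sum_ex_not_contains_le {H : Finset (Fin n)} (hH : IsHittingSet 𝒮 H) (hd : H.card = d)
    (hd1 : 1 ≤ d) (P : PMF (Option (Finset (Fin n)) × Option (Fin s))) :
    ∑ h ∈ H, (ex P fun z => ind (¬ Contains 𝒮 h z.2)) ≤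
      ENNReal.ofReal (d - 1) + ex P fun z => ind (z.2 = none) := by
  classical
  rw [← ex_finset_sum, ← ex_const P (ENNReal.ofReal (d - 1)), ← ex_add]
  refine ex_mono _ fun z => ?_
  rw [sum_ind]
  have e : ENNReal.ofReal ((d : ℝ) - 1) = ((d - 1 : ℕ) : ℝ≥0∞) := by
    rw [← ENNReal.ofReal_natCast, Nat.cast_sub hd1, Nat.cast_one]
  rw [e]
  rcases h : z.2 with - | j
  · have h1 : (H.filter fun h => ¬ Contains 𝒮 h none).card ≤ d - 1 + 1 := by
      rw [Nat.sub_add_cancel hd1]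
      exact (Finset.card_filter_le _ _).trans hd.le
    rw [ind_pos rfl]
    exact_mod_cast h1
  · obtain ⟨y, hy⟩ := hH j
    rw [Finset.mem_inter] at hy
    have h2 : (H.filter fun h => ¬ Contains 𝒮 h (some j)) ⊆ H.erase y := by
      intro w hw
      rw [Finset.mem_filter] at hw
      refine Finset.mem_erase.2 ⟨?_, hw.1⟩
      rintro rfl
      exact hw.2 ⟨j, rfl, hy.1⟩
    have h3 := Finset.card_le_card h2
    rw [Finset.card_erase_of_mem hy.2, hd] at h3
    refine le_trans ?_ le_self_add
    exact_mod_cast h3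

/-- No set is chosen only if the sampling fails or a hitting set is reported, and each of these has
probability at most 1/20. -/
theorem ex_choice_fst_none_le_of_found (hr : Regime n s d c)
    (hocc : 1 / 8 ≤ pullMass σ fun _ => true)
    (h : (ex (choice 𝒮 d c σ) fun z => ind (z.1 ≠ none)) ≤ ENNReal.ofReal (1 / 20)) :
    (ex (choice 𝒮 d c σ) fun z => ind (z.2 = none)) ≤ ENNReal.ofReal (1 / 10) := by
  calc _ ≤ ex (choice 𝒮 d c σ) fun z => ind (z.1 = none ∧ z.2 = none) + ind (z.1 ≠ none) := by
        refine ex_mono _ fun z => ?_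
        by_cases h1 : z.1 = none
        · by_cases h2 : z.2 = none
          · rw [ind_pos (A := z.1 = none ∧ z.2 = none) ⟨h1, h2⟩]
            exact (ind_le_one _).trans le_self_add
          · rw [ind_neg h2]; exact zero_le
        · rw [ind_pos (A := z.1 ≠ none) h1]
          exact (ind_le_one _).trans le_add_self
    _ ≤ ENNReal.ofReal (1 / 20) + ENNReal.ofReal (1 / 20) := by
        rw [ex_add]
        exact add_le_add (ex_choice_none_le.trans (ex_sample_none_le_of_occupied hr.one_le_d
          hr.one_le_s hr.le_c hr.numPulls_le hocc)) h
    _ = _ := by rw [← ENNReal.ofReal_add (by norm_num) (by norm_num)]; norm_num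

/-- The number of copies of `h` that are pushed. -/
def pushedCount (𝒮 : Fin s → Finset (Fin n)) (d : ℕ) (c : ℝ) (σ : Fin n → NodeState n)
    (z : Fin n → Option (Finset (Fin n)) × Option (Fin s)) (h : Fin n) : ℕ :=
  ∑ v, (pushList 𝒮 d c (σ v) (z v).2).countP (· = h)

theorem pushedCount_le (hσ : ∀ u, (σ u).store = (x.cfg.node u).store)
    (z : Fin n → Option (Finset (Fin n)) × Option (Fin s)) (h : Fin n)
    (hl : ∀ u, ((x.cfg.node u).store.length : ℝ) ≤ c * d * Real.log n) :
    pushedCount 𝒮 d c σ z h ≤ copyCount (· = h) x := by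
  refine Finset.sum_le_sum fun v _ => ?_
  rcases countP_pushList (v := σ v) (𝒮 := 𝒮) (by rw [hσ]; exact hl v) (z v).2 h with h1 | h1
  · rw [h1.1, hσ]
  · rw [h1.1]; exact Nat.zero_le _

/-- The fraction of copies not pushed is linear in the choices of the individual nodes, so its mean
is just the probability that a single choice omits `h`. -/
theorem one_sub_pushedCount_div (hσ : ∀ u, (σ u).store = (x.cfg.node u).store)
    (z : Fin n → Option (Finset (Fin n)) × Option (Fin s)) (h : Fin n)
    (hl : ∀ u, ((x.cfg.node u).store.length : ℝ) ≤ c * d * Real.log n)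
    (hm : 1 ≤ copyCount (· = h) x) :
    ENNReal.ofReal (1 - (pushedCount 𝒮 d c σ z h : ℝ) / copyCount (· = h) x) =
      ∑ v, ENNReal.ofReal (((x.cfg.node v).store.countP (· = h) : ℝ) / copyCount (· = h) x) *
        ind (¬ Contains 𝒮 h (z v).2) := by
  classical
  have hm0 : (0 : ℝ) < copyCount (· = h) x := by exact_mod_cast hm
  have h1 : 1 - (pushedCount 𝒮 d c σ z h : ℝ) / copyCount (· = h) x =
      ∑ v, if Contains 𝒮 h (z v).2 then 0 else
        ((x.cfg.node v).store.countP (· = h) : ℝ) / copyCount (· = h) x := by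
    rw [eq_comm, ← div_self hm0.ne', ← sub_div, pushedCount]
    nth_rw 2 [copyCount]
    push_cast
    rw [← Finset.sum_sub_distrib, Finset.sum_div]
    refine Finset.sum_congr rfl fun v _ => ?_
    rcases countP_pushList (v := σ v) (𝒮 := 𝒮) (by rw [hσ]; exact hl v) (z v).2 h with h2 | h2
    · rw [h2.1, if_pos h2.2, hσ, sub_self, zero_div]
    · rw [h2.1, if_neg h2.2]; simp
  rw [h1, ENNReal.ofReal_sum_of_nonneg fun v _ => by split_ifs <;> positivity]
  refine Finset.sum_congr rfl fun v _ => ?_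
  split_ifs with h2
  · rw [ind_neg (not_not.2 h2)]; simp
  · rw [ind_pos h2, mul_one]

theorem Balanced.ex_scarcity_pushed_le (hb : Balanced 𝒮 d x) (hr : Regime n s d c)
    (hσ : ∀ u, (σ u).store = (x.cfg.node u).store) {H : Finset (Fin n)} (hH : IsHittingSet 𝒮 H)
    (hd : H.card = d) :
    (ex (indep n fun _ => choice 𝒮 d c σ) fun z => ind (∀ v, (z v).1 = none) *
      ENNReal.ofReal (scarcity H d fun h => copyCount (· = h) x + pushedCount 𝒮 d c σ z h)) ≤
      ENNReal.ofReal ((1 - 26 / (100 * d)) * scarcity H d fun h => copyCount (· = h) x) := by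
  have hd1 := hr.one_le_d
  have hd0 : (1 : ℝ) ≤ d := by exact_mod_cast hd1
  have hl := hb.length_le hr
  have hm := hb.one_le_copyCount
  have hZ0 := scarcity_nonneg H d fun h => copyCount (· = h) x
  set Z := scarcity H d fun h => copyCount (· = h) x with hZ
  have hρ : 0 ≤ 1 - 26 / (100 * (d : ℝ)) := by
    rw [sub_nonneg, div_le_one (by positivity)]; linarith
  -- If a node seldom reports a hitting set, pushing lowers the scarcity. Otherwise one of the n
  -- independent nodes reports a hitting set almost surely, and the indicator alone gives the factor
  -- (19/20)^n.
  rcases le_or_gt (ex (choice 𝒮 d c σ) fun z => ind (z.1 ≠ none)) (ENNReal.ofReal (1 / 20))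
    with hA | hB
  · calc _ ≤ ex (indep n fun _ => choice 𝒮 d c σ) fun z => ENNReal.ofReal Z *
          (ENNReal.ofReal (71 / 100) + ENNReal.ofReal (29 / (100 * d)) * ∑ h ∈ H, ∑ v,
            ENNReal.ofReal (((x.cfg.node v).store.countP (· = h) : ℝ) / copyCount (· = h) x) *
              ind (¬ Contains 𝒮 h (z v).2)) := by
          refine ex_mono _ fun z => ?_
          refine (mul_le_of_le_one_left' (ind_le_one _)).trans ?_
          refine (ENNReal.ofReal_le_ofReal (scarcity_add_le hd hd1 hm
            fun h => pushedCount_le hσ z h hl)).trans_eq ?_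
          have h0 : ∀ h, 0 ≤ 1 - (pushedCount 𝒮 d c σ z h : ℝ) / copyCount (· = h) x := by
            intro h
            rw [sub_nonneg]
            refine div_le_one_of_le₀ ?_ (Nat.cast_nonneg _)
            exact_mod_cast pushedCount_le hσ z h hl
          rw [ENNReal.ofReal_mul hZ0, ENNReal.ofReal_add (by norm_num)
            (mul_nonneg (by positivity) (Finset.sum_nonneg fun h _ => h0 h)),
            ENNReal.ofReal_mul (by positivity), ENNReal.ofReal_sum_of_nonneg fun h _ => h0 h]
          congr 3
          exact Finset.sum_congr rfl fun h _ => one_sub_pushedCount_div hσ z h hl (hm h)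
      _ = ENNReal.ofReal Z * (ENNReal.ofReal (71 / 100) + ENNReal.ofReal (29 / (100 * d)) *
            ∑ h ∈ H, (ex (choice 𝒮 d c σ) fun z => ind (¬ Contains 𝒮 h z.2))) := by
          rw [ex_const_mul, ex_add, ex_const, ex_const_mul, ex_finset_sum]
          congr 3
          refine Finset.sum_congr rfl fun h _ => ?_
          rw [ex_finset_sum]
          have h1 : ∀ v, (ex (indep n fun _ => choice 𝒮 d c σ) fun z => ENNReal.ofReal
              (((x.cfg.node v).store.countP (· = h) : ℝ) / copyCount (· = h) x) *
                ind (¬ Contains 𝒮 h (z v).2)) =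
              ENNReal.ofReal (((x.cfg.node v).store.countP (· = h) : ℝ) / copyCount (· = h) x) *
                ex (choice 𝒮 d c σ) fun z => ind (¬ Contains 𝒮 h z.2) := by
            intro v
            rw [ex_const_mul]
            congr 1
            exact ex_indep_coord n (fun _ => choice 𝒮 d c σ) v
              fun z => ind (¬ Contains 𝒮 h z.2)
          simp only [h1]
          have hm0 : (0 : ℝ) < copyCount (· = h) x := by exact_mod_cast hm h
          rw [← Finset.sum_mul, ← ENNReal.ofReal_sum_of_nonneg fun v _ => by positivity,
            ← Finset.sum_div]
          have : (∑ v, ((x.cfg.node v).store.countP (· = h) : ℝ)) = copyCount (· = h) x := by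
            rw [copyCount]; push_cast; rfl
          rw [this, div_self hm0.ne', ENNReal.ofReal_one, one_mul]
      _ ≤ ENNReal.ofReal Z * (ENNReal.ofReal (71 / 100) + ENNReal.ofReal (29 / (100 * d)) *
            (ENNReal.ofReal (d - 1) + ENNReal.ofReal (1 / 10))) := by
          gcongr
          refine (sum_ex_not_contains_le hH hd hd1 _).trans ?_
          gcongr
          exact ex_choice_fst_none_le_of_found hr
            (by rw [pullMass_congr hσ]; exact hb.occupied) hA
      _ ≤ _ := by
          rw [← ENNReal.ofReal_add (by linarith) (by norm_num),
            ← ENNReal.ofReal_mul (by positivity),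
            ← ENNReal.ofReal_add (by norm_num) (mul_nonneg (by positivity) (by linarith)),
            ← ENNReal.ofReal_mul hZ0]
          refine ENNReal.ofReal_le_ofReal ?_
          rw [mul_comm]
          refine mul_le_mul_of_nonneg_right ?_ hZ0
          -- Of the d points at most d - 9/10 are omitted on average, and 0.29 · 0.9 = 0.261 exceeds
          -- the claimed 0.26.
          have : 29 / (100 * (d : ℝ)) * (d - 1 + 1 / 10) = 29 / 100 - 261 / 1000 / d := by
            field_simp; ring
          have h2 : 26 / (100 * (d : ℝ)) = 26 / 100 / d := by rw [div_div]
          have h3 : 26 / 100 / (d : ℝ) ≤ 261 / 1000 / d :=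
            div_le_div_of_nonneg_right (by norm_num) (by linarith)
          rw [this, h2]; linarith
  · calc _ ≤ ex (indep n fun _ => choice 𝒮 d c σ) fun z =>
          (∏ v, ind ((z v).1 = none)) * ENNReal.ofReal Z := by
          refine ex_mono _ fun z => ?_
          refine mul_le_mul' ?_ (ENNReal.ofReal_le_ofReal ?_)
          · by_cases h : ∀ v, (z v).1 = none
            · rw [ind_pos h, Finset.prod_eq_one fun v _ => ind_pos (h v)]
            · rw [ind_neg h]; exact zero_le
          · exact scarcity_anti H d hm fun h => Nat.le_add_right _ _
      _ = (∏ _v : Fin n, ex (choice 𝒮 d c σ) fun z => ind (z.1 = none)) * ENNReal.ofReal Z := by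
          rw [ex_mul_const]
          congr 1
          exact ex_indep_prod n (fun _ => choice 𝒮 d c σ) fun _ z => ind (z.1 = none)
      _ ≤ ENNReal.ofReal (19 / 20) ^ n * ENNReal.ofReal Z := by
          gcongr
          rw [Finset.prod_const, Finset.card_univ, Fintype.card_fin]
          gcongr
          have h1 := ex_ind_compl (choice 𝒮 d c σ) fun z => z.1 = none
          by_contra h2
          have h3 : ENNReal.ofReal (19 / 20) + ENNReal.ofReal (1 / 20) < 1 := by
            rw [← h1]; exact ENNReal.add_lt_add (not_le.1 h2) hB
          rw [← ENNReal.ofReal_add (by norm_num) (by norm_num)] at h3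
          norm_num at h3
      _ ≤ _ := by
          rw [← ENNReal.ofReal_pow (by norm_num), ← ENNReal.ofReal_mul (by positivity)]
          refine ENNReal.ofReal_le_ofReal (mul_le_mul_of_nonneg_right ?_ hZ0)
          have hn : 100 ≤ n := by
            have := hr.hundred_mul_le
            have h2 : (100 : ℝ) ≤ n := by linarith
            exact_mod_cast h2
          have h1 : (19 / 20 : ℝ) ^ n ≤ (19 / 20) ^ 100 :=
            pow_le_pow_of_le_one (by norm_num) (by norm_num) hn
          have h2 : 26 / (100 * (d : ℝ)) ≤ 26 / 100 := by
            apply div_le_div_of_nonneg_left <;> linarith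
          have h3 : (19 / 20 : ℝ) ^ 100 ≤ 1 / 100 := by norm_num
          linarith

/-- The potential that bounds the time until a hitting set is found. -/
def scarcityPot (H : Finset (Fin n)) (d : ℕ) (x : Tracked n s) : ℝ≥0∞ :=
  open Classical in
  if Running x ∧ x.found = none then
    ENNReal.ofReal (scarcity H d fun h => copyCount (· = h) x)
  else 0

/-- Pushing gives the factor 1 - 0.26/d and filtering at most 1 + 0.25/d; the product is below 1 -
0.01/d. If a hitting set is reported, the potential drops to 0. -/
theorem Balanced.ex_scarcityPot_le (hb : Balanced 𝒮 d x) (hr : Regime n s d c)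
    {H : Finset (Fin n)} (hH : IsHittingSet 𝒮 H) (hd : H.card = d) (i : ℕ) :
    ex (trackedStep 𝒮 d c i x) (scarcityPot H d) ≤
      ENNReal.ofReal (1 - 1 / (100 * d)) * scarcityPot H d x := by
  have hd1 := hr.one_le_d
  have hd0 : (1 : ℝ) ≤ d := by exact_mod_cast hd1
  by_cases hout : ∀ v, (check 𝒮 c i (x.cfg.node v)).out = none
  swap
  · rw [ex_trackedStep_eq_zero hout fun x hx => by
      rw [scarcityPot, if_neg fun h => hx h.1]]
    exact zero_le
  have hrun := running_of_check hout
  set σ : Fin n → NodeState n := fun v => check 𝒮 c i (x.cfg.node v) with hσdef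
  have hσ : ∀ u, (σ u).store = (x.cfg.node u).store := fun u => check_store _ _ _ _
  rw [ex_trackedStep 𝒮 d c i x hσdef hout, ex_search]
  by_cases hf : x.found = none
  swap
  · have hz : ∀ a σ', scarcityPot H d (advance 𝒮 d i x a σ') = 0 := by
      intro a σ'
      rw [scarcityPot, if_neg]
      rintro ⟨-, h2⟩
      obtain ⟨t, ht⟩ := Option.ne_none_iff_exists'.1 hf
      simp [advance, ht] at h2
    simp only [hz, ex_zero]
    exact zero_le
  rw [scarcityPot, if_pos ⟨hrun, hf⟩]
  have hZ0 := scarcity_nonneg H d fun h => copyCount (· = h) x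
  set Z := scarcity H d fun h => copyCount (· = h) x with hZ
  calc _ ≤ ex (indep n fun _ => choice 𝒮 d c σ) fun z =>
        ENNReal.ofReal (1 + 1 / (4 * d)) * (ind (∀ v, (z v).1 = none) *
          ENNReal.ofReal (scarcity H d fun h =>
            copyCount (· = h) x + pushedCount 𝒮 d c σ z h)) := by
        refine ex_mono _ fun z => ?_
        refine ex_le_of_forall _ fun P hP => ?_
        refine ex_le_of_forall _ fun Q _ => ?_
        by_cases hz : ∀ v, (z v).1 = none
        · rw [ind_pos hz, one_mul]
          have hpush : ∀ h, ∑ v, (delivered P v).countP (· = h) = pushedCount 𝒮 d c σ z h := by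
            intro h
            simp only [delivered_eq_received]
            rw [sum_countP_received, List.map_flatten, List.countP_flatten, List.map_ofFn,
              List.map_ofFn, List.sum_ofFn, pushedCount]
            refine Finset.sum_congr rfl fun v _ => ?_
            simp only [Function.comp]
            rw [map_snd_of_mem_support_scatter (mem_support_of_indep hP v)]
          have hm : ∀ h, 1 + ∑ u, ((σ u).extra ++ delivered P u).countP (· = h) =
              copyCount (· = h) x + pushedCount 𝒮 d c σ z h := by
            intro h
            simp only [List.countP_append, Finset.sum_add_distrib]
            rw [hpush, copyCount_eq_add, hb.orig, countP_finRange_eq, ← add_assoc]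
            simp only [hσdef, check_extra]
          have ht := ex_thin_scarcity_le hd hd1 fun u => (σ u).extra ++ delivered P u
          rw [ENNReal.ofReal_mul (by positivity)] at ht
          simp only [hm] at ht
          refine le_trans (ex_mono _ fun l => ?_) ht
          rw [scarcityPot]
          split_ifs
          · refine ENNReal.ofReal_le_ofReal (le_of_eq ?_)
            congr 1; funext h
            rw [copyCount_eq_add]
            simp only [advance, nextNode]
            congr 1
            simp only [hσdef, check_orig]
            rw [hb.orig, countP_finRange_eq]
          · exact zero_le
        · refine (ex_le_of_forall _ fun l _ => ?_).trans (zero_le)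
          rw [scarcityPot, if_neg]
          rintro ⟨-, h2⟩
          push Not at hz
          obtain ⟨v, hv⟩ := hz
          obtain ⟨R, hR⟩ := Option.ne_none_iff_exists'.1 hv
          simp only [advance, hf] at h2
          rw [if_pos ⟨v, by simp [actionOf, addEntry, hR]⟩] at h2
          exact absurd h2 (by simp)
    _ ≤ ENNReal.ofReal (1 + 1 / (4 * d)) * ENNReal.ofReal ((1 - 26 / (100 * d)) * Z) := by
        rw [ex_const_mul]
        exact mul_le_mul_right (hb.ex_scarcity_pushed_le hr hσ hH hd) _
    _ ≤ _ := by
        have h1 : 0 ≤ 1 - 1 / (100 * (d : ℝ)) := by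
          rw [sub_nonneg, div_le_one (by positivity)]; linarith
        rw [← ENNReal.ofReal_mul (by positivity), ← ENNReal.ofReal_mul h1, ← mul_assoc]
        refine ENNReal.ofReal_le_ofReal (mul_le_mul_of_nonneg_right ?_ hZ0)
        have e : (1 + 1 / (4 * (d : ℝ))) * (1 - 26 / (100 * d)) =
            1 - 1 / (100 * d) - 26 / (400 * (d : ℝ) ^ 2) := by field_simp; ring
        rw [e]
        have : 0 ≤ 26 / (400 * (d : ℝ) ^ 2) := by positivity
        linarith

/-- A hitting set is found soon. -/
theorem killed_found_le (G : ℕ → Tracked n s → Prop) (hr : Regime n s d c)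
    {H : Finset (Fin n)} (hH : IsHittingSet 𝒮 H) (hd : H.card = d)
    (hG : ∀ t x, G t x → Running x → Balanced 𝒮 d x) (t : ℕ) :
    (killed (trackedInit n s) (trackedStep 𝒮 d c) G t fun x =>
      ind (Running x ∧ Balanced 𝒮 d x ∧ x.found = none)) ≤
      ENNReal.ofReal (n * Real.exp (-(t / (100 * d)))) := by
  have hd1 := hr.one_le_d
  have hd0 : (1 : ℝ) ≤ d := by exact_mod_cast hd1
  have hn0 : (0 : ℝ) < n := by exact_mod_cast Nat.pos_of_ne_zero (NeZero.ne n)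
  have hstep : ∀ t x, G t x → ∀ m, t + m < t + m + 1 →
      (ex (trackedStep 𝒮 d c t x) fun x =>
        ENNReal.ofReal (1 - 1 / (100 * d)) ^ m * scarcityPot H d x) ≤
        ENNReal.ofReal (1 - 1 / (100 * d)) ^ (m + 1) * scarcityPot H d x := by
    intro t x hx m _
    rw [ex_const_mul, pow_succ, mul_assoc]
    refine mul_le_mul_right ?_ _
    by_cases hrun : Running x
    · exact (hG t x hx hrun).ex_scarcityPot_le hr hH hd t
    · rw [ex_trackedStep_eq_zero (fun h => hrun (running_of_check h)) fun x hx => by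
        rw [scarcityPot, if_neg fun h => hx h.1]]
      exact zero_le
  have hle : killed (trackedInit n s) (trackedStep 𝒮 d c) G t (scarcityPot H d) ≤
      ENNReal.ofReal (1 - 1 / (100 * d)) ^ t := by
    have h := killed_le_of_remaining (p := trackedInit n s) (step := trackedStep 𝒮 d c) (G := G)
      (f := fun m x => ENNReal.ofReal (1 - 1 / (100 * d)) ^ m * scarcityPot H d x) (T := t)
      (fun t' x hx m hm => hstep t' x hx m (Nat.lt_succ_self _)) (le_refl (t + 0))
    simp only [pow_zero, one_mul, zero_add] at h
    refine h.trans (ex_le_of_forall _ fun x _ => mul_le_of_le_one_right' ?_)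
    rw [scarcityPot]
    split_ifs
    · rw [← ENNReal.ofReal_one]; exact ENNReal.ofReal_le_ofReal (scarcity_le_one _ _ _)
    · exact zero_le
  have h1 : 0 ≤ 1 - 1 / (100 * (d : ℝ)) := by
    rw [sub_nonneg, div_le_one (by positivity)]; linarith
  -- Loads of at most log n ≤ n bound every multiplicity by n², so the scarcity is at least 1/n.
  refine killed_markov (y := ENNReal.ofReal n) _ _ _ _ (f := scarcityPot H d) (fun x hx => ?_) ?_
  · obtain ⟨hrun, hb, hf⟩ := hx
    rw [scarcityPot, if_pos ⟨hrun, hf⟩, ← ENNReal.ofReal_mul hn0.le, ENNReal.one_le_ofReal]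
    have := le_scarcity (n := n) hd hd1 hb.one_le_copyCount fun h => ?_
    · calc (1 : ℝ) = n * (1 / n) := by field_simp
        _ ≤ _ := by gcongr
    · calc copyCount (· = h) x ≤ ∑ _u : Fin n, n := by
            refine Finset.sum_le_sum fun u _ => List.countP_le_length.trans ?_
            have h2 := hb.load u
            have h3 := Real.log_le_sub_one_of_pos hn0
            have h4 : ((x.cfg.node u).store.length : ℝ) ≤ n := by linarith
            exact_mod_cast h4
        _ = n ^ 2 := by simp [sq]
  · refine (mul_le_mul_right hle _).trans ?_
    rw [← ENNReal.ofReal_pow h1, ← ENNReal.ofReal_mul hn0.le]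
    refine ENNReal.ofReal_le_ofReal (mul_le_mul_of_nonneg_left ?_ hn0.le)
    refine (one_sub_pow_le_exp ?_ t).trans_eq ?_
    · linarith
    · congr 1; ring

end

section
variable {n s : ℕ} {𝒮 : Fin s → Finset (Fin n)} {d : ℕ} {c : ℝ}

/-! ### The entries of the termination protocol -/

theorem hitCount_le (U : Finset (Fin n)) : hitCount 𝒮 U ≤ s :=
  (Finset.card_le_univ _).trans_eq (Fintype.card_fin s)

theorem hitCount_eq {B : Finset (Fin n)} (hB : IsHittingSet 𝒮 B) : hitCount 𝒮 B = s := by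
  rw [hitCount, Finset.filter_true_of_mem fun j _ => hB j, Finset.card_univ, Fintype.card_fin]

/-- The merged entries of a node have all properties that the individual ones have. -/
theorem foldl_receive_valid {V : ℕ → Finset (Fin n) → Prop}
    {e : ℕ → Option (Finset (Fin n) × Bool)} {l : List (Entry n)}
    (he : ∀ t B b, e t = some (B, b) → V t B ∧ b = true)
    (hl : ∀ m ∈ l, V m.1 m.2.1 ∧ m.2.2 = true) {t : ℕ} {B : Finset (Fin n)} {b : Bool}
    (h : l.foldl (receive 𝒮) e t = some (B, b)) : V t B ∧ b = true := by
  induction l generalizing e with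
  | nil => exact he t B b h
  | cons m l ih =>
    rw [List.foldl_cons] at h
    refine ih (fun t B b ht => ?_) (fun m' hm' => hl m' (List.mem_cons_of_mem _ hm')) h
    obtain ⟨t', B', b'⟩ := m
    have hm := hl _ List.mem_cons_self
    dsimp only at hm
    unfold receive at ht
    dsimp only at ht
    by_cases htt : t = t'
    · subst htt
      rw [Function.update_self] at ht
      rcases h0 : e t with - | ⟨B₀, b₀⟩
      · rw [h0] at ht
        simp only [Option.some.injEq, Prod.mk.injEq] at ht
        rw [← ht.1, ← ht.2]; exact hm
      · rw [h0] at ht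
        have h1 := he t B₀ b₀ h0
        dsimp only at ht
        split_ifs at ht <;> simp only [Option.some.injEq, Prod.mk.injEq] at ht
        · rw [← ht.1, ← ht.2]; exact h1
        · rw [← ht.1, ← ht.2]; exact hm
        · rw [← ht.1, ← ht.2, h1.2, hm.2]; exact ⟨h1.1, rfl⟩
    · rw [Function.update_of_ne htt] at ht
      exact he t B b ht

theorem isSome_foldl_receive (e : ℕ → Option (Finset (Fin n) × Bool)) (l : List (Entry n))
    (t : ℕ) : (l.foldl (receive 𝒮) e t).isSome ↔ (e t).isSome ∨ ∃ m ∈ l, m.1 = t := by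
  induction l generalizing e with
  | nil => simp
  | cons m l ih =>
    rw [List.foldl_cons, ih]
    obtain ⟨t', B', b'⟩ := m
    have : (receive 𝒮 e (t', B', b') t).isSome ↔ (e t).isSome ∨ t' = t := by
      unfold receive
      dsimp only
      by_cases htt : t = t'
      · subst htt
        rw [Function.update_self]
        rcases h0 : e t with - | ⟨B₀, b₀⟩
        · simp
        · dsimp only; split_ifs <;> simp
      · rw [Function.update_of_ne htt]
        simp [Ne.symm htt]
    rw [this]
    simp [or_assoc]

/-- A node has an entry for iteration `t`, or has just received one. -/
def Informed (t : ℕ) (v : NodeState n) : Prop := (v.entries t).isSome ∨ ∃ m ∈ v.inbox, m.1 = t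

theorem isSome_checked (v : NodeState n) (t : ℕ) : (checked 𝒮 v t).isSome ↔ Informed t v := by
  rw [checked, Option.isSome_map, isSome_foldl_receive, Informed]

/-- All entries of a node are hitting sets. -/
structure ValidNode (𝒮 : Fin s → Finset (Fin n)) (V : ℕ → Finset (Fin n) → Prop)
    (v : NodeState n) : Prop where
  entry : ∀ t B b, v.entries t = some (B, b) → (V t B ∧ IsHittingSet 𝒮 B) ∧ b = true
  inbox : ∀ m ∈ v.inbox, (V m.1 m.2.1 ∧ IsHittingSet 𝒮 m.2.1) ∧ m.2.2 = true

/-- A hitting set already has the maximal hit count s, so no stored points can clear its bit. -/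
theorem ValidNode.checked {V : ℕ → Finset (Fin n) → Prop} {v : NodeState n}
    (h : ValidNode 𝒮 V v) {t : ℕ} {B : Finset (Fin n)} {b : Bool}
    (hB : checked 𝒮 v t = some (B, b)) : (V t B ∧ IsHittingSet 𝒮 B) ∧ b = true := by
  rw [Gossip.checked, Option.map_eq_some_iff] at hB
  obtain ⟨⟨B', b'⟩, h1, h2⟩ := hB
  have h3 := foldl_receive_valid (V := fun t B => V t B ∧ IsHittingSet 𝒮 B) h.entry h.inbox h1
  simp only [Prod.mk.injEq] at h2
  rw [if_neg (by rw [hitCount_eq h3.1.2]; exact not_lt.2 (hitCount_le _))] at h2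
  rw [← h2.1, ← h2.2]
  exact h3

theorem Mature.mono {i t t' : ℕ} (h : Mature c n i t) (ht : t' ≤ t) : Mature c n i t' := by
  unfold Mature at *
  have : (t' : ℝ) ≤ t := by exact_mod_cast ht
  linarith

theorem check_out_of_not_mature {v : NodeState n} (hv : v.out = none) {i : ℕ}
    (h : ∀ t, Mature c n i t → ¬ Informed t v) : (check 𝒮 c i v).out = none := by
  classical
  rw [check, if_neg (by simp [hv])]
  rw [List.findSome?_eq_none_iff]
  intro t _
  split_ifs with hm
  · have := h t hm
    rw [← isSome_checked (𝒮 := 𝒮), Option.not_isSome_iff_eq_none] at this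
    rw [this]; rfl
  · rfl

theorem exists_check_out {V : ℕ → Finset (Fin n) → Prop} {v : NodeState n}
    (h : ValidNode 𝒮 V v) (hv : v.out = none) {i t₀ : ℕ} (hm : Mature c n i t₀) (ht₀ : t₀ ≤ i)
    (hi : Informed t₀ v) :
    ∃ t B, (check 𝒮 c i v).out = some B ∧ V t B ∧ IsHittingSet 𝒮 B := by
  classical
  rw [check, if_neg (by simp [hv])]
  dsimp only
  rw [← isSome_checked (𝒮 := 𝒮), Option.isSome_iff_exists] at hi
  obtain ⟨⟨B₀, b₀⟩, h0⟩ := hi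
  have hne : (List.range (i + 1)).findSome? (fun t =>
      if Mature c n i t then
        (Gossip.checked 𝒮 v t).bind fun Bx => if Bx.2 then some Bx.1 else none
      else none) ≠ none := by
    intro h1
    rw [List.findSome?_eq_none_iff] at h1
    have h2 := h1 t₀ (List.mem_range.2 (by omega))
    rw [if_pos hm, h0] at h2
    simp [(h.checked h0).2] at h2
  obtain ⟨B, hB⟩ := Option.ne_none_iff_exists'.1 hne
  obtain ⟨t, -, ht⟩ := List.exists_of_findSome?_eq_some hB
  refine ⟨t, B, hB, ?_⟩
  split_ifs at ht with hm'
  rw [Option.bind_eq_some_iff] at ht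
  obtain ⟨⟨B', b'⟩, h3, h4⟩ := ht
  have h5 := h.checked h3
  rw [h5.2] at h4
  simp only [if_true, Option.some.injEq] at h4
  rw [← h4]
  exact h5.1

theorem check_entries (hv : (v : NodeState n).out = none) (i t : ℕ) (h : ¬ Mature c n i t) :
    (check 𝒮 c i v).entries t = checked 𝒮 v t := by
  rw [check, if_neg (by simp [hv])]
  exact if_neg h

theorem check_entries_of_mature (hv : (v : NodeState n).out = none) (i t : ℕ)
    (h : Mature c n i t) : (check 𝒮 c i v).entries t = none := by
  rw [check, if_neg (by simp [hv])]
  exact if_pos h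

theorem mem_entryList {i : ℕ} {e : ℕ → Option (Finset (Fin n) × Bool)} {m : Entry n} :
    m ∈ entryList i e ↔ m.1 ≤ i ∧ e m.1 = some m.2 := by
  simp only [entryList, List.mem_filterMap, List.mem_range, Option.map_eq_some_iff]
  constructor
  · rintro ⟨t, ht, Bx, h, rfl⟩; exact ⟨by dsimp only; omega, h⟩
  · rintro ⟨h1, h2⟩; exact ⟨m.1, by omega, m.2, h2, rfl⟩

/-- There is at most one entry per iteration, and only the last c log n + 1 iterations are not
mature. -/
theorem length_entryList_le (i : ℕ) (e : ℕ → Option (Finset (Fin n) × Bool)) (hc : 0 ≤ c)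
    (he : ∀ t, Mature c n i t → e t = none) :
    ((entryList i e).length : ℝ) ≤ c * Real.log n + 1 := by
  classical
  have hlog : 0 ≤ c * Real.log n := mul_nonneg hc (Real.log_natCast_nonneg n)
  have h1 : (entryList i e).length ≤
      ((Finset.range (i + 1)).filter fun t => i - ⌊c * Real.log n⌋₊ ≤ t).card := by
    rw [entryList, List.length_filterMap_eq_countP, List.countP_eq_length_filter,
      ← List.toFinset_card_of_nodup (List.nodup_range.filter _)]
    refine Finset.card_le_card fun t ht => ?_
    rw [List.mem_toFinset, List.mem_filter, List.mem_range] at ht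
    rw [Finset.mem_filter, Finset.mem_range]
    refine ⟨ht.1, ?_⟩
    by_contra hlt
    have hm : Mature c n i t := by
      unfold Mature
      have h3 := Nat.lt_floor_add_one (c * Real.log n)
      have h2 : t + ⌊c * Real.log n⌋₊ + 1 ≤ i := by omega
      have h4 : (t : ℝ) + ⌊c * Real.log n⌋₊ + 1 ≤ i := by exact_mod_cast h2
      linarith
    simp [he t hm] at ht
  have h2 : ((Finset.range (i + 1)).filter fun t => i - ⌊c * Real.log n⌋₊ ≤ t).card ≤
      ⌊c * Real.log n⌋₊ + 1 := by
    have : ((Finset.range (i + 1)).filter fun t => i - ⌊c * Real.log n⌋₊ ≤ t) ⊆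
        Finset.Icc (i - ⌊c * Real.log n⌋₊) i := by
      intro t ht
      rw [Finset.mem_filter, Finset.mem_range] at ht
      rw [Finset.mem_Icc]; omega
    refine (Finset.card_le_card this).trans ?_
    rw [Nat.card_Icc]; omega
  have h3 := Nat.floor_le hlog
  have h4 : ((entryList i e).length : ℝ) ≤ ⌊c * Real.log n⌋₊ + 1 := by exact_mod_cast h1.trans h2
  linarith

theorem mem_delivered {β : Type} {Q : Fin n → List (Fin n × β)} {v : Fin n} {m : β}
    (h : m ∈ delivered Q v) : ∃ u, m ∈ (Q u).map Prod.snd := by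
  simp only [delivered, List.mem_flatMap, List.mem_map, List.mem_filter] at h
  obtain ⟨u, -, z, ⟨hz, -⟩, rfl⟩ := h
  exact ⟨u, List.mem_map_of_mem hz⟩

variable [NeZero n]

/-- Read off from `ex_trackedStep`, applied to the indicator of `x'`: if no outcomes of the choices
led to `x'`, its probability would be 0. -/
theorem exists_of_mem_support_trackedStep {i : ℕ} {x x' : Tracked n s} {σ : Fin n → NodeState n}
    (hσ : σ = fun v => check 𝒮 c i (x.cfg.node v)) (hout : ∀ v, (σ v).out = none)
    (hx : x' ∈ (trackedStep 𝒮 d c i x).support) :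
    ∃ (z : Fin n → Option (Finset (Fin n)) × Option (Fin s)) (P : Fin n → List (Fin n × Fin n))
      (Q : Fin n → List (Fin n × Entry n)) (l : Fin n → List (Fin n)), (∀ v, z v ∈ (choice 𝒮 d c σ).support) ∧
      (∀ v, (P v).map Prod.snd = pushList 𝒮 d c (σ v) (z v).2) ∧
      (∀ v, (Q v).map Prod.snd = entryList i (addEntry i (σ v).entries (z v).1)) ∧
      x' = advance 𝒮 d i x
        (fun v => actionOf d c s i (σ v) ((z v).1, pushList 𝒮 d c (σ v) (z v).2) (P v) (Q v))
        (nextNode i σ (fun v => ((z v).1, pushList 𝒮 d c (σ v) (z v).2)) Q l) := by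
  by_contra hne
  have h0 : (ex (trackedStep 𝒮 d c i x) fun y => ind (y = x')) = 0 := by
    rw [ex_trackedStep 𝒮 d c i x hσ hout, ex_search, ← le_zero_iff]
    refine ex_le_of_forall _ fun z hz => ex_le_of_forall _ fun P hP => ex_le_of_forall _
      fun Q hQ => ex_le_of_forall _ fun l _ => (ind_neg fun h => hne ?_).le
    exact ⟨z, P, Q, l, mem_support_of_indep hz,
      fun v => map_snd_of_mem_support_scatter (mem_support_of_indep hP v),
      fun v => map_snd_of_mem_support_scatter (mem_support_of_indep hQ v), h.symm⟩
  refine hx ?_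
  rw [← PMF.toOuterMeasure_apply_singleton, toOuterMeasure_eq_ex]
  exact h0

/-! ### Invariants -/

/-- Properties of the network that hold in each iteration before the nodes halt. -/
structure Consistent (𝒮 : Fin s → Finset (Fin n)) (d : ℕ) (w : ℝ) (i : ℕ) (x : Tracked n s) :
    Prop where
  running : Running x
  orig : ∀ p, ∑ u, (x.cfg.node u).orig.countP p = (List.finRange n).countP p
  mass_nonneg : 0 ≤ x.mass
  setMass_nonneg : ∀ j, 0 ≤ x.setMass j
  peak_le : (x.cfg.peak : ℝ) ≤ w
  valid : ∀ v, ValidNode 𝒮 (fun t B => B.card ≤ sampleSize d s ∧ ∃ t₀ ≤ t, x.found = some t₀)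
    (x.cfg.node v)
  found_lt : ∀ t, x.found = some t → t < i
  known : ∀ t, x.found = some t → ∃ v, Informed t (x.cfg.node v)

/-- All nodes have halted with a small hitting set. -/
structure Finished (𝒮 : Fin s → Finset (Fin n)) (d : ℕ) (w : ℝ) (x : Tracked n s) : Prop where
  out : ∀ v, ∃ B, (x.cfg.node v).out = some B ∧ IsHittingSet 𝒮 B ∧ B.card ≤ sampleSize d s
  peak_le : (x.cfg.peak : ℝ) ≤ w

theorem check_of_isSome {v : NodeState n} (h : v.out.isSome) (i : ℕ) : check 𝒮 c i v = v := by
  rw [check, if_pos h]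

theorem Finished.step {w : ℝ} {i : ℕ} {x x' : Tracked n s} (h : Finished 𝒮 d w x)
    (hx : x' ∈ (trackedStep 𝒮 d c i x).support) : Finished 𝒮 d w x' := by
  have hs : ∀ v, (x.cfg.node v).out.isSome := by
    intro v
    obtain ⟨B, hB, -⟩ := h.out v
    rw [hB]; rfl
  obtain ⟨h1, h2⟩ := trackedStep_of_all_out hx fun v => by
    rw [check_of_isSome (hs v)]; exact hs v
  refine ⟨fun v => ?_, h2 ▸ h.peak_le⟩
  rw [h1]
  dsimp only
  rw [check_of_isSome (hs v)]
  exact h.out v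

/-- The first entries are known everywhere when they are mature. -/
def Spread (c : ℝ) (i : ℕ) (x : Tracked n s) : Prop :=
  ∀ t, x.found = some t → Mature c n i t → ∀ v, Informed t (x.cfg.node v)

/-- All nodes know a mature entry and all entries are valid, so all nodes halt in the same iteration
and no work is done in it. Different nodes may output different sets. -/
theorem Consistent.finished_step {w : ℝ} {i t : ℕ} {x x' : Tracked n s}
    (h : Consistent 𝒮 d w i x) (hs : Spread c i x) (hf : x.found = some t)
    (hm : Mature c n i t) (hx : x' ∈ (trackedStep 𝒮 d c i x).support) : Finished 𝒮 d w x' := by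
  have ho := fun v => exists_check_out (h.valid v) (h.running v) hm (h.found_lt t hf).le
    (hs t hf hm v)
  obtain ⟨h1, h2⟩ := trackedStep_of_all_out hx fun v => by
    obtain ⟨t, B, hB, -⟩ := ho v
    rw [hB]; rfl
  refine ⟨fun v => ?_, h2 ▸ h.peak_le⟩
  obtain ⟨t, B, hB, hV, hH⟩ := ho v
  exact ⟨B, by rw [h1]; exact hB, hH, hV.1⟩

theorem Consistent.informed {w : ℝ} {i t : ℕ} {x : Tracked n s}
    (h : Consistent 𝒮 d w i x) {v : Fin n} (hi : Informed t (x.cfg.node v)) :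
    ∃ t₀ ≤ t, x.found = some t₀ := by
  rcases hi with h1 | ⟨m, hm, rfl⟩
  · obtain ⟨⟨B, b⟩, h2⟩ := Option.isSome_iff_exists.1 h1
    exact ((h.valid v).entry t B b h2).1.1.2
  · exact ((h.valid v).inbox m hm).1.1.2

/-- Every entry is at least as recent as the first one, so nothing is mature before the first entry
is. -/
theorem Consistent.check_out {w : ℝ} {i : ℕ} {x : Tracked n s} (h : Consistent 𝒮 d w i x)
    (hf : ∀ t, x.found = some t → ¬ Mature c n i t) (v : Fin n) :
    (check 𝒮 c i (x.cfg.node v)).out = none := by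
  refine check_out_of_not_mature (h.running v) fun t hm hi => ?_
  obtain ⟨t₀, ht, hf'⟩ := h.informed hi
  exact hf t₀ hf' (hm.mono ht)

theorem Consistent.step {w : ℝ} {i : ℕ} {x x' : Tracked n s} (h : Consistent 𝒮 d w i x)
    (hf : ∀ t, x.found = some t → ¬ Mature c n i t) (hc : 0 ≤ c)
    (hload : ∀ v, ((x.cfg.node v).store.length : ℝ) ≤ Real.log n)
    (hw : (numPulls c n s d : ℝ) + Real.log n + (c * Real.log n + 1) ≤ w)
    (hx : x' ∈ (trackedStep 𝒮 d c i x).support) : Consistent 𝒮 d w (i + 1) x' := by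
  classical
  have hout := h.check_out hf
  obtain ⟨z, P, Q, l, hz, hP, hQ, rfl⟩ := exists_of_mem_support_trackedStep rfl hout hx
  set σ : Fin n → NodeState n := fun v => check 𝒮 c i (x.cfg.node v) with hσ
  have hq := keepProb_pos d
  set e' : Fin n → ℕ → Option (Finset (Fin n) × Bool) :=
    fun v => addEntry i (σ v).entries (z v).1 with he'
  set a : Fin n → Action n := fun v =>
    actionOf d c s i (σ v) ((z v).1, pushList 𝒮 d c (σ v) (z v).2) (P v) (Q v) with ha
  set y := advance 𝒮 d i x a
    (nextNode i σ (fun v => ((z v).1, pushList 𝒮 d c (σ v) (z v).2)) Q l) with hy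
  have hfound : y.found = match x.found with
      | some t => some t
      | none => if ∃ v, (e' v i).isSome then some i else none := rfl
  have hent : ∀ v t B b, e' v t = some (B, b) →
      ((B.card ≤ sampleSize d s ∧ ∃ t₀ ≤ t, y.found = some t₀) ∧ IsHittingSet 𝒮 B) ∧ b = true := by
    have hold : ∀ v t B b, (σ v).entries t = some (B, b) →
        ((B.card ≤ sampleSize d s ∧ ∃ t₀ ≤ t, y.found = some t₀) ∧ IsHittingSet 𝒮 B) ∧
          b = true := by
      intro v t B b ht
      by_cases hm : Mature c n i t
      · rw [hσ] at ht
        dsimp only at ht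
        rw [check_entries_of_mature (h.running v) i t hm] at ht
        exact absurd ht (by simp)
      · rw [hσ] at ht
        dsimp only at ht
        rw [check_entries (h.running v) i t hm] at ht
        obtain ⟨⟨⟨h1, t₀, h2, h3⟩, h4⟩, h5⟩ := (h.valid v).checked ht
        exact ⟨⟨⟨h1, t₀, h2, by rw [hfound, h3]⟩, h4⟩, h5⟩
    intro v t B b ht
    rcases hzv : (z v).1 with - | R
    · refine hold v t B b ?_
      simpa only [he', addEntry, hzv] using ht
    · have hR := isHittingSet_of_mem_support_choice (hz v) hzv
      have hei : e' v = Function.update (σ v).entries i (some (R, true)) := by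
        simp only [he', addEntry, hzv]
      by_cases hti : t = i
      · rw [hei, hti, Function.update_self] at ht
        simp only [Option.some.injEq, Prod.mk.injEq] at ht
        rw [← ht.1, ← ht.2]
        refine ⟨⟨⟨hR.2.1, ?_⟩, hR.1⟩, rfl⟩
        rw [hfound]
        rcases hxf : x.found with - | t₁
        · refine ⟨i, hti.ge, ?_⟩
          dsimp only
          rw [if_pos ⟨v, by rw [hei, Function.update_self]; rfl⟩]
        · exact ⟨t₁, (h.found_lt t₁ hxf).le.trans hti.ge, rfl⟩
      · rw [hei, Function.update_of_ne hti] at ht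
        exact hold v t B b ht
  refine ⟨fun v => rfl, fun p => ?_, ?_, fun j => ?_, ?_, fun v => ⟨hent v, fun m hm => ?_⟩,
    fun t ht => ?_, fun t ht => ?_⟩
  · rw [← h.orig p]
    refine Finset.sum_congr rfl fun u _ => ?_
    simp only [hy, advance, nextNode, hσ, check_orig]
  · have := h.mass_nonneg
    simp only [hy, advance]
    positivity
  · have := h.setMass_nonneg j
    simp only [hy, advance]
    positivity
  · have hwork : ∀ v, ((a v).work : ℝ) ≤ w := by
      intro v
      have h1 : (P v).length ≤ (x.cfg.node v).store.length := by
        rw [← List.length_map (f := Prod.snd), hP]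
        refine (length_pushList_le _ _ _ _ _).trans_eq ?_
        rw [check_store]
      have h1' : ((P v).length : ℝ) ≤ (x.cfg.node v).store.length := by exact_mod_cast h1
      have h2 : ((Q v).length : ℝ) ≤ c * Real.log n + 1 := by
        rw [← List.length_map (f := Prod.snd), hQ]
        refine length_entryList_le i _ hc fun t hm => ?_
        -- An entry created in the present iteration is not mature, so adding it does not disturb
        -- the vanishing of mature entries.
        have hti : t ≠ i := by
          rintro rfl
          unfold Mature at hm
          have : 0 ≤ c * Real.log n := mul_nonneg hc (Real.log_natCast_nonneg n)
          linarith
        have h3 := check_entries_of_mature (𝒮 := 𝒮) (h.running v) i t hm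
        cases (z v).1 with
        | none => exact h3
        | some R => exact (Function.update_of_ne hti _ _).trans h3
      have h3 := hload v
      simp only [ha, actionOf]
      push_cast
      linarith
    simp only [hy, advance]
    rw [Nat.cast_max]
    refine max_le h.peak_le ?_
    obtain ⟨v, -, hv⟩ := Finset.exists_mem_eq_sup (Finset.univ : Finset (Fin n))
      Finset.univ_nonempty fun v => (a v).work
    rw [hv]
    exact hwork v
  · obtain ⟨u, hu⟩ := mem_delivered hm
    rw [hQ, mem_entryList] at hu
    exact hent u m.1 m.2.1 m.2.2 hu.2
  · rw [hfound] at ht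
    rcases hxf : x.found with - | t₁
    · rw [hxf] at ht
      dsimp only at ht
      split_ifs at ht
      cases ht
      exact Nat.lt_succ_self i
    · rw [hxf] at ht
      have := h.found_lt t₁ hxf
      cases ht
      omega
  · rw [hfound] at ht
    rcases hxf : x.found with - | t₁
    · rw [hxf] at ht
      dsimp only at ht
      split_ifs at ht with hv
      cases ht
      obtain ⟨v, hv⟩ := hv
      exact ⟨v, Or.inl hv⟩
    · rw [hxf] at ht
      cases ht
      obtain ⟨v, hv⟩ := h.known t hxf
      rw [← isSome_checked (𝒮 := 𝒮), ← check_entries (h.running v) i t (hf t hxf)] at hv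
      -- The new entry is stored at index `i` and cannot overwrite the first one.
      have hti : t ≠ i := (h.found_lt t hxf).ne
      refine ⟨v, Or.inl ?_⟩
      have he : e' v t = (σ v).entries t := by
        simp only [he']
        cases (z v).1 with
        | none => rfl
        | some R => exact Function.update_of_ne hti _ _
      change (e' v t).isSome
      rw [he]
      exact hv

theorem consistent_of_mem_support_trackedInit {w : ℝ} (hw : 0 ≤ w) {x : Tracked n s}
    (hx : x ∈ (trackedInit n s).support) : Consistent 𝒮 d w 0 x := by
  have hx0 : (ex (trackedInit n s) fun y => ind (y = x)) ≠ 0 := by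
    rw [PMF.mem_support_iff, ← PMF.toOuterMeasure_apply_singleton, toOuterMeasure_eq_ex] at hx
    exact hx
  rw [ex_trackedInit] at hx0
  by_contra hne
  refine hx0 ?_
  rw [← le_zero_iff]
  refine ex_le_of_forall _ fun P hP => (ind_neg fun h => hne ?_).le
  rw [← h]
  refine ⟨fun v => rfl, fun p => ?_, le_rfl, fun j => le_rfl, by simpa using hw,
    fun v => ⟨fun t B b h => ?_, fun m hm => ?_⟩, fun t ht => ?_, fun t ht => ?_⟩
  · dsimp only
    rw [sum_countP_received, map_snd_of_mem_support_scatter hP]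
  · exact absurd h (by simp)
  · exact absurd hm (by simp)
  · exact absurd ht (by simp)
  · exact absurd ht (by simp)

end

/-! ### The spreading of the first entries -/

section
variable {n : ℕ} [NeZero n] {β : Type}

theorem ex_scatter_miss_le (p : β → Bool) (u : Fin n) (W : List β) :
    (ex (scatter n W) fun P => ind (∀ z ∈ received P u, ¬ p z)) ≤
      ENNReal.ofReal ((1 - 1 / n) ^ W.countP p) := by
  have hn : (1 : ℝ) ≤ n := by exact_mod_cast NeZero.one_le
  have hq : (0 : ℝ) ≤ 1 - 1 / n := by rw [sub_nonneg, div_le_one (by linarith)]; exact hn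
  induction W with
  | nil => rw [ex_scatter_nil]; simpa using ind_le_one _
  | cons b W ih =>
    rw [ex_scatter_cons]
    simp only [received_cons]
    by_cases hb : p b
    · rw [List.countP_cons_of_pos hb, pow_succ]
      have h1 : ∀ v : Fin n, (ex (scatter n W) fun P =>
          ind (∀ z ∈ (if u = v then b :: received P u else received P u), ¬ p z)) ≤
          if u = v then 0 else ENNReal.ofReal ((1 - 1 / n) ^ W.countP p) := by
        intro v
        split_ifs with huv
        · refine ex_le_of_forall _ fun P _ => (ind_neg fun h => ?_).le
          exact h b (List.mem_cons_self ..) hb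
        · exact ih
      refine (ENNReal.div_le_div_right (Finset.sum_le_sum fun v _ => h1 v) _).trans ?_
      rw [Finset.sum_ite, Finset.sum_const_zero, zero_add, Finset.sum_const, nsmul_eq_mul]
      have h2 : (Finset.univ.filter fun v => ¬ u = v).card = n - 1 := by
        rw [Finset.filter_not, Finset.filter_eq, if_pos (Finset.mem_univ _),
          Finset.card_sdiff_of_subset (Finset.subset_univ _)]
        simp
      have h3 : ((n - 1 : ℕ) : ℝ) = n - 1 := by
        rw [Nat.cast_sub NeZero.one_le, Nat.cast_one]
      rw [h2, ← ENNReal.ofReal_natCast, ← ENNReal.ofReal_natCast, ← ENNReal.ofReal_mul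
        (Nat.cast_nonneg _), ← ENNReal.ofReal_div_of_pos (by linarith), h3]
      refine ENNReal.ofReal_le_ofReal (le_of_eq ?_)
      field_simp
    · rw [List.countP_cons_of_neg hb]
      have h1 : ∀ v : Fin n, (ex (scatter n W) fun P =>
          ind (∀ z ∈ (if u = v then b :: received P u else received P u), ¬ p z)) ≤
          ENNReal.ofReal ((1 - 1 / n) ^ W.countP p) := by
        intro v
        refine le_trans (ex_mono _ fun P => ind_mono fun h z hz => ?_) ih
        refine h z ?_
        split_ifs
        · exact List.mem_cons_of_mem _ hz
        · exact hz
      refine (ENNReal.div_le_div_right (Finset.sum_le_sum fun v _ => h1 v) _).trans ?_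
      rw [Finset.sum_const, Finset.card_univ, Fintype.card_fin, nsmul_eq_mul]
      rw [mul_comm, ENNReal.mul_div_cancel_right (by simpa using NeZero.ne n) (by simp)]

open Classical in
/-- The nodes in `U` that do not receive a message that satisfies `p`. -/
def missed (p : β → Bool) (U : Finset (Fin n)) (P : List (Fin n × β)) : Finset (Fin n) :=
  U.filter fun u => ∀ z ∈ received P u, ¬ p z

theorem exp_neg_le {v : ℝ} (h0 : 0 ≤ v) (h1 : v ≤ 1) : Real.exp (-v) ≤ 1 - v / 2 := by
  have h2 := Real.add_one_le_exp v
  rw [Real.exp_neg, inv_eq_one_div, div_le_iff₀ (Real.exp_pos _)]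
  nlinarith

/-- Let m be the number of messages, one for each informed node. If m ≥ n/2, each node is missed
with probability at most 7/8 and the denominator does not decrease. If m < n/2, the number k ≤ m of
newly informed nodes has mean at least m/4, and it enters through the denominator m + k. -/
theorem ex_scatter_missed_le (p : β → Bool) {U : Finset (Fin n)} {W : List β}
    (hU : U.card + W.countP p = n) (hW : 1 ≤ W.countP p) :
    (ex (scatter n W) fun P => ENNReal.ofReal
      ((missed p U P).card / ((n - (missed p U P).card : ℕ) : ℝ))) ≤
      ENNReal.ofReal (7 / 8 * ((U.card : ℝ) / W.countP p)) := by
  classical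
  set m := W.countP p with hm
  have hn : (1 : ℝ) ≤ n := by exact_mod_cast NeZero.one_le
  have hm0 : (1 : ℝ) ≤ m := by exact_mod_cast hW
  have hUn : (U.card : ℝ) + m = n := by exact_mod_cast hU
  have hU0 : (0 : ℝ) ≤ U.card := Nat.cast_nonneg _
  have hmn : (m : ℝ) / n ≤ 1 := by rw [div_le_one (by linarith)]; linarith
  have hmiss : ∀ u, (ex (scatter n W) fun P => ind (∀ z ∈ received P u, ¬ p z)) ≤
      ENNReal.ofReal (Real.exp (-(m / n))) := by
    intro u
    refine (ex_scatter_miss_le p u W).trans (ENNReal.ofReal_le_ofReal ?_)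
    refine (one_sub_pow_le_exp ?_ _).trans_eq ?_
    · rw [div_le_one (by linarith)]; exact hn
    · congr 1; rw [hm]; ring
  have hsub : ∀ P, missed p U P ⊆ U := fun P => Finset.filter_subset _ _
  have hcard : ∀ P, (missed p U P).card ≤ U.card := fun P => Finset.card_le_card (hsub P)
  have hcast : ∀ P, ((n - (missed p U P).card : ℕ) : ℝ) = n - (missed p U P).card := by
    intro P
    rw [Nat.cast_sub ((hcard P).trans (by omega))]
  rcases le_or_gt (n : ℝ) (2 * m) with h | h
  · calc _ ≤ ex (scatter n W) fun P => ∑ u ∈ U, ENNReal.ofReal (1 / m) *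
          ind (∀ z ∈ received P u, ¬ p z) := by
          refine ex_mono _ fun P => ?_
          rw [← Finset.mul_sum, sum_ind, ← ENNReal.ofReal_natCast,
            ← ENNReal.ofReal_mul (by positivity), hcast]
          refine ENNReal.ofReal_le_ofReal ?_
          have h1 : ((missed p U P).card : ℝ) ≤ U.card := by exact_mod_cast hcard P
          rw [one_div_mul_eq_div]
          change _ ≤ ((missed p U P).card : ℝ) / m
          gcongr
          linarith
      _ ≤ ∑ _u ∈ U, ENNReal.ofReal (1 / m) * ENNReal.ofReal (Real.exp (-(m / n))) := by
          rw [ex_finset_sum]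
          refine Finset.sum_le_sum fun u _ => ?_
          rw [ex_const_mul]
          exact mul_le_mul_right (hmiss u) _
      _ ≤ _ := by
          rw [Finset.sum_const, nsmul_eq_mul, ← ENNReal.ofReal_natCast,
            ← ENNReal.ofReal_mul (by positivity), ← ENNReal.ofReal_mul (by positivity)]
          refine ENNReal.ofReal_le_ofReal ?_
          have h1 := exp_neg_le (v := (m : ℝ) / n) (by positivity) hmn
          have h2 : 1 / 2 ≤ (m : ℝ) / n := by rw [le_div_iff₀ (by linarith)]; linarith
          calc (U.card : ℝ) * (1 / m * Real.exp (-(m / n))) ≤ U.card * (1 / m * (7 / 8)) := by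
                gcongr; linarith
            _ = _ := by ring
  -- At most one new node per message is informed. The bound k ≤ m makes the linear estimate 1/(m +
  -- k) ≤ (1/m)(1 - k/(2m)) available.
  · have hk : ∀ P ∈ (scatter n W).support, U.card ≤ (missed p U P).card + m := by
      intro P hP
      have h1 : U.card - (missed p U P).card ≤ m := by
        rw [← Finset.card_sdiff_of_subset (hsub P), hm, ← map_snd_of_mem_support_scatter hP,
          ← sum_countP_received, Finset.card_eq_sum_ones]
        refine (Finset.sum_le_sum fun u hu => ?_).trans
          (Finset.sum_le_sum_of_subset (Finset.subset_univ _))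
        rw [Finset.mem_sdiff, missed, Finset.mem_filter, not_and] at hu
        have h2 := hu.2 hu.1
        push Not at h2
        obtain ⟨z, hz, hz'⟩ := h2
        exact Nat.one_le_iff_ne_zero.2 fun h0 => (List.countP_eq_zero.1 h0 z hz) hz'
      omega
    have hB : ENNReal.ofReal (1 / 8) ≤ ex (scatter n W) fun P =>
        ENNReal.ofReal (((U.card : ℝ) - (missed p U P).card) / (2 * m)) := by
      have h1 : ∀ u, ENNReal.ofReal (m / (2 * n)) ≤
          ex (scatter n W) fun P => ind (¬ ∀ z ∈ received P u, ¬ p z) := by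
        intro u
        have h2 := ex_ind_compl (scatter n W) fun P => ∀ z ∈ received P u, ¬ p z
        by_contra h3
        have h4 := exp_neg_le (v := (m : ℝ) / n) (by positivity) hmn
        have h5 : (ex (scatter n W) fun P => ind (∀ z ∈ received P u, ¬ p z)) +
            (ex (scatter n W) fun P => ind (¬ ∀ z ∈ received P u, ¬ p z)) < 1 := by
          calc _ < ENNReal.ofReal (Real.exp (-(m / n))) + ENNReal.ofReal (m / (2 * n)) :=
                ENNReal.add_lt_add_of_le_of_lt (ex_ind_ne_top _ _) (hmiss u) (not_le.1 h3)
            _ ≤ 1 := by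
                rw [← ENNReal.ofReal_add (Real.exp_pos _).le (by positivity),
                  ENNReal.ofReal_le_one]
                have : (m : ℝ) / (2 * n) = m / n / 2 := by rw [div_div, mul_comm 2]
                linarith
        rw [h2] at h5
        exact lt_irrefl _ h5
      calc ENNReal.ofReal (1 / 8) ≤ ENNReal.ofReal (U.card * (1 / (2 * m) * (m / (2 * n)))) := by
            refine ENNReal.ofReal_le_ofReal ?_
            have : (U.card : ℝ) * (1 / (2 * m) * (m / (2 * n))) = U.card / (4 * n) := by
              field_simp; norm_num
            rw [this, le_div_iff₀ (by linarith)]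
            linarith
        _ = ∑ _u ∈ U, ENNReal.ofReal (1 / (2 * m)) * ENNReal.ofReal (m / (2 * n)) := by
            rw [Finset.sum_const, nsmul_eq_mul, ← ENNReal.ofReal_natCast,
              ← ENNReal.ofReal_mul (by positivity), ← ENNReal.ofReal_mul (by positivity)]
        _ ≤ ∑ u ∈ U, ENNReal.ofReal (1 / (2 * m)) *
              ex (scatter n W) fun P => ind (¬ ∀ z ∈ received P u, ¬ p z) := by
            gcongr with u _
            exact h1 u
        _ = ex (scatter n W) fun P => ∑ u ∈ U, ENNReal.ofReal (1 / (2 * m)) *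
              ind (¬ ∀ z ∈ received P u, ¬ p z) := by
            rw [ex_finset_sum]
            simp only [ex_const_mul]
        _ = _ := by
            congr 1; funext P
            rw [← Finset.mul_sum, sum_ind, ← ENNReal.ofReal_natCast,
              ← ENNReal.ofReal_mul (by positivity)]
            have h2 := Finset.card_filter_add_card_filter_not (s := U)
              fun u => ∀ z ∈ received P u, ¬ p z
            have h3 : ((missed p U P).card : ℝ) + ((U.filter fun u =>
                ¬ ∀ z ∈ received P u, ¬ p z).card : ℝ) = U.card := by exact_mod_cast h2
            congr 1
            rw [← h3]; ring
    have hA : (ex (scatter n W) fun P => ENNReal.ofReal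
        (1 - ((U.card : ℝ) - (missed p U P).card) / (2 * m))) ≤ ENNReal.ofReal (7 / 8) := by
      have h1 : (ex (scatter n W) fun P => ENNReal.ofReal
          (1 - ((U.card : ℝ) - (missed p U P).card) / (2 * m))) + (ex (scatter n W) fun P =>
            ENNReal.ofReal (((U.card : ℝ) - (missed p U P).card) / (2 * m))) = 1 := by
        rw [← ex_add, ← ex_const (scatter n W) 1]
        refine ex_congr_of_support _ fun P hP => ?_
        have h1 : (U.card : ℝ) ≤ (missed p U P).card + m := by exact_mod_cast hk P hP
        have h2 : ((missed p U P).card : ℝ) ≤ U.card := by exact_mod_cast hcard P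
        have h3 : ((U.card : ℝ) - (missed p U P).card) / (2 * m) ≤ 1 := by
          rw [div_le_one (by linarith)]; linarith
        rw [← ENNReal.ofReal_add (by linarith) (div_nonneg (by linarith) (by linarith))]
        simp
      by_contra h2
      have h3 : ENNReal.ofReal (7 / 8) + ENNReal.ofReal (1 / 8) < 1 := by
        rw [← h1]
        exact ENNReal.add_lt_add_of_lt_of_le (by simp) (not_le.1 h2) hB
      rw [← ENNReal.ofReal_add (by norm_num) (by norm_num)] at h3
      norm_num at h3
    calc _ ≤ ex (scatter n W) fun P => ENNReal.ofReal (U.card / m) * ENNReal.ofReal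
          (1 - ((U.card : ℝ) - (missed p U P).card) / (2 * m)) := by
          refine ex_mono_of_support _ fun P hP => ?_
          have h1 : (U.card : ℝ) ≤ (missed p U P).card + m := by exact_mod_cast hk P hP
          have h2 : ((missed p U P).card : ℝ) ≤ U.card := by exact_mod_cast hcard P
          rw [← ENNReal.ofReal_mul (by positivity), hcast]
          refine ENNReal.ofReal_le_ofReal ?_
          set k := (U.card : ℝ) - (missed p U P).card with hkdef
          have e1 : (n : ℝ) - (missed p U P).card = m + k := by rw [hkdef]; linarith
          have hk0 : 0 ≤ k := by linarith
          have hkm : k ≤ m := by linarith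
          rw [e1]
          have e2 : 1 / ((m : ℝ) + k) ≤ 1 / m * (1 - k / (2 * m)) := by
            have : 1 / (m : ℝ) * (1 - k / (2 * m)) = (2 * m - k) / (2 * m ^ 2) := by
              field_simp
            rw [this, div_le_div_iff₀ (by linarith) (by positivity)]
            nlinarith
          calc ((missed p U P).card : ℝ) / (m + k) ≤ U.card * (1 / (m + k)) := by
                rw [mul_one_div]; gcongr
            _ ≤ U.card * (1 / m * (1 - k / (2 * m))) := by gcongr
            _ = _ := by ring
      _ ≤ ENNReal.ofReal (U.card / m) * ENNReal.ofReal (7 / 8) := by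
          rw [ex_const_mul]; exact mul_le_mul_right hA _
      _ = _ := by rw [← ENNReal.ofReal_mul (by positivity), mul_comm]

end

/-! ### Spreading of the first entry in the algorithm -/

section
variable {n s : ℕ} [NeZero n] {𝒮 : Fin s → Finset (Fin n)} {d : ℕ} {c : ℝ}

theorem countP_entryList {i t : ℕ} (ht : t ≤ i)
    (e : ℕ → Option (Finset (Fin n) × Bool)) :
    (entryList i e).countP (fun m => m.1 = t) = if (e t).isSome then 1 else 0 := by
  rw [entryList, List.countP_filterMap]
  have h1 : ∀ k ∈ List.range (i + 1), (((e k).map fun Bx => ((k, Bx) : Entry n)).map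
      fun m => decide (m.1 = t)).getD false = true ↔ (decide (k = t ∧ (e t).isSome)) = true := by
    intro k _
    by_cases hk : k = t
    · subst hk
      cases e k <;> simp
    · cases e k <;> simp [hk]
  rw [List.countP_congr h1]
  split_ifs with h
  · simp only [h, and_true]
    have := List.count_eq_one_of_mem (l := List.range (i + 1)) List.nodup_range
      (List.mem_range.2 (show t < i + 1 by omega))
    refine Eq.trans ?_ this
    rw [List.count]
    congr 1
  · simp [h]

open Classical in
/-- The number of nodes that do not know an entry for iteration `t`. -/
def uninformedCount (t : ℕ) (x : Tracked n s) : ℕ :=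
  (Finset.univ.filter fun v => ¬ Informed t (x.cfg.node v)).card

open Classical in
/-- The ratio of the numbers of uninformed and informed nodes. -/
def rumorPot (t : ℕ) (x : Tracked n s) : ℝ≥0∞ :=
  if Running x ∧ x.found = some t then
    ENNReal.ofReal (uninformedCount t x / ((n - uninformedCount t x : ℕ) : ℝ))
  else 0

/-- While the first entry is not mature, each informed node pushes exactly one message about it, so
`ex_scatter_missed_le` applies. Once the entry is mature, all nodes halt and the potential vanishes.
-/
theorem Consistent.ex_rumorPot_le {w : ℝ} {i t : ℕ} {x : Tracked n s}
    (h : Consistent 𝒮 d w i x) (hs : Spread c i x) (hti : t < i) :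
    ex (trackedStep 𝒮 d c i x) (rumorPot t) ≤ ENNReal.ofReal (7 / 8) * rumorPot t x := by
  classical
  by_cases hfin : ∃ t₀, x.found = some t₀ ∧ Mature c n i t₀
  · obtain ⟨t₀, hf, hm⟩ := hfin
    refine (ex_le_of_forall _ fun x' hx' => ?_).trans (zero_le)
    rw [rumorPot, if_neg]
    rintro ⟨hrun, -⟩
    obtain ⟨B, hB, -⟩ := (h.finished_step hs hf hm hx').out 0
    rw [hrun 0] at hB
    exact absurd hB (by simp)
  push Not at hfin
  have hout := h.check_out hfin
  by_cases hf : x.found = some t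
  swap
  · refine (ex_le_of_forall _ fun x' hx' => ?_).trans (zero_le)
    rw [rumorPot, if_neg]
    rintro ⟨-, hf'⟩
    obtain ⟨z, P, Q, l, -, -, -, rfl⟩ := exists_of_mem_support_trackedStep rfl hout hx'
    rcases hxf : x.found with - | t₁
    · simp only [advance, hxf] at hf'
      split_ifs at hf'
      cases hf'
      exact lt_irrefl _ hti
    · simp only [advance, hxf] at hf'
      exact hf (hxf.trans hf')
  have hm := hfin t hf
  set σ : Fin n → NodeState n := fun v => check 𝒮 c i (x.cfg.node v) with hσ
  set U : Finset (Fin n) := Finset.univ.filter fun v => ¬ Informed t (x.cfg.node v) with hU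
  have hUc : uninformedCount t x = U.card := rfl
  have hent : ∀ (o : Option (Finset (Fin n))) v,
      (addEntry i (σ v).entries o t).isSome ↔ Informed t (x.cfg.node v) := by
    intro o v
    have : addEntry i (σ v).entries o t = (σ v).entries t := by
      cases o with
      | none => rfl
      | some R => exact Function.update_of_ne hti.ne _ _
    rw [this, hσ]
    dsimp only
    rw [check_entries (h.running v) i t hm, isSome_checked]
  rw [ex_trackedStep 𝒮 d c i x hσ hout]
  refine ex_le_of_forall _ fun RW _ => ex_le_of_forall _ fun P _ => ?_
  set W : List (Entry n) :=
    (List.ofFn fun v => entryList i (addEntry i (σ v).entries (RW v).1)).flatten with hW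
  have hWm : W.countP (fun m => m.1 = t) =
      (Finset.univ.filter fun v => Informed t (x.cfg.node v)).card := by
    rw [hW, List.countP_flatten, List.map_ofFn, List.sum_ofFn, Finset.card_filter]
    refine Finset.sum_congr rfl fun v _ => ?_
    simp only [Function.comp]
    rw [countP_entryList hti.le]
    simp only [hent]
  have hcard : U.card + W.countP (fun m => m.1 = t) = n := by
    rw [hWm, add_comm, hU, Finset.card_filter_add_card_filter_not, Finset.card_univ,
      Fintype.card_fin]
  have hpos : 1 ≤ W.countP (fun m => m.1 = t) := by
    rw [hWm, Nat.one_le_iff_ne_zero, Finset.card_ne_zero]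
    obtain ⟨v, hv⟩ := h.known t hf
    exact ⟨v, Finset.mem_filter.2 ⟨Finset.mem_univ _, hv⟩⟩
  have hb := ex_scatter_missed_le (fun m : Entry n => decide (m.1 = t)) hcard hpos
  rw [hW, ← ex_indep_scatter n (fun v => entryList i (addEntry i (σ v).entries (RW v).1))
    fun P => ENNReal.ofReal ((missed (fun m : Entry n => decide (m.1 = t)) U P).card /
      ((n - (missed (fun m : Entry n => decide (m.1 = t)) U P).card : ℕ) : ℝ)), ← hW] at hb
  have hx : rumorPot t x = ENNReal.ofReal (U.card / W.countP (fun m => m.1 = t)) := by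
    rw [rumorPot, if_pos ⟨h.running, hf⟩, hUc]
    congr 3
    omega
  rw [hx, ← ENNReal.ofReal_mul (by norm_num)]
  refine le_trans (ex_mono _ fun Q => ex_le_of_forall _ fun l _ => ?_) hb
  rw [rumorPot]
  split_ifs
  swap
  · exact zero_le
  have hun : uninformedCount t (advance 𝒮 d i x
      (fun v => actionOf d c s i (σ v) (RW v) (P v) (Q v)) (nextNode i σ RW Q l)) =
      (missed (fun m : Entry n => decide (m.1 = t)) U (List.ofFn fun v => Q v).flatten).card := by
    rw [uninformedCount, missed, hU, Finset.filter_filter]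
    congr 1
    refine Finset.filter_congr fun v _ => ?_
    have h1 : Informed t ((advance 𝒮 d i x
        (fun v => actionOf d c s i (σ v) (RW v) (P v) (Q v)) (nextNode i σ RW Q l)).cfg.node v) ↔
        Informed t (x.cfg.node v) ∨ ∃ m ∈ delivered Q v, m.1 = t := by
      rw [← hent (RW v).1 v]
      rfl
    rw [h1, delivered_eq_received]
    simp only [decide_eq_true_eq]
    push Not
    rfl
  rw [hun]

/-- Mature entries are known everywhere. -/
theorem killed_not_spread_le (G : ℕ → Tracked n s → Prop) {w : ℝ}
    (hG : ∀ i x, G i x → Running x → Consistent 𝒮 d w i x ∧ Spread c i x) (i : ℕ) :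
    (killed (trackedInit n s) (trackedStep 𝒮 d c) G i fun x =>
      ind (Consistent 𝒮 d w i x ∧ ¬ Spread c i x)) ≤
      ENNReal.ofReal (i * (n ^ 2 * Real.exp (-((c * Real.log n - 1) / 8)))) := by
  classical
  have hn : (1 : ℝ) ≤ n := by exact_mod_cast NeZero.one_le
  have hone : ∀ t < i, Mature c n i t →
      (killed (trackedInit n s) (trackedStep 𝒮 d c) G i fun x =>
        ind (Consistent 𝒮 d w i x ∧ x.found = some t ∧ ∃ v, ¬ Informed t (x.cfg.node v))) ≤
      ENNReal.ofReal (n ^ 2 * Real.exp (-((c * Real.log n - 1) / 8))) := by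
    intro t hti hm
    -- The factor (8/7)^k undoes the contraction. The process starts at time t + 1, when an entry of
    -- iteration t first exists.
    have hsup := killed_le_of_supermartingale (trackedInit n s) (trackedStep 𝒮 d c) G
      (f := fun k x => ENNReal.ofReal ((8 / 7) ^ k) * rumorPot t x) (t₀ := t + 1)
      (fun k x hk hx => by
        rw [ex_const_mul]
        by_cases hrun : Running x
        · obtain ⟨h1, h2⟩ := hG k x hx hrun
          refine (mul_le_mul_right (h1.ex_rumorPot_le h2 hk) _).trans_eq ?_
          rw [← mul_assoc, ← ENNReal.ofReal_mul (by positivity), pow_succ]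
          congr 2; ring
        · rw [ex_trackedStep_eq_zero (fun h => hrun (running_of_check h)) fun x hx => by
            rw [rumorPot, if_neg fun h => hx h.1], mul_zero]
          exact zero_le) (t := i) hti
    have hstart : (killed (trackedInit n s) (trackedStep 𝒮 d c) G (t + 1) fun x =>
        ENNReal.ofReal ((8 / 7) ^ (t + 1)) * rumorPot t x) ≤
        ENNReal.ofReal ((8 / 7) ^ (t + 1) * n) := by
      refine (killed_mono _ _ _ _ fun x => ?_).trans (killed_const_le _ _ _ _ _)
      rw [ENNReal.ofReal_mul (by positivity)]
      refine mul_le_mul_right ?_ _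
      rw [rumorPot]
      split_ifs
      · refine ENNReal.ofReal_le_ofReal ?_
        have h1 : (uninformedCount t x : ℝ) ≤ n := by
          exact_mod_cast (Finset.card_le_univ _).trans_eq (Fintype.card_fin n)
        rcases Nat.eq_zero_or_pos (n - uninformedCount t x) with h0 | h0
        · rw [h0]; simp
        · have h2 : (1 : ℝ) ≤ ((n - uninformedCount t x : ℕ) : ℝ) := by exact_mod_cast h0
          exact (div_le_self (Nat.cast_nonneg _) h2).trans h1
      · exact zero_le
    -- The ratio starts at no more than n and is at least 1/n as long as some node is uninformed,
    -- hence the loss n².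
    refine killed_markov (y := ENNReal.ofReal (n * (7 / 8) ^ i)) _ _ _ _
      (f := fun x => ENNReal.ofReal ((8 / 7) ^ i) * rumorPot t x) (fun x hx => ?_) ?_
    · obtain ⟨h, hf, v, hv⟩ := hx
      rw [rumorPot, if_pos ⟨h.running, hf⟩, ← ENNReal.ofReal_mul (by positivity),
        ← ENNReal.ofReal_mul (by positivity), ENNReal.one_le_ofReal]
      have h1 : (1 : ℝ) ≤ uninformedCount t x := by
        have : 1 ≤ uninformedCount t x := by
          rw [uninformedCount, Nat.one_le_iff_ne_zero, Finset.card_ne_zero]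
          exact ⟨v, Finset.mem_filter.2 ⟨Finset.mem_univ _, hv⟩⟩
        exact_mod_cast this
      have h2 : uninformedCount t x < n := by
        obtain ⟨u, hu⟩ := h.known t hf
        refine (Finset.card_lt_univ_of_notMem (x := u) ?_).trans_eq (Fintype.card_fin n)
        simp [hu]
      have h3 : (0 : ℝ) < ((n - uninformedCount t x : ℕ) : ℝ) := by
        exact_mod_cast Nat.sub_pos_of_lt h2
      have h4 : ((n - uninformedCount t x : ℕ) : ℝ) ≤ n := by exact_mod_cast Nat.sub_le _ _
      have h5 : (1 : ℝ) / n ≤ uninformedCount t x / ((n - uninformedCount t x : ℕ) : ℝ) := by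
        gcongr
      have h6 : (7 / 8 : ℝ) ^ i * (8 / 7) ^ i = 1 := by rw [← mul_pow]; norm_num
      calc (1 : ℝ) = n * ((7 / 8 : ℝ) ^ i * (8 / 7) ^ i) * (1 / n) := by rw [h6]; field_simp
        _ ≤ n * ((7 / 8 : ℝ) ^ i * (8 / 7) ^ i) *
            (uninformedCount t x / ((n - uninformedCount t x : ℕ) : ℝ)) := by gcongr
        _ = _ := by ring
    · refine (mul_le_mul_right (hsup.trans hstart) _).trans ?_
      rw [← ENNReal.ofReal_mul (by positivity)]
      refine ENNReal.ofReal_le_ofReal ?_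
      obtain ⟨k, rfl⟩ : ∃ k, i = t + 1 + k := ⟨i - (t + 1), by omega⟩
      have h6 : (7 / 8 : ℝ) ^ (t + 1) * (8 / 7) ^ (t + 1) = 1 := by rw [← mul_pow]; norm_num
      have h7 : (7 / 8 : ℝ) ^ k ≤ Real.exp (-((c * Real.log n - 1) / 8)) := by
        have h8 := one_sub_pow_le_exp (x := 1 / 8) (by norm_num) k
        norm_num at h8 ⊢
        refine h8.trans (Real.exp_le_exp.2 ?_)
        unfold Mature at hm
        push_cast at hm
        linarith
      calc (n : ℝ) * (7 / 8) ^ (t + 1 + k) * ((8 / 7) ^ (t + 1) * n) =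
            n ^ 2 * (7 / 8) ^ k * ((7 / 8 : ℝ) ^ (t + 1) * (8 / 7) ^ (t + 1)) := by
            rw [pow_add]; ring
        _ = n ^ 2 * (7 / 8) ^ k := by rw [h6, mul_one]
        _ ≤ _ := by gcongr
  calc _ ≤ killed (trackedInit n s) (trackedStep 𝒮 d c) G i fun x =>
        ∑ t ∈ (Finset.range i).filter (Mature c n i),
          ind (Consistent 𝒮 d w i x ∧ x.found = some t ∧ ∃ v, ¬ Informed t (x.cfg.node v)) := by
        refine killed_mono _ _ _ _ fun x => ?_
        by_cases hx : Consistent 𝒮 d w i x ∧ ¬ Spread c i x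
        · obtain ⟨h1, h2⟩ := hx
          unfold Spread at h2
          push Not at h2
          obtain ⟨t, hf, hm, v, hv⟩ := h2
          refine (ind_le_one _).trans ?_
          rw [← ind_pos (A := Consistent 𝒮 d w i x ∧ x.found = some t ∧
            ∃ v, ¬ Informed t (x.cfg.node v)) ⟨h1, hf, v, hv⟩]
          exact Finset.single_le_sum (f := fun t => ind (Consistent 𝒮 d w i x ∧
            x.found = some t ∧ ∃ v, ¬ Informed t (x.cfg.node v))) (fun _ _ => zero_le)
            (Finset.mem_filter.2 ⟨Finset.mem_range.2 (h1.found_lt t hf), hm⟩)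
        · rw [ind_neg hx]; exact zero_le
    _ ≤ ∑ _t ∈ (Finset.range i).filter (Mature c n i),
          ENNReal.ofReal (n ^ 2 * Real.exp (-((c * Real.log n - 1) / 8))) := by
        rw [killed_sum]
        refine Finset.sum_le_sum fun t ht => ?_
        rw [Finset.mem_filter, Finset.mem_range] at ht
        exact hone t ht.1 ht.2
    _ ≤ _ := by
        rw [Finset.sum_const, nsmul_eq_mul, ENNReal.ofReal_mul (Nat.cast_nonneg _),
          ENNReal.ofReal_natCast]
        gcongr
        exact (Finset.card_filter_le _ _).trans_eq (Finset.card_range i)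

end

/-! ### Good trajectories -/

section
variable {α : Type} (p : PMF α) (step : ℕ → α → PMF α) (G : ℕ → α → Prop)

theorem killed_ind_or_le (t : ℕ) {A B : α → Prop} {a b : ℝ≥0∞}
    (hA : (killed p step G t fun x => ind (A x)) ≤ a)
    (hB : (killed p step G t fun x => ind (B x)) ≤ b) :
    (killed p step G t fun x => ind (A x ∨ B x)) ≤ a + b := by
  refine le_trans ?_ (add_le_add hA hB)
  rw [← killed_add]
  refine killed_mono _ _ _ _ fun x => ?_
  by_cases h : A x
  · rw [ind_pos (A := A x) h]; exact (ind_le_one _).trans le_self_add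
  · by_cases h' : B x
    · rw [ind_pos (A := B x) h']; exact (ind_le_one _).trans le_add_self
    · rw [ind_neg (by tauto)]; exact zero_le

theorem killed_ind_exists_le {ι : Type} (s : Finset ι) (t : ℕ) {A : ι → α → Prop} {a : ℝ≥0∞}
    (hA : ∀ i ∈ s, (killed p step G t fun x => ind (A i x)) ≤ a) :
    (killed p step G t fun x => ind (∃ i ∈ s, A i x)) ≤ s.card * a := by
  rw [← nsmul_eq_mul, ← Finset.sum_const]
  refine le_trans ?_ (Finset.sum_le_sum hA)
  rw [← killed_sum]
  refine killed_mono _ _ _ _ fun x => ?_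
  by_cases h : ∃ i ∈ s, A i x
  · obtain ⟨i, hi, h⟩ := h
    refine (ind_le_one _).trans ?_
    rw [← ind_pos h]
    exact Finset.single_le_sum (f := fun i => ind (A i x)) (fun _ _ => zero_le) hi
  · rw [ind_neg h]; exact zero_le

end

section
variable {n s : ℕ} [NeZero n] {𝒮 : Fin s → Finset (Fin n)} {d : ℕ} {c : ℝ}

/-- At least an eighth of the nodes initially have a point. -/
def Occupied (o : Fin n → List (Fin n)) : Prop :=
  n ≤ 8 * (Finset.univ.filter fun u => o u ≠ []).card

/-- A pull at a nonempty node always returns a copy, and initial points are never removed. -/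
theorem Occupied.pullMass {σ : Fin n → NodeState n} (h : Occupied fun u => (σ u).orig) :
    1 / 8 ≤ pullMass σ fun _ => true := by
  have hn : (0 : ℝ) < n := by exact_mod_cast Nat.pos_of_ne_zero (NeZero.ne n)
  have h' : (n : ℝ) ≤ 8 * (Finset.univ.filter fun u => (σ u).orig ≠ []).card := by exact_mod_cast h
  rw [Gossip.pullMass, le_div_iff₀ hn]
  have : ((Finset.univ.filter fun u => (σ u).orig ≠ []).card : ℝ) ≤
      ∑ u, ((σ u).store.countP (fun _ => true) : ℝ) / (σ u).store.length := by
    rw [Finset.card_filter]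
    push_cast
    refine Finset.sum_le_sum fun u _ => ?_
    split_ifs with hu
    · have h1 : (0 : ℝ) < (σ u).store.length := by
        have : 0 < (σ u).store.length := by
          rw [NodeState.store, List.length_append]
          have := List.length_pos_of_ne_nil hu
          omega
        exact_mod_cast this
      rw [List.countP_true, div_self h1.ne']
    · positivity
  linarith

/-- The event depends only on the initial assignment, so it is carried unchanged from time 0. -/
theorem killed_not_occupied_le (G : ℕ → Tracked n s → Prop) (hn : 8 ≤ n) (t : ℕ) :
    (killed (trackedInit n s) (trackedStep 𝒮 d c) G t fun x =>
      ind (Running x ∧ ¬ Occupied fun u => (x.cfg.node u).orig)) ≤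
      ENNReal.ofReal (2 * 64 * (1 / 2) ^ n) := by
  set f : ℕ → Tracked n s → ℝ≥0∞ := fun _ => loadPot fun o _ _ _ => ind (¬ Occupied o) with hf
  have h := killed_le_of_remaining (trackedInit n s) (trackedStep 𝒮 d c) G (f := f) (T := t)
    (fun i x _ m _ => ex_trackedStep_loadPot_le fun W => by simp only [ex_const]; exact le_rfl)
    (le_refl (t + 0))
  have h0 : ex (trackedInit n s) (f (0 + t)) ≤ ENNReal.ofReal (2 * 64 * (1 / 2) ^ n) := by
    rw [ex_trackedInit]
    refine le_trans (ex_mono _ fun P => ?_)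
      (ex_scatter_occupied_le (List.finRange n) List.length_finRange hn)
    simp only [hf, loadPot]
    split_ifs
    · refine ind_mono fun hP => ?_
      rw [Occupied, not_le] at hP
      refine lt_of_eq_of_lt ?_ hP
      congr 2
      ext u
      simp only [List.mem_toFinset, List.mem_map, Finset.mem_filter, Finset.mem_univ, true_and,
        received, ne_eq, List.map_eq_nil_iff, List.filter_eq_nil_iff, not_forall]
      constructor
      · rintro ⟨z, hz, rfl⟩; exact ⟨z, hz, by simp⟩
      · rintro ⟨z, hz, hz'⟩; exact ⟨z, hz, by simpa using hz'⟩
    · exact zero_le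
  refine (killed_mono _ _ _ _ fun x => ?_).trans (h.trans h0)
  simp only [hf, loadPot]
  by_cases hx : Running x
  · rw [if_pos hx]; exact ind_mono fun h => h.2
  · rw [ind_neg fun h => hx h.1]; exact zero_le

/-- The conditions that hold in each iteration with high probability, if a hitting set has to be
found in one of the first `T₁` iterations. -/
structure Healthy (𝒮 : Fin s → Finset (Fin n)) (d : ℕ) (c w : ℝ) (T₁ T i : ℕ) (x : Tracked n s) :
    Prop where
  consistent : Consistent 𝒮 d w i x
  spread : Spread c i x
  balanced : Balanced 𝒮 d x
  loadWeight_le : ∀ m, i + m < T → ∑ u, budgetWeight (1 / 4) 800 n d (m + 1) x.mass *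
    loadWeight (1 / 4) d (m + 1) (x.cfg.node u).orig.length (x.cfg.node u).extra.length ≤
      3 * n * Real.exp (1 / 4 * 800)
  found : T₁ ≤ i → ∃ t < T₁, x.found = some t

/-- All nodes have halted, or the network is in a good state. -/
def Good (𝒮 : Fin s → Finset (Fin n)) (d : ℕ) (c w : ℝ) (T₁ T i : ℕ) (x : Tracked n s) : Prop :=
  Finished 𝒮 d w x ∨ Healthy 𝒮 d c w T₁ T i x

theorem Finished.not_running {w : ℝ} {x : Tracked n s} (h : Finished 𝒮 d w x) : ¬ Running x := by
  intro hr
  obtain ⟨B, hB, -⟩ := h.out 0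
  rw [hr 0] at hB
  exact absurd hB (by simp)

theorem Good.healthy {w : ℝ} {T₁ T i : ℕ} {x : Tracked n s} (h : Good 𝒮 d c w T₁ T i x)
    (hx : Running x) : Healthy 𝒮 d c w T₁ T i x :=
  h.resolve_left fun h => h.not_running hx

theorem found_of_mem_support {i t : ℕ} {x x' : Tracked n s}
    (hout : ∀ v, (check 𝒮 c i (x.cfg.node v)).out = none)
    (hx : x' ∈ (trackedStep 𝒮 d c i x).support) (hf : x.found = some t) : x'.found = some t := by
  obtain ⟨z, P, Q, l, -, -, -, rfl⟩ := exists_of_mem_support_trackedStep rfl hout hx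
  simp only [advance, hf]

theorem Good.step {w : ℝ} {T₁ T i : ℕ} {x x' : Tracked n s} (h : Good 𝒮 d c w T₁ T i x)
    (hc : 0 ≤ c) (hw : (numPulls c n s d : ℝ) + Real.log n + (c * Real.log n + 1) ≤ w)
    (hx : x' ∈ (trackedStep 𝒮 d c i x).support) :
    Finished 𝒮 d w x' ∨ (Consistent 𝒮 d w (i + 1) x' ∧
      (T₁ ≤ i → ∃ t < T₁, x'.found = some t ∧ ¬ Mature c n i t)) := by
  rcases h with h | h
  · exact Or.inl (h.step hx)
  by_cases hf : ∃ t, x.found = some t ∧ Mature c n i t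
  · obtain ⟨t, hf, hm⟩ := hf
    exact Or.inl (h.consistent.finished_step h.spread hf hm hx)
  · push Not at hf
    refine Or.inr ⟨h.consistent.step hf hc h.balanced.load hw hx, fun hi => ?_⟩
    obtain ⟨t, ht, hft⟩ := h.found hi
    exact ⟨t, ht, found_of_mem_support (h.consistent.check_out hf) hx hft, hf t hft⟩

/-- This part of goodness is deterministic: it holds initially and after every step from a good
state. The deadline is inherited only for i > T₁; at i = T₁ it is a probabilistic statement. -/
theorem killed_not_consistent {w : ℝ} {T₁ T : ℕ} (hc : 0 ≤ c)
    (hw : (numPulls c n s d : ℝ) + Real.log n + (c * Real.log n + 1) ≤ w) (i : ℕ) :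
    (killed (trackedInit n s) (trackedStep 𝒮 d c) (Good 𝒮 d c w T₁ T) i fun x =>
      ind (¬ (Finished 𝒮 d w x ∨ (Consistent 𝒮 d w i x ∧
        (T₁ < i → ∃ t < T₁, x.found = some t))))) ≤ 0 := by
  cases i with
  | zero =>
    refine ex_le_of_forall _ fun x hx => (ind_neg ?_).le
    rw [not_not]
    have hw0 : 0 ≤ w := by
      have := mul_nonneg hc (Real.log_natCast_nonneg n)
      have := Real.log_natCast_nonneg n
      have : (0 : ℝ) ≤ numPulls c n s d := Nat.cast_nonneg _
      linarith
    exact Or.inr ⟨consistent_of_mem_support_trackedInit hw0 hx, fun h => absurd h (Nat.not_lt_zero _)⟩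
  | succ i =>
    rw [killed]
    refine (killed_mono (g := fun _ => 0) _ _ _ _ fun x => ?_).trans_eq (killed_zero _ _ _ i)
    split_ifs with hG
    · refine ex_le_of_forall _ fun x' hx' => (ind_neg ?_).le
      rw [not_not]
      rcases hG.step hc hw hx' with h | ⟨h1, h2⟩
      · exact Or.inl h
      · refine Or.inr ⟨h1, fun hi => ?_⟩
        obtain ⟨t, ht, hf, -⟩ := h2 (Nat.lt_succ_iff.1 hi)
        exact ⟨t, ht, hf⟩
    · exact zero_le

/-- An entry from before T₁ is mature in the last iteration T - 1 = T₁ + ⌈c log n⌉, so a good state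
there leads to halting. -/
theorem killed_not_finished {w : ℝ} {T₁ T : ℕ} (hc : 0 ≤ c)
    (hw : (numPulls c n s d : ℝ) + Real.log n + (c * Real.log n + 1) ≤ w)
    (hT : T₁ + ⌈c * Real.log n⌉₊ + 1 = T) :
    (killed (trackedInit n s) (trackedStep 𝒮 d c) (Good 𝒮 d c w T₁ T) T fun x =>
      ind (¬ Finished 𝒮 d w x)) ≤ 0 := by
  subst hT
  rw [killed]
  refine (killed_mono (g := fun _ => 0) _ _ _ _ fun x => ?_).trans_eq (killed_zero _ _ _ _)
  split_ifs with hG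
  · refine ex_le_of_forall _ fun x' hx' => (ind_neg ?_).le
    rw [not_not]
    rcases hG.step hc hw hx' with h | ⟨h1, h2⟩
    · exact h
    · obtain ⟨t, ht, hf, hm⟩ := h2 (Nat.le_add_right _ _)
      refine absurd ?_ hm
      unfold Mature
      have h3 := Nat.le_ceil (c * Real.log n)
      have h4 : (t : ℝ) + 1 ≤ T₁ := by exact_mod_cast ht
      push_cast
      linarith
  · exact zero_le

/-- The probability of leaving the good states in a given iteration. -/
theorem killed_not_good_le {w a : ℝ} {T₁ T : ℕ} (ha : 0 ≤ a) (hr : Regime n s d c) {H : Finset (Fin n)}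
    (hH : IsHittingSet 𝒮 H) (hd : H.card = d)
    (hw : (numPulls c n s d : ℝ) + Real.log n + (c * Real.log n + 1) ≤ w) {i : ℕ} (hi : i < T) :
    (killed (trackedInit n s) (trackedStep 𝒮 d c) (Good 𝒮 d c w T₁ T) i fun x =>
      ind (¬ Good 𝒮 d c w T₁ T i x)) ≤
      0 + (ENNReal.ofReal (T * (n ^ 2 * Real.exp (-((c * Real.log n - 1) / 8)))) +
      (ENNReal.ofReal (Real.exp (-(3 / 4 * (n / Real.log n)))) +
      (n * ENNReal.ofReal ((1 + Real.exp ((Real.exp a - 1) * 800)) / Real.exp (a * Real.log n)) +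
      (T * ENNReal.ofReal (Real.exp (-(n / (2 * Real.exp (1 / 4 * Real.log n))))) +
      (s * ENNReal.ofReal (Real.exp (-(1 / 1000 * (n / d)))) +
      (s * ENNReal.ofReal (Real.exp (-(1 / 1000 * (n / d)))) +
      (ENNReal.ofReal (2 * 64 * (1 / 2) ^ n) +
      ENNReal.ofReal (n * Real.exp (-(T₁ / (100 * d))))))))))) := by
  have hc : 0 ≤ c := by linarith [hr.le_c]
  have hl := hr.one_le_log
  have hn8 : 8 ≤ n := by
    have h1 := hr.hundred_mul_le
    have h2 : (1 : ℝ) ≤ d := by exact_mod_cast hr.one_le_d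
    have h3 : (8 : ℝ) ≤ n := by linarith
    exact_mod_cast h3
  set G := Good 𝒮 d c w T₁ T with hG
  have hbal : ∀ t x, G t x → Running x → Balanced 𝒮 d x := fun t x h hx => (h.healthy hx).balanced
  have hb0 : 0 ≤ Real.exp a - 1 := by linarith [Real.add_one_le_exp a]
  have B0 := killed_not_consistent (𝒮 := 𝒮) (T₁ := T₁) (T := T) hc hw i
  have B1 := (killed_not_spread_le G (𝒮 := 𝒮) (c := c) (w := w)
    (fun t x h hx => ⟨(h.healthy hx).consistent, (h.healthy hx).spread⟩) i).trans
    (ENNReal.ofReal_le_ofReal (show (i : ℝ) * (n ^ 2 * Real.exp (-((c * Real.log n - 1) / 8))) ≤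
      T * (n ^ 2 * Real.exp (-((c * Real.log n - 1) / 8))) by gcongr))
  have B2 := killed_mass_le G hr hbal i
  -- With b = exp(a) - 1 a load above log n has weight more than n^a, while exp(800b) is a constant.
  have B3 := killed_ind_exists_le (trackedInit n s) (trackedStep 𝒮 d c) G Finset.univ i
    fun u _ => killed_load_le (𝒮 := 𝒮) (d := d) (c := c) G (B := 800) hb0
      (Real.exp_pos (a * Real.log n)) i u
  rw [Finset.card_univ, Fintype.card_fin] at B3
  have B4 := killed_ind_exists_le (trackedInit n s) (trackedStep 𝒮 d c) G (Finset.range T) i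
    fun m _ => killed_loadWeight_le (𝒮 := 𝒮) (d := d) (c := c) G (b := 1 / 4) (B := 800)
      (by norm_num) (Real.exp_pos (1 / 4 * Real.log n)) i (m + 1)
  rw [Finset.card_range] at B4
  have B5 := killed_ind_exists_le (trackedInit n s) (trackedStep 𝒮 d c) G Finset.univ i
    fun j _ => killed_crowded_le (𝒮 := 𝒮) (d := d) (c := c) G (B := 800) (T := T)
      (fun t x h hx => (h.healthy hx).loadWeight_le) j hi.le (1 / 1000 * (n / d))
  have B6 := killed_ind_exists_le (trackedInit n s) (trackedStep 𝒮 d c) G Finset.univ i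
    fun j _ => killed_extraCount_le (𝒮 := 𝒮) (d := d) (c := c) G j i (1 / 1000 * (n / d))
  rw [Finset.card_univ, Fintype.card_fin] at B5 B6
  have B7 := killed_not_occupied_le (𝒮 := 𝒮) (d := d) (c := c) G hn8 i
  have B8 : (killed (trackedInit n s) (trackedStep 𝒮 d c) G i fun x =>
      ind (i = T₁ ∧ Running x ∧ Balanced 𝒮 d x ∧ x.found = none)) ≤
      ENNReal.ofReal (n * Real.exp (-(T₁ / (100 * d)))) := by
    by_cases hiT : i = T₁
    · rw [← hiT]
      refine (killed_mono _ _ _ _ fun x => ind_mono fun h => h.2).trans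
        (killed_found_le G hr hH hd hbal i)
    · refine (killed_mono _ _ _ _ fun x => (ind_neg fun h => hiT h.1).le).trans ?_
      rw [killed_zero]; exact zero_le
  refine (killed_mono _ _ _ _ fun x => ind_mono ?_).trans
    (killed_ind_or_le _ _ _ _ B0 (killed_ind_or_le _ _ _ _ B1 (killed_ind_or_le _ _ _ _ B2
      (killed_ind_or_le _ _ _ _ B3 (killed_ind_or_le _ _ _ _ B4 (killed_ind_or_le _ _ _ _ B5
        (killed_ind_or_le _ _ _ _ B6 (killed_ind_or_le _ _ _ _ B7 B8))))))))
  intro hx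
  by_contra hcon
  simp only [not_or] at hcon
  obtain ⟨E0, E1, E2, E3, E4, E5, E6, E7, E8⟩ := hcon
  rcases by_contra fun h => E0 (not_or.1 h) with hfin | ⟨hcons, hlate⟩
  · exact hx (Or.inl hfin)
  have hrun := hcons.running
  have hspread : Spread c i x := by_contra fun h => E1 ⟨hcons, h⟩
  have hmass : x.mass ≤ (800 - 1) * n := by
    by_contra h; exact E2 ⟨hrun, not_le.1 h⟩
  have hload : ∀ u, ((x.cfg.node u).store.length : ℝ) ≤ Real.log n := by
    intro u
    by_contra h
    refine E3 ⟨u, Finset.mem_univ _, hrun, hmass, ?_⟩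
    rw [add_sub_cancel, ← Real.exp_nat_mul]
    refine Real.exp_le_exp.2 ?_
    nlinarith [not_le.1 h]
  -- Loads up to log n cap the individual weights at n^(1/4), so the average weight concentrates
  -- with exponent of order n^(3/4).
  have hZ : ∀ u, (1 + 1 / 4 : ℝ) ^ (x.cfg.node u).store.length ≤ Real.exp (1 / 4 * Real.log n) := by
    intro u
    have h1 : (1 + 1 / 4 : ℝ) ≤ Real.exp (1 / 4) := by
      linarith [Real.add_one_le_exp (1 / 4 : ℝ)]
    calc (1 + 1 / 4 : ℝ) ^ (x.cfg.node u).store.length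
        ≤ Real.exp (1 / 4) ^ (x.cfg.node u).store.length := by gcongr
      _ = Real.exp ((x.cfg.node u).store.length * (1 / 4)) := by rw [Real.exp_nat_mul]
      _ ≤ _ := Real.exp_le_exp.2 (by linarith [hload u])
  have hlw : ∀ m, i + m < T → ∑ u, budgetWeight (1 / 4) 800 n d (m + 1) x.mass *
      loadWeight (1 / 4) d (m + 1) (x.cfg.node u).orig.length (x.cfg.node u).extra.length ≤
      3 * n * Real.exp (1 / 4 * 800) := by
    intro m hm
    by_contra h
    exact E4 ⟨m, Finset.mem_range.2 (by omega), hrun, hcons.mass_nonneg, hZ, (not_le.1 h).le⟩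
  have hbalx : Balanced 𝒮 d x := by
    refine ⟨hload, fun j => ?_, fun j => ?_, ?_, hcons.orig⟩
    · by_contra h
      exact E5 ⟨j, Finset.mem_univ _, hrun, hmass, hcons.setMass_nonneg j, (not_le.1 h).le⟩
    · by_contra h
      exact E6 ⟨j, Finset.mem_univ _, hrun, (not_le.1 h).le⟩
    · refine Occupied.pullMass ?_
      by_contra h
      exact E7 ⟨hrun, h⟩
  refine hx (Or.inr ⟨hcons, hspread, hbalx, hlw, fun hi' => ?_⟩)
  rcases hi'.lt_or_eq with h | h
  · exact hlate h
  · rcases hf : x.found with - | t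
    · exact absurd ⟨h.symm, hrun, hbalx, hf⟩ E8
    · exact ⟨t, by rw [h]; exact hcons.found_lt t hf, rfl⟩

end

/-! ### The probability of success -/

theorem mul_ofReal_le_of_log {s : ℕ} {y z : ℝ} (h : Real.log s ≤ y - z) :
    (s : ℝ≥0∞) * ENNReal.ofReal (Real.exp (-y)) ≤ ENNReal.ofReal (Real.exp (-z)) := by
  rcases Nat.eq_zero_or_pos s with h0 | h0
  · rw [h0]; simp
  · have hs : (0 : ℝ) < s := by exact_mod_cast h0
    rw [← ENNReal.ofReal_natCast, ← ENNReal.ofReal_mul hs.le]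
    refine ENNReal.ofReal_le_ofReal ?_
    nth_rw 1 [← Real.exp_log hs]
    rw [← Real.exp_add]
    exact Real.exp_le_exp.2 (by linarith)

section
variable {n s : ℕ} [NeZero n] {𝒮 : Fin s → Finset (Fin n)} {d : ℕ} {c : ℝ}

/-- Each of the eight error terms of an iteration is at most n^(-(a+3)); the factor 8T ≤ n · n²
leaves n^(-a). -/
theorem ex_not_finished_le {w a : ℝ} {T₁ T : ℕ} (ha : 0 < a) (hr : Regime n s d c)
    {H : Finset (Fin n)} (hH : IsHittingSet 𝒮 H) (hd : H.card = d) (hc : 8 * (a + 8) ≤ c)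
    (hw : (numPulls c n s d : ℝ) + Real.log n + (c * Real.log n + 1) ≤ w)
    (hT₁ : 100 * (a + 4) * d * Real.log n ≤ T₁) (hT : T₁ + ⌈c * Real.log n⌉₊ + 1 = T)
    (hTn : (T : ℝ) ≤ n ^ 2)
    (hdn : 1000 * (a + 3) * d * (Real.log n + Real.log (12 * d * s)) ≤ n)
    (h2 : 2 * (a + 8) * Real.log n ^ 2 ≤ Real.exp (1 / 4 * Real.log n))
    (h3 : 1 + Real.exp ((Real.exp (a + 5) - 1) * 800) ≤ n) :
    (ex (chain (trackedInit n s) (trackedStep 𝒮 d c) T) fun x => ind (¬ Finished 𝒮 d w x)) ≤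
      ENNReal.ofReal (Real.exp (-(a * Real.log n))) := by
  have hn0 : (0 : ℝ) < n := by exact_mod_cast Nat.pos_of_ne_zero (NeZero.ne n)
  have hl := hr.one_le_log
  have hd1 : (1 : ℝ) ≤ d := by exact_mod_cast hr.one_le_d
  have hs1 : (1 : ℝ) ≤ s := by exact_mod_cast hr.one_le_s
  have hΛ := one_le_log_twelve hr.one_le_d hr.one_le_s
  have hsΛ : Real.log s ≤ Real.log (12 * d * s) :=
    Real.log_le_log (by linarith) (by nlinarith)
  set Λ := Real.log (12 * d * s) with hΛdef
  have hnL : Real.exp (Real.log n) = n := Real.exp_log hn0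
  set L := Real.log n with hL
  have hT0 : 0 < T := by omega
  have hTL : Real.log T ≤ 2 * L := by
    have h4 : Real.log T ≤ Real.log ((n : ℝ) ^ 2) :=
      Real.log_le_log (by exact_mod_cast hT0) hTn
    rwa [Real.log_pow] at h4
  have hLL : L ≤ L ^ 2 := by nlinarith
  have hq1 : Real.exp (1 / 4 * L) ≤ Real.exp (3 / 4 * L) := Real.exp_le_exp.2 (by linarith)
  have hq2 : Real.exp (1 / 4 * L) ≤ n := by
    rw [← hnL]; exact Real.exp_le_exp.2 (by linarith)
  have hk : 2 * (a + 8) * L ≤ 2 * (a + 8) * L ^ 2 := by gcongr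
  have haL : 0 ≤ a * L := by positivity
  -- The load bound loses one power of n to the union over the nodes and one to its constant, which
  -- explains a + 5.
  have B := fun i (hi : i ∈ Finset.range T) => killed_not_good_le (T₁ := T₁) (a := a + 5)
    (by linarith) hr hH hd hw (Finset.mem_range.1 hi)
  have t1 : ENNReal.ofReal (T * (n ^ 2 * Real.exp (-((c * L - 1) / 8)))) ≤
      ENNReal.ofReal (Real.exp (-((a + 3) * L))) := by
    rw [ENNReal.ofReal_mul (Nat.cast_nonneg T), ENNReal.ofReal_natCast]
    have : (n : ℝ) ^ 2 * Real.exp (-((c * L - 1) / 8)) = Real.exp (-((c * L - 1) / 8 - 2 * L)) := by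
      nth_rw 1 [← hnL]
      rw [← Real.exp_nat_mul, ← Real.exp_add]
      congr 1; push_cast; ring
    rw [this]
    refine mul_ofReal_le_of_log ?_
    have : 8 * (a + 8) * L ≤ c * L := by gcongr
    linarith
  have t2 : ENNReal.ofReal (Real.exp (-(3 / 4 * (n / L)))) ≤
      ENNReal.ofReal (Real.exp (-((a + 3) * L))) := by
    refine ENNReal.ofReal_le_ofReal (Real.exp_le_exp.2 (neg_le_neg ?_))
    have : 2 * (a + 8) * L ≤ n / L := by
      rw [le_div_iff₀ (by linarith)]; nlinarith
    nlinarith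
  have t3 : n * ENNReal.ofReal ((1 + Real.exp ((Real.exp (a + 5) - 1) * 800)) /
      Real.exp ((a + 5) * L)) ≤ ENNReal.ofReal (Real.exp (-((a + 3) * L))) := by
    have h4 : (1 + Real.exp ((Real.exp (a + 5) - 1) * 800)) / Real.exp ((a + 5) * L) ≤
        Real.exp (-((a + 4) * L)) := by
      rw [div_le_iff₀ (Real.exp_pos _), ← Real.exp_add]
      refine h3.trans_eq ?_
      rw [← hnL]; congr 1; ring
    refine (mul_le_mul_right (ENNReal.ofReal_le_ofReal h4) _).trans (mul_ofReal_le_of_log ?_)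
    linarith
  have t4 : T * ENNReal.ofReal (Real.exp (-(n / (2 * Real.exp (1 / 4 * L))))) ≤
      ENNReal.ofReal (Real.exp (-((a + 3) * L))) := by
    refine mul_ofReal_le_of_log ?_
    have : (n : ℝ) / (2 * Real.exp (1 / 4 * L)) = Real.exp (3 / 4 * L) / 2 := by
      rw [div_eq_div_iff (by positivity) (by norm_num), ← hnL, mul_comm 2, ← mul_assoc,
        ← Real.exp_add]
      congr 2; ring
    rw [this]
    linarith
  have t5 : s * ENNReal.ofReal (Real.exp (-(1 / 1000 * (n / d)))) ≤
      ENNReal.ofReal (Real.exp (-((a + 3) * L))) := by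
    refine mul_ofReal_le_of_log ?_
    have : 1000 * (a + 3) * (L + Λ) ≤ n / d := by
      rw [le_div_iff₀ (by linarith)]; linarith
    nlinarith
  have t7 : ENNReal.ofReal (2 * 64 * (1 / 2) ^ n) ≤
      ENNReal.ofReal (Real.exp (-((a + 3) * L))) := by
    refine ENNReal.ofReal_le_ofReal ?_
    have h4 := one_sub_pow_le_exp (x := 1 / 2) (by norm_num) n
    norm_num at h4
    have h5 : (128 : ℝ) ≤ Real.exp 5 := by
      have : Real.exp 5 = Real.exp 1 ^ 5 := by rw [← Real.exp_nat_mul]; norm_num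
      rw [this]
      have h6 : (2.7 : ℝ) ≤ Real.exp 1 := by linarith [Real.exp_one_gt_d9]
      calc (128 : ℝ) ≤ 2.7 ^ 5 := by norm_num
        _ ≤ _ := by gcongr
    calc (2 : ℝ) * 64 * (1 / 2) ^ n ≤ Real.exp 5 * Real.exp (-(n / 2)) := by
          norm_num
          gcongr
          refine h4.trans_eq ?_
          congr 1; ring
      _ = Real.exp (5 - n / 2) := by rw [← Real.exp_add]; congr 1
      _ ≤ _ := Real.exp_le_exp.2 (by nlinarith)
  have t8 : ENNReal.ofReal (n * Real.exp (-(T₁ / (100 * d)))) ≤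
      ENNReal.ofReal (Real.exp (-((a + 3) * L))) := by
    rw [ENNReal.ofReal_mul hn0.le, ENNReal.ofReal_natCast]
    refine mul_ofReal_le_of_log ?_
    have : (a + 4) * L ≤ T₁ / (100 * d) := by
      rw [le_div_iff₀ (by linarith)]; linarith
    linarith
  set E := ENNReal.ofReal (Real.exp (-((a + 3) * L))) with hE
  have hB : ∀ i ∈ Finset.range T, (killed (trackedInit n s) (trackedStep 𝒮 d c)
      (Good 𝒮 d c w T₁ T) i fun x => ind (¬ Good 𝒮 d c w T₁ T i x)) ≤ 8 * E := by
    intro i hi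
    refine (B i hi).trans ?_
    calc _ ≤ 0 + (E + (E + (E + (E + (E + (E + (E + E))))))) := by
          gcongr
      _ = 8 * E := by ring
  refine (ex_chain_le _ _ (Good 𝒮 d c w T₁ T) T fun x => ind_le_one _).trans ?_
  calc _ ≤ (∑ _i ∈ Finset.range T, 8 * E) + 0 :=
        add_le_add (Finset.sum_le_sum hB) (killed_not_finished (by linarith [hr.le_c]) hw hT)
    _ = ((8 * T : ℕ) : ℝ≥0∞) * E := by
        rw [Finset.sum_const, Finset.card_range, nsmul_eq_mul, add_zero]
        push_cast; ring
    _ ≤ _ := by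
        refine mul_ofReal_le_of_log ?_
        push_cast
        rw [Real.log_mul (by norm_num) (by exact_mod_cast hT0.ne')]
        have h8 : Real.log 8 ≤ L := by
          refine Real.log_le_log (by norm_num) ?_
          have := hr.hundred_mul_le
          linarith
        linarith

theorem ofReal_one_sub_le_of_finished {w e K : ℝ} {T : ℕ} (he : 0 ≤ e)
    (hK : (sampleSize d s : ℝ) ≤ K)
    (h : (ex (chain (trackedInit n s) (trackedStep 𝒮 d c) T) fun x => ind (¬ Finished 𝒮 d w x)) ≤
      ENNReal.ofReal e) :
    ENNReal.ofReal (1 - e) ≤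
      (run 𝒮 d c T).toOuterMeasure {γ | Success (IsHittingSet 𝒮) K w γ} := by
  rw [toOuterMeasure_eq_ex, ex_run]
  have h1 := ex_ind_compl (chain (trackedInit n s) (trackedStep 𝒮 d c) T) (Finished 𝒮 d w)
  calc ENNReal.ofReal (1 - e) = 1 - ENNReal.ofReal e := by
        rw [ENNReal.ofReal_sub _ he, ENNReal.ofReal_one]
    _ ≤ ex (chain (trackedInit n s) (trackedStep 𝒮 d c) T) fun x => ind (Finished 𝒮 d w x) := by
        rw [tsub_le_iff_right, ← h1]
        gcongr
    _ ≤ _ := by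
        refine ex_mono _ fun x => ind_mono fun hx => ⟨fun v => ?_, hx.peak_le⟩
        obtain ⟨B, h1, h2, h3⟩ := hx.out v
        exact ⟨B, h1, h2, le_trans (by exact_mod_cast h3) hK⟩

theorem log_twelve_le {d s : ℕ} (hd : 1 ≤ d) (hs : 1 ≤ s) :
    Real.log (12 * d * s) ≤ 4 * Real.log (2 * d * s) ∧ 1 / 2 ≤ Real.log (2 * d * s) := by
  have h1 : (1 : ℝ) ≤ d * s := by exact_mod_cast Nat.mul_pos hd hs
  have hlog : 0 ≤ Real.log (d * s) := Real.log_nonneg h1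
  have h2 := Real.log_two_gt_d9
  have h12 : Real.log 12 ≤ 4 * Real.log 2 := by
    have : 4 * Real.log 2 = Real.log (2 ^ 4) := by rw [Real.log_pow]; norm_num
    rw [this]
    exact Real.log_le_log (by norm_num) (by norm_num)
  have h0 : (d : ℝ) * s ≠ 0 := by linarith
  have e1 : Real.log (12 * d * s) = Real.log 12 + Real.log (d * s) := by
    rw [mul_assoc, Real.log_mul (by norm_num) h0]
  have e2 : Real.log (2 * d * s) = Real.log 2 + Real.log (d * s) := by
    rw [mul_assoc, Real.log_mul (by norm_num) h0]
  rw [e1, e2]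
  constructor <;> linarith

/-- The sizes for which the analysis applies. -/
theorem mul_log_add_le {K ε : ℝ} (hK : 1 ≤ K) (hε : ε * (4 * K) ≤ 1) (hd : 1 ≤ d) (hs : 1 ≤ s)
    (h : (d : ℝ) * Real.log (12 * d * s) ≤ ε * n)
    (hL : 2 * K * Real.log n ≤ Real.exp (1 / 4 * Real.log n)) :
    K * d * (Real.log n + Real.log (12 * d * s)) ≤ n := by
  have hn0 : (0 : ℝ) < n := by exact_mod_cast Nat.pos_of_ne_zero (NeZero.ne n)
  have hd1 : (1 : ℝ) ≤ d := by exact_mod_cast hd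
  have hs1 : (1 : ℝ) ≤ s := by exact_mod_cast hs
  have hnL : Real.exp (Real.log n) = n := Real.exp_log hn0
  have hL0 : 0 ≤ Real.log n := Real.log_natCast_nonneg n
  set L := Real.log n with hLdef
  have hdL : Real.log d ≤ Real.log (12 * d * s) := Real.log_le_log (by linarith) (by nlinarith)
  set Λ := Real.log (12 * d * s) with hΛdef
  have h1 : K * (d * Λ) ≤ n / 4 := by
    calc K * (d * Λ) ≤ K * (ε * n) := by gcongr
      _ = ε * (4 * K) * n / 4 := by ring
      _ ≤ 1 * n / 4 := by gcongr
      _ = n / 4 := by ring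
  -- For d ≤ √n the term d log n is far below n. Otherwise log n < 2 log d ≤ 2Λ, and the assumption
  -- on dΛ covers it.
  rcases le_or_gt (Real.log d) (L / 2) with h2 | h2
  · have h3 : (d : ℝ) ≤ Real.exp (1 / 2 * L) := by
      rw [← Real.exp_log (show (0 : ℝ) < d by linarith)]
      exact Real.exp_le_exp.2 (by linarith)
    have h4 : 2 * K * L ≤ Real.exp (1 / 2 * L) :=
      hL.trans (Real.exp_le_exp.2 (by linarith))
    have h5 : d * (2 * K * L) ≤ n := by
      calc d * (2 * K * L) ≤ Real.exp (1 / 2 * L) * Real.exp (1 / 2 * L) := by gcongr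
        _ = n := by rw [← Real.exp_add, ← hnL]; congr 1; ring
    nlinarith
  · have h3 : L ≤ 2 * Λ := by linarith
    have h4 : K * (d * L) ≤ K * (d * (2 * Λ)) := by gcongr
    nlinarith

/-- The algorithm finds a small hitting set with high probability. -/
theorem success_of_small_hitting_set {a c : ℝ} (ha : 0 < a) (hc : 200 + 8 * (a + 8) ≤ c) :
    ∃ C : ℝ, 0 < C ∧ ∃ ε : ℝ, 0 < ε ∧
      ∀ (n : ℕ) [NeZero n] (s d : ℕ) (𝒮 : Fin s → Finset (Fin n)),
        1 ≤ s → IsMinHittingSetSize 𝒮 d → (d : ℝ) * Real.log (12 * d * s) ≤ ε * n →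
        ∃ T : ℕ, (T : ℝ) ≤ C * (d * Real.log n) ∧
          ENNReal.ofReal (1 - 1 / (n : ℝ) ^ a) ≤
            (run 𝒮 d c T).toOuterMeasure
              {γ | Success (IsHittingSet 𝒮) (C * (d * Real.log (2 * d * s)))
                (C * (d * Real.log (2 * d * s) + Real.log n)) γ} := by
  set C : ℝ := 100 * (a + 4) + 40 * c with hC
  -- The first summand serves the deviations of order n/d, the second one the bound n/20 for the
  -- number of pulls.
  set K₁ : ℝ := 1000 * (a + 3) + 200 * c with hK₁
  -- The sum of all constants k for which k log² n ≤ n^(1/4) will be needed.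
  set K : ℝ := 2 * K₁ + 2 * (a + 8) + C + (1 + Real.exp ((Real.exp (a + 5) - 1) * 800)) with hK
  have hc0 : 264 ≤ c := by linarith
  have hC0 : 0 < C := by linarith
  have hexp0 := Real.exp_pos ((Real.exp (a + 5) - 1) * 800)
  have hK0 : 1 ≤ K := by linarith
  -- As dΛ ≥ 1, this choice of ε forces log n ≥ 384K, so small n never have to be treated.
  refine ⟨C, hC0, Real.exp (-(384 * K)), Real.exp_pos _, ?_⟩
  intro n _ s d 𝒮 hs hmin hsmall
  obtain ⟨⟨H, hH, hHd⟩, -⟩ := hmin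
  have hd : 1 ≤ d := by
    rw [← hHd, Nat.one_le_iff_ne_zero, Finset.card_ne_zero]
    obtain ⟨y, hy⟩ := hH ⟨0, hs⟩
    exact ⟨y, (Finset.mem_inter.1 hy).2⟩
  have hn0 : (0 : ℝ) < n := by exact_mod_cast Nat.pos_of_ne_zero (NeZero.ne n)
  have hd1 : (1 : ℝ) ≤ d := by exact_mod_cast hd
  have hΛ := one_le_log_twelve hd hs
  have hnL : Real.exp (Real.log n) = n := Real.exp_log hn0
  have hL : 384 * K ≤ Real.log n := by
    rw [Real.le_log_iff_exp_le hn0]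
    have h1 : 1 ≤ Real.exp (-(384 * K)) * n := le_trans (by nlinarith) hsmall
    calc Real.exp (384 * K) = Real.exp (384 * K) * 1 := (mul_one _).symm
      _ ≤ Real.exp (384 * K) * (Real.exp (-(384 * K)) * n) := by gcongr
      _ = n := by rw [← mul_assoc, ← Real.exp_add]; simp
  have hL1 : 1 ≤ Real.log n := by linarith
  -- From exp(x) ≥ x³/6 at x = (log n)/4, where 6 · 4³ = 384.
  have hKL : K * Real.log n ^ 2 ≤ Real.exp (1 / 4 * Real.log n) := by
    have h1 := Real.pow_div_factorial_le_exp (1 / 4 * Real.log n) (by linarith) 3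
    refine le_trans ?_ h1
    have : ((Nat.factorial 3 : ℕ) : ℝ) = 6 := by norm_num [Nat.factorial]
    rw [this]
    have h2 : 384 * K * Real.log n ^ 2 ≤ Real.log n * Real.log n ^ 2 := by gcongr
    linarith
  have hLL : Real.log n ≤ Real.log n ^ 2 := by nlinarith
  have hq : Real.exp (1 / 4 * Real.log n) ≤ n := by
    nth_rw 2 [← hnL]; exact Real.exp_le_exp.2 (by linarith)
  have hKLn : ∀ k, 0 ≤ k → k ≤ K → k * Real.log n ^ 2 ≤ Real.exp (1 / 4 * Real.log n) := by
    intro k _ hk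
    refine le_trans ?_ hKL
    gcongr
  have hsize := mul_log_add_le (K := K₁) (by linarith) (ε := Real.exp (-(384 * K))) (by
      have h1 := Real.add_one_le_exp (384 * K)
      rw [Real.exp_neg, inv_mul_le_iff₀ (Real.exp_pos _)]
      linarith) hd hs hsmall (by
      have h1 := hKLn (2 * K₁) (by linarith) (by linarith)
      have h2 : 2 * K₁ * Real.log n ≤ 2 * K₁ * Real.log n ^ 2 := by gcongr
      linarith)
  obtain ⟨h12, hhalf⟩ := log_twelve_le hd hs
  set Λ := Real.log (12 * d * s) with hΛdef
  set ℓ := Real.log (2 * d * s) with hℓdef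
  set L := Real.log n with hLdef
  have hdΛ : d * Λ ≤ 4 * (d * ℓ) := by
    have h1 : d * Λ ≤ d * (4 * ℓ) := by gcongr
    linarith
  have hdℓ : 1 ≤ 2 * (d * ℓ) := by
    have h1 : (1 : ℝ) * (1 / 2) ≤ d * ℓ := by gcongr
    linarith
  have hdL : L ≤ d * L := le_mul_of_one_le_left (by linarith) hd1
  have hr : (sampleSize d s : ℝ) ≤ 6 * d * Λ + 1 := (Nat.ceil_lt_add_one (by positivity)).le
  have hNup : (numPulls c n s d : ℝ) ≤ c * (6 * d * Λ + 1 + L) + 1 := by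
    refine (Nat.ceil_lt_add_one (by positivity)).le.trans ?_
    gcongr
  have hcd : c * (6 * d * Λ + 1 + L) + 1 ≤ 10 * c * (d * (L + Λ)) := by
    have h1 : 1 ≤ d * Λ := one_le_mul_of_one_le_of_one_le hd1 hΛ
    have h2 : c * 1 ≤ c * (d * Λ) := by gcongr
    have h3 : c * L ≤ c * (d * L) := by gcongr
    have h4 : 1 ≤ c * (d * Λ) := by linarith
    have h5 : 0 ≤ c * (d * L) := by positivity
    linarith
  have hXn : K₁ * (d * (L + Λ)) ≤ n := by linarith
  have hX0 : 0 ≤ d * (L + Λ) := by positivity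
  have hX1 : d ≤ d * (L + Λ) := le_mul_of_one_le_right (by linarith) (by linarith)
  have hcX : c * (d * (L + Λ)) ≤ n / 200 := by
    have : 0 ≤ 1000 * (a + 3) * (d * (L + Λ)) := by positivity
    rw [hK₁] at hXn
    linarith
  have hreg : Regime n s d c := by
    refine ⟨hd, hs, by linarith, by linarith, ?_, hL1⟩
    have : 100 * (d * (L + Λ)) ≤ c * (d * (L + Λ)) := by gcongr; linarith
    linarith
  set T₁ := ⌈100 * (a + 4) * d * L⌉₊ with hT₁
  set T := T₁ + ⌈c * L⌉₊ + 1 with hT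
  have hTle : (T : ℝ) ≤ C * (d * L) := by
    have h1 : (T₁ : ℝ) < 100 * (a + 4) * d * L + 1 := Nat.ceil_lt_add_one (by positivity)
    have h2 : (⌈c * L⌉₊ : ℝ) < c * L + 1 := Nat.ceil_lt_add_one (by positivity)
    have h3 : c * L ≤ c * (d * L) := by gcongr
    have h4 : 1 ≤ d * L := hL1.trans hdL
    have h5 : c * 1 ≤ c * (d * L) := by gcongr
    rw [hT, hC]
    push_cast
    linarith
  refine ⟨T, hTle, ?_⟩
  set w := (numPulls c n s d : ℝ) + L + (c * L + 1) with hw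
  have hfin := ex_not_finished_le (w := w) ha hreg hH hHd (by linarith) le_rfl (Nat.le_ceil _)
    (T := T) rfl (by
      refine hTle.trans ?_
      have h1 := hKLn C hC0.le (by linarith)
      have h2 : C * L ≤ n := by
        have h4 : C * L ≤ C * L ^ 2 := by gcongr
        linarith
      have h3 : (d : ℝ) ≤ n := by linarith [hreg.hundred_mul_le]
      calc C * (d * L) = d * (C * L) := by ring
        _ ≤ n * n := by gcongr
        _ = _ := by ring) (by
      have : 0 ≤ c * (d * (L + Λ)) := by positivity
      rw [hK₁] at hXn
      linarith) (hKLn _ (by linarith) (by linarith)) (by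
      have h1 := hKLn (1 + Real.exp ((Real.exp (a + 5) - 1) * 800)) (by linarith) (by linarith)
      have h2 : (1 + Real.exp ((Real.exp (a + 5) - 1) * 800)) * 1 ≤
        (1 + Real.exp ((Real.exp (a + 5) - 1) * 800)) * L ^ 2 := by gcongr; linarith
      linarith)
  have he : Real.exp (-(a * L)) = 1 / (n : ℝ) ^ a := by
    rw [Real.exp_neg, Real.rpow_def_of_pos hn0, one_div, mul_comm]
  rw [← he]
  have hcℓ : c * 1 ≤ c * (2 * (d * ℓ)) := by gcongr
  have hcΛ : c * (d * Λ) ≤ c * (4 * (d * ℓ)) := by gcongr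
  have haℓ : 0 ≤ 100 * (a + 4) * (d * ℓ) := by positivity
  have haL : 0 ≤ 100 * (a + 4) * L := by positivity
  have hcL : L ≤ c * L := le_mul_of_one_le_left (by linarith) (by linarith)
  refine (ofReal_one_sub_le_of_finished (K := C * (d * ℓ)) (Real.exp_pos _).le ?_ hfin).trans ?_
  · have hc2 : 1 * (d * ℓ) ≤ c * (d * ℓ) := by
      gcongr
      linarith
    rw [hC]
    linarith
  · have hwC : w ≤ C * (d * ℓ + L) := by
      rw [hw, hC]
      linarith
    exact MeasureTheory.OuterMeasure.mono _ fun γ hγ => ⟨hγ.1, hγ.2.trans hwC⟩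

end

/-! ### Set covers as hitting sets of the dual family, and the theorem -/

theorem isHittingSet_dualFamily {m n : ℕ} (𝒰 : Fin n → Finset (Fin m)) (K : Finset (Fin n)) :
    IsHittingSet (dualFamily 𝒰) K ↔ IsSetCover 𝒰 K := by
  simp only [IsHittingSet, IsSetCover, dualFamily, Finset.eq_univ_iff_forall, Finset.mem_biUnion,
    Finset.Nonempty, Finset.mem_inter, Finset.mem_filter, Finset.mem_univ, true_and]
  exact forall_congr' fun i => ⟨fun ⟨j, h1, h2⟩ => ⟨j, h2, h1⟩, fun ⟨j, h1, h2⟩ => ⟨j, h2, h1⟩⟩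

end Gossip

end

theorem theorem3 :
    ∀ a : ℝ, 0 < a → ∃ c₀ : ℝ, 0 < c₀ ∧ ∀ c : ℝ, c₀ ≤ c →
      ∃ C : ℝ, 0 < C ∧ ∃ ε : ℝ, 0 < ε ∧
        -- hitting set: `n` points, `n` nodes, `s` sets, minimum hitting set size `d`
        (∀ (n : ℕ) [NeZero n] (s d : ℕ) (𝒮 : Fin s → Finset (Fin n)),
          1 ≤ s → IsMinHittingSetSize 𝒮 d →
          (d : ℝ) * Real.log (12 * d * s) ≤ ε * n →
          ∃ T : ℕ, (T : ℝ) ≤ C * (d * Real.log n) ∧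
            ENNReal.ofReal (1 - 1 / (n : ℝ) ^ a) ≤
              (Gossip.run 𝒮 d c T).toOuterMeasure
                {γ | Gossip.Success (IsHittingSet 𝒮)
                  (C * (d * Real.log (2 * d * s)))
                  (C * (d * Real.log (2 * d * s) + Real.log n)) γ}) ∧
        -- set cover: `n` sets, `n` nodes, `m` elements, minimum set cover size `d`
        (∀ (n : ℕ) [NeZero n] (m d : ℕ) (𝒰 : Fin n → Finset (Fin m)),
          1 ≤ m → IsMinSetCoverSize 𝒰 d →
          (d : ℝ) * Real.log (12 * d * m) ≤ ε * n →
          ∃ T : ℕ, (T : ℝ) ≤ C * (d * Real.log n) ∧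
            ENNReal.ofReal (1 - 1 / (n : ℝ) ^ a) ≤
              (Gossip.run (dualFamily 𝒰) d c T).toOuterMeasure
                {γ | Gossip.Success (IsSetCover 𝒰)
                  (C * (d * Real.log (2 * d * m)))
                  (C * (d * Real.log (2 * d * m) + Real.log n)) γ}) := by
  intro a ha
  refine ⟨200 + 8 * (a + 8), by linarith, fun c hc => ?_⟩
  obtain ⟨C, hC, ε, hε, h⟩ := Gossip.success_of_small_hitting_set ha hc
  refine ⟨C, hC, ε, hε, h, fun n _ m d 𝒰 hm hmin hsmall => ?_⟩
  have hiff : IsHittingSet (dualFamily 𝒰) = IsSetCover 𝒰 :=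
    funext fun K => propext (Gossip.isHittingSet_dualFamily 𝒰 K)
  have hmin' : IsMinHittingSetSize (dualFamily 𝒰) d := by
    rw [IsMinHittingSetSize, hiff]
    exact hmin
  have h' := h n m d (dualFamily 𝒰) hm hmin' hsmall
  rw [hiff] at h'
  exact h'
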